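/- Let $X$ be a connected 2-complex, i.e. a connected compact Hausdorff space in which every point $x$ has a closed neighbourhood homeomorphic to the cone over a finite graph, with cone point $x$. A point is generic, resp. a ridge point, if this graph can be taken to be a circle, resp. two vertices joined by $m\ge 3$ edges; it is a boundary point if the graph can be taken to be a segment, and singular if it is of none of these three types. A link in $X$ is a nonempty finite family of closed curves in $X$ (parametrized by circles, up to reparametrization) consisting of generic and ridge points, whose only multiple points are finitely many double transversal crossings at generic points, and which at every ridge point pass transversally to the ridge from one branch of $X$ to a different one; at every crossing two opposite areas of the four adjacent areas carry a dot. Let $\#L$ be the set of crossings of $L$ and $\operatorname{cro}(L)=|\#L|$. For $C\subset \#L$ let $|L,C|\ge 1$ be the number of closed curves obtained from $L$ by smoothing every crossing so that the two dotted areas are merged if the crossing is in $C$, and the two undotted areas are merged otherwise. Set $$\langle L\rangle=\sum_{C\subset \#L}(-A^2-A^{-2})^{|L,C|-1}A^{2|C|-\operatorname{cro}(L)}\in\mathbb Z[A,A^{-1}].$$ Direct the components of $L$. The sign of a crossing is $+1$ if the dots lie in the area between the two outgoing branches and in the area between the two incoming ones, and $-1$ otherwise. Let $\operatorname{wri}(L)$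 be the sum of the signs of the self-crossings of all components; it does not depend on the directions (and neither $\langle L\rangle$ nor $\operatorname{wri}(L)$ depends on the parametrizations). The basic moves replace the part of a link in a set $D\subset X$ and fix the link outside $D$. For $M_1^\pm,M_2,M_3$, the set $D$ is a closed disc in the generic part of $X$: $M_1^{\pm}$ replaces an embedded arc by an arc with one self-crossing, of sign $\pm1$; $M_2$ replaces two disjoint embedded arcs by two embedded arcs crossing twice, such that exactly one of the two corners of the resulting bigon is dotted; $M_3$ acts on three embedded arcs crossing pairwise once, reverses the order of the two crossings on every arc, keeps the dots (in the areas facing the same endpoints), and requires the corners of the triangle to be neither all dotted nor all undotted. For $M_4$ and $M_5^\pm$, $D$ is a disc formed by half-discs in two branches along the ridge: $M_4$ pushes an embedded arc lying in one branch across the ridge into the other branch (creating two ridge points); $M_5^\pm$ pushes a crossing of two arcs, both of which go from the first branch to the second, across the ridge, where the sign $\pm$ stands for the two choices of dots. For $M_6$, $D$ is formed by half-discs in three branches, and an embedded arc going directly from the first branch to the third is replaced by an embedded arc that passes through the second branch on the way. For $M_7$, $D$ is the cone over a circle embedded in the base graph of a cone neighbourhood of a singular point, and an embedded arc in $D$ with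 endpoints on $\partial D$ is replaced by another one with the same endpoints. Two links are isotopic if they are related by a finite sequence of ambient isotopies of $X$, basic moves and inverses of basic moves. Then: 1. $\langle L\rangle$ is unchanged by the moves $M_2,M_3,M_4,M_5^\pm,M_6,M_7$. 2. Under the moves $M_1^{\pm}$ (which change $\operatorname{wri}$ by $\pm 1$) $\langle L\rangle$ is multiplied by $-A^{\pm 3}$. 3. The normalized bracket polynomial $(-A^3)^{-\operatorname{wri}(L)}\langle L\rangle$ is an isotopy invariant of links in $X$. 4. Let $D$ be a diagram of a nonempty classical link in the oriented plane, with over/under-crossings, and let $f$ be an embedding of the plane onto an open subset of the generic part of $X$. Let $L$ be the local link obtained by transporting $D$ along $f$, where the dots are put in the two areas swept when the overpassing line at a crossing is rotated counterclockwise towards the underpassing line. Then $\langle L\rangle$ is Kauffman's bracket polynomial of $D$ (normalized to be $1$ on a circle without crossings), and $\operatorname{wri}(L)$ is the sum of the usual signs of the self-crossings of the components of $D$; hence $(-A^3)^{-\operatorname{wri}(L)}\langle L\rangle$ is Kauffman's bracket of $D$ normalized by the same factor. -/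

import Mathlib

open Filter Topology Set

namespace LinksInTwoComplexes

noncomputable section

/-! ### Finite graphs, cones and 2-complexes -/

/-- A finite graph: finitely many vertices and edges, multiple edges and loops allowed. -/
structure FiniteGraph where
  numVertices : ℕ
  numEdges : ℕ
  src : Fin numEdges → Fin numVertices
  tgt : Fin numEdges → Fin numVertices

/-- The endpoint `(e, 0)` of an edge is glued to its source, `(e, 1)` to its target. -/
inductive FiniteGraph.Glue (G : FiniteGraph) :
    Fin G.numVertices ⊕ (Fin G.numEdges × unitInterval) →
      Fin G.numVertices ⊕ (Fin G.numEdges × unitInterval) → Prop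
  | src (e : Fin G.numEdges) : FiniteGraph.Glue G (Sum.inr (e, 0)) (Sum.inl (G.src e))
  | tgt (e : Fin G.numEdges) : FiniteGraph.Glue G (Sum.inr (e, 1)) (Sum.inl (G.tgt e))

/-- The underlying topological space of a finite graph. -/
def FiniteGraph.Space (G : FiniteGraph) : Type := Quot G.Glue

instance (G : FiniteGraph) : TopologicalSpace G.Space :=
  inferInstanceAs (TopologicalSpace (Quot G.Glue))

/-- The graph `θ_m` with two vertices and `m` edges connecting them. In particular `θ_1` is a
segment and `θ_2` is a circle. -/
def theta (m : ℕ) : FiniteGraph where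
  numVertices := 2
  numEdges := m
  src := fun _ => 0
  tgt := fun _ => 1

/-- All points `(g, 0)` of the cylinder are glued to the cone point. -/
inductive ConeGlue (Γ : Type) : Unit ⊕ (Γ × unitInterval) → Unit ⊕ (Γ × unitInterval) → Prop
  | glue (g : Γ) : ConeGlue Γ (Sum.inr (g, 0)) (Sum.inl ())

/-- The cone over a topological space. -/
def Cone (Γ : Type) : Type := Quot (ConeGlue Γ)

instance (Γ : Type) [TopologicalSpace Γ] : TopologicalSpace (Cone Γ) :=
  inferInstanceAs (TopologicalSpace (Quot (ConeGlue Γ)))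

/-- The cone point. -/
def Cone.apex (Γ : Type) : Cone Γ := Quot.mk _ (Sum.inl ())

/-- The point of the cone represented by `(g, r)`. -/
def Cone.mk {Γ : Type} (g : Γ) (r : unitInterval) : Cone Γ := Quot.mk _ (Sum.inr (g, r))

section Spaces

variable {X : Type*} [TopologicalSpace X]

/-- `h` identifies `N`, a closed neighbourhood of `x`, with the cone over the graph `G`, carrying
`x` to the cone point. -/
def IsConeChart (x : X) (G : FiniteGraph) (N : Set X) (h : N ≃ₜ Cone G.Space) : Prop :=
  IsClosed N ∧ N ∈ 𝓝 x ∧ ∃ hx : x ∈ N, h ⟨x, hx⟩ = Cone.apex G.Space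

/-- `x` has a closed neighbourhood homeomorphic to the cone over `G`, with cone point `x`. -/
def HasConeNhd (x : X) (G : FiniteGraph) : Prop :=
  ∃ (N : Set X) (h : N ≃ₜ Cone G.Space), IsConeChart x G N h

variable (X) in
/-- A 2-complex: a compact Hausdorff space which is locally the cone over a finite graph. -/
def IsTwoComplex : Prop :=
  CompactSpace X ∧ T2Space X ∧ ∀ x : X, ∃ G : FiniteGraph, HasConeNhd x G

variable (X) in
/-- The interior of `X`: the set of generic points. -/
def interiorPts : Set X := {x | HasConeNhd x (theta 2)}

variable (X) in
/-- The boundary points of `X`. -/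
def boundaryPts : Set X := {x | HasConeNhd x (theta 1)}

variable (X) in
/-- The ridge of `X`. -/
def ridge : Set X := {x | ∃ m : ℕ, 3 ≤ m ∧ HasConeNhd x (theta m)}

variable (X) in
/-- The singular points of `X`. -/
def singularPts : Set X := {x | x ∉ interiorPts X ∧ x ∉ boundaryPts X ∧ x ∉ ridge X}

end Spaces

/-- The book with `m` pages: the union of `m` half-planes with a common boundary line, the
spine. A point has a coordinate along the spine and one nonnegative coordinate for each page, at
most one of which is nonzero. -/
def Book (m : ℕ) : Type :=
  {p : ℝ × (Fin m → ℝ) // (∀ i, 0 ≤ p.2 i) ∧ ∀ i j, i ≠ j → p.2 i = 0 ∨ p.2 j = 0}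

instance (m : ℕ) : TopologicalSpace (Book m) :=
  inferInstanceAs (TopologicalSpace {p : ℝ × (Fin m → ℝ) //
    (∀ i, 0 ≤ p.2 i) ∧ ∀ i j, i ≠ j → p.2 i = 0 ∨ p.2 j = 0})

/-- The union of `m` closed unit half-discs with a common diameter. For `m = 2` this is a disc
with a distinguished diameter. -/
def BookDisc (m : ℕ) : Type := {p : Book m // p.1.1 ^ 2 + ∑ i, p.1.2 i ^ 2 ≤ 1}

instance (m : ℕ) : TopologicalSpace (BookDisc m) :=
  inferInstanceAs (TopologicalSpace {p : Book m // p.1.1 ^ 2 + ∑ i, p.1.2 i ^ 2 ≤ 1})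

/-- The coordinate along the spine. -/
def BookDisc.along {m : ℕ} (p : BookDisc m) : ℝ := p.1.1.1

/-- The height above the spine on the page `i`. -/
def BookDisc.height {m : ℕ} (p : BookDisc m) (i : Fin m) : ℝ := p.1.1.2 i

/-! ### Families of closed curves -/

/-- The domain of a family of `n` closed curves: the disjoint union of `n` copies of the circle
`ℝ / ℤ`. -/
abbrev Source (n : ℕ) : Type := Fin n × UnitAddCircle

/-- The point reached from `s` by travelling the distance `u` along the circle, in the positive
direction for `ε = 1` and in the negative direction for `ε = -1`. -/
def ray {n : ℕ} (s : Source n) (ε : ℤˣ) (u : ℝ) : Source n :=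
  (s.1, s.2 + ((((ε : ℤ) : ℝ) * u : ℝ) : UnitAddCircle))

/-- The germ of the half-branch at `s` in the direction `ε`. -/
def halfNhds {n : ℕ} (s : Source n) (ε : ℤˣ) : Filter (Source n) := map (ray s ε) (𝓝[>] 0)

section Curves

variable {n : ℕ} {Y : Type*}

/-- The crossings of a family of closed curves. -/
def crossings (c : Source n → Y) : Set Y := {y | ∃ s t, s ≠ t ∧ c s = y ∧ c t = y}

/-- The crossings of the `i`-th curve of a family with itself. -/
def selfCrossings (c : Source n → Y) (i : Fin n) : Set Y :=
  {y | ∃ s t, s ≠ t ∧ s.1 = i ∧ t.1 = i ∧ c s = y ∧ c t = y}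

lemma crossings_finite (c : Source n → Y) (h : {s | ∃ t, t ≠ s ∧ c t = c s}.Finite) :
    (crossings c).Finite := by
  refine (h.image c).subset ?_
  rintro y ⟨s, t, hst, hs, ht⟩
  exact ⟨s, ⟨t, hst.symm, ht.trans hs.symm⟩, hs⟩

lemma selfCrossings_finite (c : Source n → Y) (h : {s | ∃ t, t ≠ s ∧ c t = c s}.Finite)
    (i : Fin n) : (selfCrossings c i).Finite := by
  refine (crossings_finite c h).subset ?_
  rintro y ⟨s, t, hst, -, -, hs, ht⟩
  exact ⟨s, t, hst, hs, ht⟩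

/-- The circles of the domain cut at all preimages of crossings. -/
def cutSource (c : Source n → Y) : Set (Source n) := {s | ∀ t, c t = c s → t = s}

/-- The edge (component of the cut domain) containing `p` ends with the half-branch at `s` in the
direction `ε`. -/
def EndsWith (c : Source n → Y) (p s : Source n) (ε : ℤˣ) : Prop :=
  ∀ᶠ q in halfNhds s ε, q ∈ connectedComponentIn (cutSource c) p

/-- Two points of the cut curves lie on the same edge, or on two edges which end with
half-branches that are rejoined. -/
def Rejoined (c : Source n → Y) (J : Source n → ℤˣ → Source n → ℤˣ → Prop)
    (p q : cutSource c) : Prop :=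
  (q : Source n) ∈ connectedComponentIn (cutSource c) p ∨
    ∃ s ε t δ, J s ε t δ ∧ EndsWith c p s ε ∧ EndsWith c q t δ

/-- The number of closed curves obtained from the family `c` by cutting it at every crossing and
joining there the half-branch at `s` in the direction `ε` with the half-branch at `t` in the
direction `δ` whenever `J s ε t δ`. -/
def smoothingCount (c : Source n → Y) (J : Source n → ℤˣ → Source n → ℤˣ → Prop) : ℕ :=
  Nat.card (Quot (Rejoined c J))

end Curves

/-! ### Links in 2-complexes -/

/-- A link in `X` with `n` components, given by parametrizations of its components.

An area adjacent to the crossing `curve s = curve t`, `s ≠ t`, is named by the two half-branches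
which bound it: `dotted s ε t δ` says that `s, t` are the two preimages of a crossing and that
the area between the half-branch at `s` in the direction `ε` and the half-branch at `t` in the
direction `δ` carries a dot. -/
structure Link (X : Type*) [TopologicalSpace X] (n : ℕ) where
  curve : Source n → X
  continuous_curve : Continuous curve
  mem_interior_or_ridge : ∀ s, curve s ∈ interiorPts X ∨ curve s ∈ ridge X
  finite_multiple : {s | ∃ t, t ≠ s ∧ curve t = curve s}.Finite
  double : ∀ r s t, curve r = curve s → curve s = curve t → r = s ∨ s = t ∨ r = t
  /-- At a crossing the two branches are the coordinate axes of a local chart of the interior. -/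
  transversal : ∀ s t, s ≠ t → curve s = curve t → curve s ∈ interiorPts X ∧
    ∃ φ : ℝ × ℝ → X, IsOpenEmbedding φ ∧ φ 0 = curve s ∧
      (∀ᶠ u : ℝ in 𝓝 0, curve (ray s 1 u) ∈ φ '' {p | p.2 = 0}) ∧
      (∀ᶠ u : ℝ in 𝓝 0, curve (ray t 1 u) ∈ φ '' {p | p.1 = 0})
  /-- At a ridge point (a point of the curves which is not generic) the curve runs from a page of a
  local book chart to another page along the line orthogonal to the spine. -/
  ridge_transversal : ∀ s, curve s ∉ interiorPts X →
    ∃ (m : ℕ) (β : Book m → X) (i j : Fin m), 3 ≤ m ∧ IsOpenEmbedding β ∧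
      (∃ o : Book m, o.1 = 0 ∧ β o = curve s) ∧ i ≠ j ∧
      (∀ᶠ u : ℝ in 𝓝[>] 0, curve (ray s 1 u) ∈ β '' {p | p.1.1 = 0 ∧ 0 < p.1.2 i}) ∧
      (∀ᶠ u : ℝ in 𝓝[>] 0, curve (ray s (-1) u) ∈ β '' {p | p.1.1 = 0 ∧ 0 < p.1.2 j})
  dotted : Source n → ℤˣ → Source n → ℤˣ → Prop
  dotted_crossing : ∀ s ε t δ, dotted s ε t δ → s ≠ t ∧ curve s = curve t
  dotted_symm : ∀ s ε t δ, dotted s ε t δ → dotted t δ s ε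
  /-- Of two neighbouring areas at a crossing exactly one is dotted (so opposite areas agree). -/
  dotted_neg : ∀ s ε t δ, s ≠ t → curve s = curve t → (dotted s ε t (-δ) ↔ ¬ dotted s ε t δ)

namespace Link

variable {X : Type*} [TopologicalSpace X] {n : ℕ}

/-- The finite set `#L` of crossings of `L`. -/
def crossingSet (L : Link X n) : Finset X := (crossings_finite L.curve L.finite_multiple).toFinset

/-- The finite set of self-crossings of the `i`-th component of `L`. -/
def selfCrossingSet (L : Link X n) (i : Fin n) : Finset X :=
  (selfCrossings_finite L.curve L.finite_multiple i).toFinset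

open Classical in
/-- The sign of a crossing with respect to the directions of the components given by the
parametrizations: `+1` if the dots lie in the area between the two outgoing half-branches and in
the area between the two incoming ones, and `-1` otherwise. -/
def sign (L : Link X n) (x : X) : ℤ :=
  if ∃ s t, L.curve s = x ∧ L.curve t = x ∧ L.dotted s 1 t 1 then 1 else -1

/-- The unoriented writhe: the sum over the components of the signs of their self-crossings. -/
def wri (L : Link X n) : ℤ := ∑ i, ∑ x ∈ L.selfCrossingSet i, L.sign x

/-- The smoothing determined by a set `C` of crossings. At a crossing in `C` the two dotted areas
are merged, so that half-branches bounding an area without a dot are joined; at the other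
crossings the two areas without dots are merged. -/
def smoothing (L : Link X n) (C : Finset X) (s : Source n) (ε : ℤˣ) (t : Source n) (δ : ℤˣ) :
    Prop :=
  s ≠ t ∧ L.curve s = L.curve t ∧
    ((L.curve s ∈ C ∧ ¬ L.dotted s ε t δ) ∨ (L.curve s ∉ C ∧ L.dotted s ε t δ))

/-- The number `|L, C|` of closed curves in the smoothing. -/
def numCurves (L : Link X n) (C : Finset X) : ℕ := smoothingCount L.curve (L.smoothing C)

open LaurentPolynomial in
/-- The bracket polynomial `⟨L⟩ ∈ ℤ[A, A⁻¹]`; here `A ^ k` is `T k`. -/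
def bracket (L : Link X n) : LaurentPolynomial ℤ :=
  ∑ C ∈ L.crossingSet.powerset,
    (-T 2 - T (-2)) ^ (L.numCurves C - 1) * T (2 * (C.card : ℤ) - (L.crossingSet.card : ℤ))

end Link

open LaurentPolynomial in
/-- The unit `-A³` of `ℤ[A, A⁻¹]`. -/
def negCube : (LaurentPolynomial ℤ)ˣ where
  val := -T 3
  inv := -T (-3)
  val_inv := by rw [neg_mul_neg, ← T_add]; simp
  inv_val := by rw [neg_mul_neg, ← T_add]; simp

/-- The normalized bracket polynomial `(-A³)^(-wri L) ⟨L⟩`. -/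
def Link.normalizedBracket {X : Type*} [TopologicalSpace X] {n : ℕ} (L : Link X n) :
    LaurentPolynomial ℤ :=
  ((negCube ^ (-L.wri) : (LaurentPolynomial ℤ)ˣ) : LaurentPolynomial ℤ) * L.bracket

/-! ### Moves -/

/-- An embedded directed arc in the domain of a family of curves. -/
structure Strand (n : ℕ) where
  start : Source n
  dir : ℤˣ
  len : ℝ
  len_pos : 0 < len
  len_lt_one : len < 1

/-- The point of the strand at distance `u` from its start. -/
def Strand.pos {n : ℕ} (σ : Strand n) (u : ℝ) : Source n := ray σ.start σ.dir u

section Moves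

variable {X : Type*} [TopologicalSpace X] {n : ℕ}

/-- `L` meets `D` along the arcs traced by the strands `σ`, which have their endpoints on `bd`. -/
structure MeetsAlong (L : Link X n) (D bd : Set X) {k : ℕ} (σ : Fin k → Strand n) : Prop where
  mem_iff : ∀ s, L.curve s ∈ D ↔ ∃ i, ∃ u ∈ Icc 0 (σ i).len, s = (σ i).pos u
  start_mem : ∀ i, L.curve ((σ i).pos 0) ∈ bd
  end_mem : ∀ i, L.curve ((σ i).pos (σ i).len) ∈ bd

/-- The interior points of the arcs do not lie on `bd`. -/
def MeetsProperly (L : Link X n) (bd : Set X) {k : ℕ} (σ : Fin k → Strand n) : Prop :=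
  ∀ i, ∀ u ∈ Ioo 0 (σ i).len, L.curve ((σ i).pos u) ∉ bd

/-- `L'` is obtained from `L` by replacing the arcs traced by the pairwise disjoint strands `σ` in
`D` by other arcs in `D` with the same endpoints, and by changing the dots in `D`. -/
structure Replaces (L L' : Link X n) (D bd : Set X) {k : ℕ} (σ : Fin k → Strand n) : Prop where
  disjoint : ∀ i j, ∀ u ∈ Icc 0 (σ i).len, ∀ v ∈ Icc 0 (σ j).len,
    (σ i).pos u = (σ j).pos v → i = j ∧ u = v
  meets : MeetsAlong L D bd σ
  meets' : MeetsAlong L' D bd σ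
  off : ∀ s, L.curve s ∉ D → L'.curve s = L.curve s
  start_eq : ∀ i, L'.curve ((σ i).pos 0) = L.curve ((σ i).pos 0)
  end_eq : ∀ i, L'.curve ((σ i).pos (σ i).len) = L.curve ((σ i).pos (σ i).len)
  dots_off : ∀ s ε t δ, L.curve s ∉ D → (L'.dotted s ε t δ ↔ L.dotted s ε t δ)

/-- The pairs of distinct points of the strands with the same image under `L` are exactly the
pairs described by `P` (in one of the two orders); here `P i u j v` refers to the points at
distance `u` on the strand `i` and at distance `v` on the strand `j`. -/
def CrossExactly (L : Link X n) {k : ℕ} (σ : Fin k → Strand n)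
    (P : Fin k → ℝ → Fin k → ℝ → Prop) : Prop :=
  ∀ i j, ∀ u ∈ Icc 0 (σ i).len, ∀ v ∈ Icc 0 (σ j).len,
    L.curve ((σ i).pos u) = L.curve ((σ j).pos v) ↔
      (i = j ∧ u = v) ∨ P i u j v ∨ P j v i u

/-- The strands are mapped by `L` to disjoint embedded arcs. -/
def NoCrossings (L : Link X n) {k : ℕ} (σ : Fin k → Strand n) : Prop :=
  CrossExactly L σ fun _ _ _ _ => False

/-- `D` is a closed disc embedded in the interior of `X`, with boundary circle `bd`. -/
def IsInteriorDisc (D bd : Set X) : Prop :=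
  ∃ φ : Metric.closedBall (0 : ℂ) 1 → X, Continuous φ ∧ Function.Injective φ ∧
    D = range φ ∧ bd = φ '' {z | ‖(z : ℂ)‖ = 1} ∧ range φ ⊆ interiorPts X

/-- `φ` embeds `m` half-discs with a common diameter in `X`: the diameter goes to the ridge, the
rest of the half-discs lies in the interior, so that the half-discs lie in different branches. -/
def IsRidgeDisc {m : ℕ} (φ : BookDisc m → X) : Prop :=
  Continuous φ ∧ Function.Injective φ ∧
    (∀ p, (∀ i, p.height i = 0) → φ p ∈ ridge X) ∧
    ∀ p i, 0 < p.height i → φ p ∈ interiorPts X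

/-- The union of the half-circles which bound the half-discs. -/
def ridgeDiscRim {m : ℕ} (φ : BookDisc m → X) : Set X :=
  φ '' {p | p.along ^ 2 + ∑ i, p.height i ^ 2 = 1}

/-- The half-disc in the branch `i`, without the diameter. -/
def halfDisc {m : ℕ} (φ : BookDisc m → X) (i : Fin m) : Set X := φ '' {p | 0 < p.height i}

/-- The moves `M₁⁺` (for `e = 1`) and `M₁⁻` (for `e = -1`): in a disc in the interior, an embedded
arc is replaced by an arc which crosses itself once, with crossing sign `e`. -/
def MoveOne (e : ℤˣ) (L L' : Link X n) : Prop :=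
  ∃ (D bd : Set X) (σ : Fin 1 → Strand n), IsInteriorDisc D bd ∧ Replaces L L' D bd σ ∧
    MeetsProperly L bd σ ∧ MeetsProperly L' bd σ ∧ NoCrossings L σ ∧
    ∃ p q : ℝ, 0 < p ∧ p < q ∧ q < (σ 0).len ∧
      CrossExactly L' σ (fun _ u _ v => u = p ∧ v = q) ∧
      (L'.dotted ((σ 0).pos p) (σ 0).dir ((σ 0).pos q) (σ 0).dir ↔ e = 1)

/-- The move `M₂`: in a disc in the interior, two disjoint embedded arcs are replaced by two
embedded arcs which cross each other twice, and thus form a bigon; of the two corners of the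
bigon exactly one is dotted. The strands are directed so that both meet the crossings in the same
order; the corners of the bigon are then between the half-branches going forward at the first
crossing and between those going backward at the second one. -/
def MoveTwo (L L' : Link X n) : Prop :=
  ∃ (D bd : Set X) (σ : Fin 2 → Strand n), IsInteriorDisc D bd ∧ Replaces L L' D bd σ ∧
    MeetsProperly L bd σ ∧ MeetsProperly L' bd σ ∧ NoCrossings L σ ∧
    ∃ p q : Fin 2 → ℝ, (∀ i, 0 < p i ∧ p i < q i ∧ q i < (σ i).len) ∧
      CrossExactly L' σ (fun i u j v => i = 0 ∧ j = 1 ∧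
        ((u = p 0 ∧ v = p 1) ∨ (u = q 0 ∧ v = q 1))) ∧
      (L'.dotted ((σ 0).pos (p 0)) (σ 0).dir ((σ 1).pos (p 1)) (σ 1).dir ↔
        ¬ L'.dotted ((σ 0).pos (q 0)) (-(σ 0).dir) ((σ 1).pos (q 1)) (-(σ 1).dir))

/-- In the picture of `M₃`: the strand `i` meets the strand `i + 1` at distance `p i` and the
strand `i + 2` at distance `q i`, and there are no other crossings. -/
def TripleCrossing (L : Link X n) (σ : Fin 3 → Strand n) (p q : Fin 3 → ℝ) : Prop :=
  (∀ i, p i ∈ Ioo 0 (σ i).len ∧ q i ∈ Ioo 0 (σ i).len) ∧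
    CrossExactly L σ fun i u j v => j = i + 1 ∧ u = p i ∧ v = q j

/-- The area at the crossing of the strands `i` and `i + 1` between the half-branch going forward
along the strand `i` and the half-branch going backward along the strand `i + 1` is dotted. -/
def CornerDotted (L : Link X n) (σ : Fin 3 → Strand n) (p q : Fin 3 → ℝ) (i : Fin 3) : Prop :=
  L.dotted ((σ i).pos (p i)) (σ i).dir ((σ (i + 1)).pos (q (i + 1))) (-(σ (i + 1)).dir)

/-- The move `M₃`: in a disc in the interior, three embedded arcs, every two of which cross once,
are replaced by three such arcs on each of which the order of the two crossings is reversed. At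
each crossing the dots stay in the areas facing the same endpoints, and the corners of the
triangle formed by the arcs are neither all dotted nor all undotted (so that one of the arcs lies
above, and another one below the other two). The strands are directed so that each strand `i`
meets first the strand `i + 1` in the picture before the move; the corners of the triangle are
then the areas in `CornerDotted`. -/
def MoveThree (L L' : Link X n) : Prop :=
  ∃ (D bd : Set X) (σ : Fin 3 → Strand n), IsInteriorDisc D bd ∧ Replaces L L' D bd σ ∧
    MeetsProperly L bd σ ∧ MeetsProperly L' bd σ ∧
    ∃ p q p' q' : Fin 3 → ℝ, TripleCrossing L σ p q ∧ TripleCrossing L' σ p' q' ∧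
      (∀ i, p i < q i) ∧ (∀ i, q' i < p' i) ∧
      (∀ i, CornerDotted L' σ p' q' i ↔ CornerDotted L σ p q i) ∧
      ¬ (∀ i, CornerDotted L σ p q i) ∧ ¬ (∀ i, ¬ CornerDotted L σ p q i)

/-- The move `M₄`: an arc in a branch is pushed across the ridge into another branch. -/
def MoveFour (L L' : Link X n) : Prop :=
  ∃ (φ : BookDisc 2 → X) (σ : Fin 1 → Strand n), IsRidgeDisc φ ∧
    Replaces L L' (range φ) (ridgeDiscRim φ) σ ∧
    MeetsProperly L (ridgeDiscRim φ) σ ∧ MeetsProperly L' (ridgeDiscRim φ) σ ∧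
    NoCrossings L σ ∧ NoCrossings L' σ ∧
    (∀ u ∈ Icc 0 (σ 0).len, L.curve ((σ 0).pos u) ∈ halfDisc φ 0) ∧
    ∃ p q : ℝ, 0 < p ∧ p < q ∧ q < (σ 0).len ∧
      (∀ u ∈ Ico 0 p, L'.curve ((σ 0).pos u) ∈ halfDisc φ 0) ∧
      L'.curve ((σ 0).pos p) ∈ ridge X ∧
      (∀ u ∈ Ioo p q, L'.curve ((σ 0).pos u) ∈ halfDisc φ 1) ∧
      L'.curve ((σ 0).pos q) ∈ ridge X ∧
      (∀ u ∈ Ioc q (σ 0).len, L'.curve ((σ 0).pos u) ∈ halfDisc φ 0)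

/-- The strand `τ` starts in the half-disc `i`, crosses the ridge exactly once, at distance `r`,
and ends in the half-disc `j`. -/
def CrossesRidgeOnce (L : Link X n) {m : ℕ} (φ : BookDisc m → X) (τ : Strand n) (i j : Fin m)
    (r : ℝ) : Prop :=
  r ∈ Ioo 0 τ.len ∧ (∀ u ∈ Ico 0 r, L.curve (τ.pos u) ∈ halfDisc φ i) ∧
    L.curve (τ.pos r) ∈ ridge X ∧ ∀ u ∈ Ioc r τ.len, L.curve (τ.pos u) ∈ halfDisc φ j

/-- The moves `M₅⁺` and `M₅⁻`: two arcs which cross once and both go from a branch to another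
branch are changed so that the crossing is pushed across the ridge from the first branch to the
second. The dots stay in the areas facing the same endpoints. The two moves differ by the choice
of the dots: for `e = 1` the areas containing the directions to and from the ridge (between the
two half-branches going forward, and between those going backward) are dotted, for `e = -1` the
other two areas. -/
def MoveFive (e : ℤˣ) (L L' : Link X n) : Prop :=
  ∃ (φ : BookDisc 2 → X) (σ : Fin 2 → Strand n), IsRidgeDisc φ ∧
    Replaces L L' (range φ) (ridgeDiscRim φ) σ ∧
    MeetsProperly L (ridgeDiscRim φ) σ ∧ MeetsProperly L' (ridgeDiscRim φ) σ ∧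
    ∃ r r' p p' : Fin 2 → ℝ,
      (∀ i, CrossesRidgeOnce L φ (σ i) 0 1 (r i)) ∧
      (∀ i, CrossesRidgeOnce L' φ (σ i) 0 1 (r' i)) ∧
      (∀ i, 0 < p i ∧ p i < r i) ∧ (∀ i, r' i < p' i ∧ p' i < (σ i).len) ∧
      CrossExactly L σ (fun i u j v => i = 0 ∧ j = 1 ∧ u = p 0 ∧ v = p 1) ∧
      CrossExactly L' σ (fun i u j v => i = 0 ∧ j = 1 ∧ u = p' 0 ∧ v = p' 1) ∧
      (L.dotted ((σ 0).pos (p 0)) (σ 0).dir ((σ 1).pos (p 1)) (σ 1).dir ↔ e = 1) ∧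
      (L'.dotted ((σ 0).pos (p' 0)) (σ 0).dir ((σ 1).pos (p' 1)) (σ 1).dir ↔ e = 1)

/-- The move `M₆`: in the union of three branches adjacent to the ridge, an arc going directly
from a branch to another one is replaced by an arc which first enters the third branch. -/
def MoveSix (L L' : Link X n) : Prop :=
  ∃ (φ : BookDisc 3 → X) (σ : Fin 1 → Strand n), IsRidgeDisc φ ∧
    Replaces L L' (range φ) (ridgeDiscRim φ) σ ∧
    MeetsProperly L (ridgeDiscRim φ) σ ∧ MeetsProperly L' (ridgeDiscRim φ) σ ∧
    NoCrossings L σ ∧ NoCrossings L' σ ∧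
    (∃ r : ℝ, CrossesRidgeOnce L φ (σ 0) 0 2 r) ∧
    ∃ p q : ℝ, 0 < p ∧ p < q ∧ q < (σ 0).len ∧
      (∀ u ∈ Ico 0 p, L'.curve ((σ 0).pos u) ∈ halfDisc φ 0) ∧
      L'.curve ((σ 0).pos p) ∈ ridge X ∧
      (∀ u ∈ Ioo p q, L'.curve ((σ 0).pos u) ∈ halfDisc φ 1) ∧
      L'.curve ((σ 0).pos q) ∈ ridge X ∧
      (∀ u ∈ Ioc q (σ 0).len, L'.curve ((σ 0).pos u) ∈ halfDisc φ 2)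

/-- The move `M₇`: let `x` be a singular point with a cone neighbourhood and let `z ↦ γ z` be a
circle embedded in the base graph of the cone. In the disc formed by the cone over this circle, an
embedded arc with endpoints on the boundary is replaced by another embedded arc with the same
endpoints. (Both arcs miss `x` and are transversal to the ridge, because `L` and `L'` are
links.) -/
def MoveSeven (L L' : Link X n) : Prop :=
  ∃ (x : X) (G : FiniteGraph) (N : Set X) (h : N ≃ₜ Cone G.Space) (γ : UnitAddCircle → G.Space)
    (σ : Fin 1 → Strand n),
    x ∈ singularPts X ∧ IsConeChart x G N h ∧ Continuous γ ∧ Function.Injective γ ∧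
    Replaces L L' {y | ∃ z r, y = (h.symm (Cone.mk (γ z) r) : X)}
      {y | ∃ z, y = (h.symm (Cone.mk (γ z) 1) : X)} σ ∧
    NoCrossings L σ ∧ NoCrossings L' σ

/-- An ambient isotopy of `X` carries `L` to `L'`. -/
def AmbientIsotopic (L L' : Link X n) : Prop :=
  ∃ H : unitInterval → (X ≃ₜ X), Continuous (fun p : unitInterval × X => H p.1 p.2) ∧
    (∀ x, H 0 x = x) ∧ (∀ s, L'.curve s = H 1 (L.curve s)) ∧
    ∀ s ε t δ, L'.dotted s ε t δ ↔ L.dotted s ε t δ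

/-- `L` and `L'` are parametrizations of the same link: they differ by a homeomorphism of the
domain, which preserves (`e i = 1`) or reverses (`e i = -1`) the direction of the `i`-th circle and
may permute the circles. -/
def Reparametrizes (L L' : Link X n) : Prop :=
  ∃ (θ : Source n ≃ₜ Source n) (e : Fin n → ℤˣ),
    (∀ s ε, Tendsto θ (halfNhds s ε) (halfNhds (θ s) (e s.1 * ε))) ∧
    (∀ s, L'.curve s = L.curve (θ s)) ∧
    ∀ s ε t δ, L'.dotted s ε t δ ↔ L.dotted (θ s) (e s.1 * ε) (θ t) (e t.1 * δ)

/-- The generating steps of isotopy. -/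
inductive IsotopyStep : Link X n → Link X n → Prop
  | reparam {L L' : Link X n} : Reparametrizes L L' → IsotopyStep L L'
  | ambient {L L' : Link X n} : AmbientIsotopic L L' → IsotopyStep L L'
  | moveOne {L L' : Link X n} (e : ℤˣ) : MoveOne e L L' → IsotopyStep L L'
  | moveTwo {L L' : Link X n} : MoveTwo L L' → IsotopyStep L L'
  | moveThree {L L' : Link X n} : MoveThree L L' → IsotopyStep L L'
  | moveFour {L L' : Link X n} : MoveFour L L' → IsotopyStep L L'
  | moveFive {L L' : Link X n} (e : ℤˣ) : MoveFive e L L' → IsotopyStep L L'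
  | moveSix {L L' : Link X n} : MoveSix L L' → IsotopyStep L L'
  | moveSeven {L L' : Link X n} : MoveSeven L L' → IsotopyStep L L'

/-- Isotopy of links: the equivalence relation generated by ambient isotopies and the basic moves
(hence also their inverses). -/
def Isotopic (L L' : Link X n) : Prop := Relation.EqvGen IsotopyStep L L'

end Moves

/-! ### Classical link diagrams and local links -/

/-- The determinant of two plane vectors. It is positive if the direction of `w` is obtained from
that of `v` by a counterclockwise rotation by an angle between `0` and `π`. -/
def cross (v w : ℝ × ℝ) : ℝ := v.1 * w.2 - v.2 * w.1

/-- The velocity of a family of plane curves. -/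
def velocity {n : ℕ} (c : Source n → ℝ × ℝ) (s : Source n) : ℝ × ℝ :=
  deriv (fun u : ℝ => c (ray s 1 u)) 0

/-- A classical link diagram in the oriented plane: `n` generically immersed closed curves with a
choice of an overpassing branch at every crossing. `isOver s` says that the branch through `s` is
the overpassing one; it is meaningful only if `s` is a preimage of a crossing. -/
structure Diagram (n : ℕ) where
  curve : Source n → ℝ × ℝ
  contDiff_curve : ∀ i, ContDiff ℝ 1 fun u : ℝ => curve (i, (u : UnitAddCircle))
  velocity_ne_zero : ∀ s, velocity curve s ≠ 0
  finite_multiple : {s | ∃ t, t ≠ s ∧ curve t = curve s}.Finite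
  double : ∀ r s t, curve r = curve s → curve s = curve t → r = s ∨ s = t ∨ r = t
  transversal : ∀ s t, s ≠ t → curve s = curve t →
    cross (velocity curve s) (velocity curve t) ≠ 0
  isOver : Source n → Prop
  isOver_iff : ∀ s t, s ≠ t → curve s = curve t → (isOver s ↔ ¬ isOver t)

namespace Diagram

variable {n : ℕ}

def crossingSet (D : Diagram n) : Finset (ℝ × ℝ) :=
  (crossings_finite D.curve D.finite_multiple).toFinset

def selfCrossingSet (D : Diagram n) (i : Fin n) : Finset (ℝ × ℝ) :=
  (selfCrossings_finite D.curve D.finite_multiple i).toFinset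

/-- `s, t` are the preimages of a crossing, and the area between the half-branch at `s` in the
direction `ε` and the half-branch at `t` in the direction `δ` is swept when the overpassing line
is rotated counterclockwise towards the underpassing line. -/
def Swept (D : Diagram n) (s : Source n) (ε : ℤˣ) (t : Source n) (δ : ℤˣ) : Prop :=
  s ≠ t ∧ D.curve s = D.curve t ∧
    ((D.isOver s ∧ 0 < ((ε : ℤ) : ℝ) * ((δ : ℤ) : ℝ) *
        cross (velocity D.curve s) (velocity D.curve t)) ∨
      (D.isOver t ∧ 0 < ((ε : ℤ) : ℝ) * ((δ : ℤ) : ℝ) *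
        cross (velocity D.curve t) (velocity D.curve s)))

open Classical in
/-- The usual sign of a crossing of an oriented diagram. -/
def sign (D : Diagram n) (y : ℝ × ℝ) : ℤ :=
  if ∃ s t, s ≠ t ∧ D.curve s = y ∧ D.curve t = y ∧ D.isOver s ∧
    0 < cross (velocity D.curve s) (velocity D.curve t) then 1 else -1

/-- The sum of the signs of the self-crossings of all components. -/
def selfWrithe (D : Diagram n) : ℤ := ∑ i, ∑ y ∈ D.selfCrossingSet i, D.sign y

/-- A Kauffman state: at the crossings in `C` the `A`-smoothing merges the two swept areas, at
the other crossings the `B`-smoothing merges the other two areas. -/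
def state (D : Diagram n) (C : Finset (ℝ × ℝ)) (s : Source n) (ε : ℤˣ) (t : Source n) (δ : ℤˣ) :
    Prop :=
  s ≠ t ∧ D.curve s = D.curve t ∧
    ((D.curve s ∈ C ∧ ¬ D.Swept s ε t δ) ∨ (D.curve s ∉ C ∧ D.Swept s ε t δ))

open LaurentPolynomial in
/-- Kauffman's bracket polynomial of a classical diagram: every `A`-smoothing contributes `A`,
every `B`-smoothing contributes `A⁻¹`, and the value of `k` circles is `(-A² - A⁻²)^(k-1)`. -/
def kauffmanBracket (D : Diagram n) : LaurentPolynomial ℤ :=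
  ∑ C ∈ D.crossingSet.powerset,
    T 1 ^ C.card * T (-1) ^ (D.crossingSet.card - C.card) *
      (-T 2 - T (-2)) ^ (smoothingCount D.curve (D.state C) - 1)

end Diagram

/-! ### Local links: the proof that a transported diagram is a link -/

lemma cross_swap (v w : ℝ × ℝ) : cross w v = -cross v w := by
  simp only [cross]; ring

lemma ray_zero {n : ℕ} (s : Source n) (ε : ℤˣ) : ray s ε 0 = s := by
  simp [ray]

/-- The linear automorphism of the plane carrying the standard basis to `v`, `w`. -/
def basisEquiv (v w : ℝ × ℝ) (h : cross v w ≠ 0) : (ℝ × ℝ) ≃L[ℝ] (ℝ × ℝ) :=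
  ContinuousLinearEquiv.equivOfInverse
    ((ContinuousLinearMap.fst ℝ ℝ ℝ).smulRight v + (ContinuousLinearMap.snd ℝ ℝ ℝ).smulRight w)
    (((cross v w)⁻¹ • (w.2 • ContinuousLinearMap.fst ℝ ℝ ℝ -
        w.1 • ContinuousLinearMap.snd ℝ ℝ ℝ)).prod
      ((cross v w)⁻¹ • (v.1 • ContinuousLinearMap.snd ℝ ℝ ℝ -
        v.2 • ContinuousLinearMap.fst ℝ ℝ ℝ)))
    (by
      intro x
      apply Prod.ext <;>
      · simp
        field_simp
        simp only [cross]; ring)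
    (by
      intro x
      apply Prod.ext <;>
      · simp
        field_simp
        simp only [cross]; ring)

lemma Diagram.contDiff_ray {n : ℕ} (D : Diagram n) (s : Source n) :
    ContDiff ℝ 1 fun u : ℝ => D.curve (ray s 1 u) := by
  obtain ⟨i, z⟩ := s
  induction z using QuotientAddGroup.induction_on with
  | H r =>
    have h := (D.contDiff_curve i).comp
      (contDiff_const.add contDiff_id : ContDiff ℝ 1 fun u : ℝ => r + u)
    convert h using 1
    funext u
    simp [ray]

lemma Diagram.continuous_curve {n : ℕ} (D : Diagram n) : Continuous D.curve := by
  rw [continuous_prod_of_discrete_left]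
  intro i
  have h : Continuous fun u : ℝ => D.curve (i, (u : UnitAddCircle)) :=
    (D.contDiff_curve i).continuous
  exact (QuotientAddGroup.isQuotientMap_mk (N := AddSubgroup.zmultiples (1 : ℝ))).continuous_iff.2 h

/-- Near a crossing of a diagram the branches are the coordinate axes of a chart. -/
lemma Diagram.exists_chart {n : ℕ} (D : Diagram n) {s t : Source n} (hst : s ≠ t)
    (h : D.curve s = D.curve t) :
    ∃ φ : ℝ × ℝ → ℝ × ℝ, IsOpenEmbedding φ ∧ φ 0 = D.curve s ∧
      (∀ᶠ u : ℝ in 𝓝 0, D.curve (ray s 1 u) ∈ φ '' {p | p.2 = 0}) ∧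
      (∀ᶠ u : ℝ in 𝓝 0, D.curve (ray t 1 u) ∈ φ '' {p | p.1 = 0}) := by
  set x := D.curve s with hx
  let g : ℝ × ℝ → ℝ × ℝ := fun p => D.curve (ray s 1 p.1) + D.curve (ray t 1 p.2) - x
  have hg0 : g 0 = x := by simp [g, ray_zero, ← h, hx]
  have d1 : HasStrictDerivAt (fun u : ℝ => D.curve (ray s 1 u)) (velocity D.curve s) 0 :=
    (D.contDiff_ray s).contDiffAt.hasStrictDerivAt (by norm_num)
  have d2 : HasStrictDerivAt (fun u : ℝ => D.curve (ray t 1 u)) (velocity D.curve t) 0 :=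
    (D.contDiff_ray t).contDiffAt.hasStrictDerivAt (by norm_num)
  have e1 : HasStrictFDerivAt (fun p : ℝ × ℝ => D.curve (ray s 1 p.1)) _ (0 : ℝ × ℝ) :=
    HasStrictFDerivAt.comp (0 : ℝ × ℝ) (f := Prod.fst) d1.hasStrictFDerivAt hasStrictFDerivAt_fst
  have e2 : HasStrictFDerivAt (fun p : ℝ × ℝ => D.curve (ray t 1 p.2)) _ (0 : ℝ × ℝ) :=
    HasStrictFDerivAt.comp (0 : ℝ × ℝ) (f := Prod.snd) d2.hasStrictFDerivAt hasStrictFDerivAt_snd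
  have hg : HasStrictFDerivAt g
      (basisEquiv _ _ (D.transversal s t hst h) : (ℝ × ℝ) →L[ℝ] (ℝ × ℝ)) 0 := by
    have h₃ := (e1.add e2).sub_const x
    refine h₃.congr_fderiv ?_
    ext <;> simp [basisEquiv]
  let E := hg.toOpenPartialHomeomorph g
  have hE : ∀ p, E p = g p := fun p => rfl
  have hE0 : (0 : ℝ × ℝ) ∈ E.source := hg.mem_toOpenPartialHomeomorph_source
  obtain ⟨r, hr, hball⟩ := Metric.isOpen_iff.1 E.open_source 0 hE0
  let κ : OpenPartialHomeomorph ℝ ℝ := OpenPartialHomeomorph.univBall 0 r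
  have hκs : κ.source = univ := OpenPartialHomeomorph.univBall_source 0 r
  have hκt : κ.target = Metric.ball 0 r := OpenPartialHomeomorph.univBall_target 0 hr
  have hκ0 : κ 0 = 0 := OpenPartialHomeomorph.univBall_apply_zero 0 r
  let Φ := (κ.prod κ).trans E
  have hΦs : Φ.source = univ := by
    rw [eq_univ_iff_forall]
    rintro ⟨a, b⟩
    have ha : κ a ∈ Metric.ball (0 : ℝ) r := hκt ▸ κ.map_source (hκs ▸ mem_univ a)
    have hb : κ b ∈ Metric.ball (0 : ℝ) r := hκt ▸ κ.map_source (hκs ▸ mem_univ b)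
    have hab : (κ a, κ b) ∈ Metric.ball (0 : ℝ × ℝ) r := by
      rw [show (0 : ℝ × ℝ) = (0, 0) from rfl, ← ball_prod_same]
      exact ⟨ha, hb⟩
    simp only [Φ, OpenPartialHomeomorph.trans_source, OpenPartialHomeomorph.prod_source, hκs]
    exact ⟨by simp, hball hab⟩
  have hΦ : ∀ a b, Φ (a, b) = g (κ a, κ b) := fun a b => rfl
  have hev : ∀ᶠ u : ℝ in 𝓝 0, u ∈ κ.target := by
    rw [hκt]; exact Metric.ball_mem_nhds 0 hr
  refine ⟨Φ, Φ.isOpenEmbedding hΦs, ?_, ?_, ?_⟩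
  · rw [show (0 : ℝ × ℝ) = (0, 0) from rfl, hΦ, hκ0]; exact hg0
  · filter_upwards [hev] with u hu
    refine ⟨(κ.symm u, 0), rfl, ?_⟩
    rw [hΦ, hκ0, κ.right_inv hu]
    simp [g, ray_zero, ← h, hx]
  · filter_upwards [hev] with u hu
    refine ⟨(0, κ.symm u), rfl, ?_⟩
    rw [hΦ, hκ0, κ.right_inv hu]
    simp [g, ray_zero, hx]

/-- The local link in `X` obtained by transporting a classical diagram along an embedding `f` of
the plane in the interior of `X`, with dots in the areas swept by the overpassing lines. -/
def Diagram.localLink {X : Type*} [TopologicalSpace X] {n : ℕ} (D : Diagram n)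
    (f : ℝ × ℝ → X) (hf : IsOpenEmbedding f) (hX : range f ⊆ interiorPts X) : Link X n where
  curve := f ∘ D.curve
  continuous_curve := hf.continuous.comp D.continuous_curve
  mem_interior_or_ridge s := Or.inl (hX ⟨_, rfl⟩)
  finite_multiple := by
    simpa only [Function.comp, hf.injective.eq_iff] using D.finite_multiple
  double r s t h₁ h₂ := D.double r s t (hf.injective h₁) (hf.injective h₂)
  transversal s t hst h := by
    refine ⟨hX ⟨_, rfl⟩, ?_⟩
    obtain ⟨φ, hφ, h0, h₁, h₂⟩ := D.exists_chart hst (hf.injective h)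
    refine ⟨f ∘ φ, hf.comp hφ, congrArg f h0, ?_, ?_⟩
    · filter_upwards [h₁] with u hu
      rw [image_comp]; exact mem_image_of_mem f hu
    · filter_upwards [h₂] with u hu
      rw [image_comp]; exact mem_image_of_mem f hu
  ridge_transversal s hs := absurd (hX ⟨_, rfl⟩) hs
  dotted := D.Swept
  dotted_crossing s ε t δ h := ⟨h.1, congrArg f h.2.1⟩
  dotted_symm s ε t δ h := by
    obtain ⟨hst, hc, h⟩ := h
    refine ⟨hst.symm, hc.symm, ?_⟩
    rw [mul_comm ((δ : ℤ) : ℝ)]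
    exact h.symm
  dotted_neg s ε t δ hst h := by
    have hc := hf.injective h
    have hx := D.transversal s t hst hc
    have ho := D.isOver_iff s t hst hc
    have h₁ : ∀ ε : ℤˣ, ((ε : ℤ) : ℝ) ≠ 0 := fun ε => by simp
    have h₂ := mul_ne_zero (mul_ne_zero (h₁ ε) (h₁ δ)) hx
    simp only [Diagram.Swept, hst, hc, ne_eq, not_false_eq_true, true_and, cross_swap
      (velocity D.curve s) (velocity D.curve t), Units.val_neg, Int.cast_neg]
    rcases lt_or_gt_of_ne h₂ with h₂ | h₂ <;> by_cases hs : D.isOver s <;>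
      simp_all <;> grind

end

end LinksInTwoComplexes

open LinksInTwoComplexes

namespace LinksInTwoComplexes

universe u

/-! ### Counting classes of generated equivalence relations -/

section ClassCount

variable {E : Type u}

/-! The argument is Kauffman's, carried out on abstract arcs instead of pictures. Fix a move in `D`
and a smoothing `C` of the crossings outside `D`. Removing the preimages of all crossings from the
circles leaves finitely many components. The outer smoothing is a relation between them, each
smoothing of the crossings in `D` adds some pairs of ends, and the closed curves are the classes of
the generated equivalence relation (`arcCount_eq_card`, `LocalCrossings.numCurves_eq`). So the
bracket is a sum over `C` of local state sums (`LocalCrossings.bracket_eq`). As the outer smoothing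
is the same before and after the move, the local sums can be compared for each `C` separately
(`Replaces.bracket_eq`).

For `M₁`, `M₂`, `M₃` every strand is cut twice, into a start, a middle and an end. The outer
relation does not touch the middle parts (`CutTwice.isolated`), so attaching one of them to
something else lowers the number of classes by one (`classCount_attach`). A local smoothing is
therefore counted by the pairing which it induces on starts and ends, with one class more if middle
parts close up to a circle. Write `d = -A² - A⁻²`. The kink gives `A⁻¹ + A d = -A³` or its mirror
image (`stateSum_kink`). In the bigon the wrong pairing has the coefficient `A² + A⁻² + d = 0`
(`stateSum_bigon`). In the triangle one cyclic pairing arises from four smoothings and the opposite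
one from a single smoothing; the move exchanges these roles, and the four weights, with their
circle, add up to the single one (`stateSum_triangle`).

In `M₃` and `M₅` the crossings also travel along the strands. A homeomorphism of the domain which
slides the cut points (`exists_homeo_strands`) brings both links to the same cut domain
(`stateCount_transfer`). In `M₄`, `M₆`, `M₇` there are no crossings in `D`, so the cut domain and
the joined ends agree (`Replaces.bracket_wri_of_noCrossings`). Reparametrizations, ambient isotopies
and the transport of diagrams preserve the combinatorial data.

The writhe is a sum over crossings (`Link.wri_eq_sum`), so only the crossings in `D` can change it:
a kink contributes its sign, the two crossings of a bigon cancel, and `M₃`, `M₅` keep all signs.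
Thus the power of `-A³` exactly compensates `M₁`. -/

lemma card_quot_congr {r r' : E → E → Prop} (h : ∀ a b, r a b → Quot.mk r' a = Quot.mk r' b)
    (h' : ∀ a b, r' a b → Quot.mk r a = Quot.mk r b) :
    Nat.card (Quot r) = Nat.card (Quot r') :=
  Nat.card_congr
    { toFun := Quot.lift (Quot.mk r') h
      invFun := Quot.lift (Quot.mk r) h'
      left_inv := by rintro ⟨a⟩; rfl
      right_inv := by rintro ⟨a⟩; rfl }

open Classical in
/-- Attaching an isolated element to another one reduces the number of classes by one. -/
lemma card_quot_attach [Finite E] {r : E → E → Prop} {m x : E}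
    (hr : ∀ a b, r a b → a ≠ m ∧ b ≠ m) (hx : x ≠ m) :
    Nat.card (Quot fun a b => r a b ∨ (a = m ∧ b = x)) + 1 = Nat.card (Quot r) := by
  rw [← Finite.card_option]
  refine (Nat.card_congr ?_).symm
  -- `none` stands for the class of `m` in `Quot r`. In the enlarged relation `m` belongs to the
  -- class of `x`, so the inverse treats `m` there as `x`.
  refine
    { toFun := Quot.lift (fun a => if a = m then none else some (Quot.mk _ a)) ?_
      invFun := fun o => o.elim (Quot.mk r m)
        (Quot.lift (fun a => if a = m then Quot.mk r x else Quot.mk r a) ?_)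
      left_inv := ?_
      right_inv := ?_ }
  · intro a b h
    obtain ⟨h₁, h₂⟩ := hr a b h
    simp only [h₁, h₂, if_false]
    exact congrArg some (Quot.sound (Or.inl h))
  · rintro a b (h | ⟨rfl, rfl⟩)
    · obtain ⟨h₁, h₂⟩ := hr a b h
      simp only [h₁, h₂, if_false]
      exact Quot.sound h
    · simp [hx]
  · rintro ⟨a⟩
    by_cases ha : a = m <;> simp [ha]
  · rintro (_ | ⟨⟨a⟩⟩)
    · simp
    · by_cases ha : a = m
      · simp only [ha, Option.elim, if_true, hx, if_false, Option.some.injEq]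
        exact (Quot.sound (r := fun a b => r a b ∨ (a = m ∧ b = x)) (Or.inr ⟨rfl, rfl⟩)).symm
      · simp [ha]

/-- The number of classes of the equivalence relation generated by `R` and the pairs in `l`. -/
noncomputable def classCount (R : E → E → Prop) (l : List (E × E)) : ℕ :=
  Nat.card (Quot fun a b => R a b ∨ (a, b) ∈ l)

lemma classCount_attach [Finite E] {R : E → E → Prop} {l : List (E × E)} {m x : E}
    (hR : ∀ a b, R a b → a ≠ m ∧ b ≠ m) (hl : ∀ p ∈ l, p.1 ≠ m ∧ p.2 ≠ m) (hx : x ≠ m) :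
    classCount R ((m, x) :: l) + 1 = classCount R l := by
  unfold classCount
  rw [← card_quot_attach (r := fun a b => R a b ∨ (a, b) ∈ l) (m := m) (x := x) ?_ hx]
  · congr 3
    ext a b
    simp only [List.mem_cons, Prod.mk.injEq]
    tauto
  · rintro a b (h | h)
    · exact hR a b h
    · exact hl _ h

/-- The number of classes after joining at each of `r` crossings the ends `a k η` and
`b k (f k * η)`. -/
noncomputable def stateCount {r : ℕ} (R : E → E → Prop) (a b : Fin r → ℤˣ → E)
    (f : Fin r → ℤˣ) : ℕ :=
  Nat.card (Quot fun x y => R x y ∨ ∃ k η, x = a k η ∧ y = b k (f k * η))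

/-- Two sets of pairs generate the same equivalence relation if the same functions `g` are constant
on them. In this form the comparison of two pairings is a problem about equations between values of
`g`, without any paths in quotients. -/
lemma stateCount_eq_classCount {E : Type u} {r : ℕ} {R : E → E → Prop} {a b : Fin r → ℤˣ → E}
    {f : Fin r → ℤˣ} {l : List (E × E)}
    (h : ∀ {Q : Type u} (g : E → Q), (∀ k η, g (a k η) = g (b k (f k * η))) →
      ∀ p ∈ l, g p.1 = g p.2)
    (h' : ∀ {Q : Type u} (g : E → Q), (∀ p ∈ l, g p.1 = g p.2) →
      ∀ k η, g (a k η) = g (b k (f k * η))) :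
    stateCount R a b f = classCount R l := by
  refine card_quot_congr ?_ ?_
  · rintro x y (hxy | ⟨k, η, rfl, rfl⟩)
    · exact Quot.sound (Or.inl hxy)
    · exact h' _ (fun p hp => Quot.sound (Or.inr hp)) k η
  · rintro x y (hxy | hxy)
    · exact Quot.sound (Or.inl hxy)
    · exact h _ (fun k η => Quot.sound (Or.inr ⟨k, η, rfl, rfl⟩)) _ hxy

/-- The number of classes after joining the three successive parts of each of `k` strands. -/
noncomputable def throughCount {k : ℕ} (R : E → E → Prop) (s m e : Fin k → E) : ℕ :=
  Nat.card (Quot fun x y => R x y ∨ ∃ i, (x = s i ∧ y = m i) ∨ (x = m i ∧ y = e i))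

lemma throughCount_eq_classCount {E : Type u} {k : ℕ} {R : E → E → Prop} {s m e : Fin k → E}
    {l : List (E × E)}
    (h : ∀ {Q : Type u} (g : E → Q), (∀ i, g (s i) = g (m i) ∧ g (m i) = g (e i)) →
      ∀ p ∈ l, g p.1 = g p.2)
    (h' : ∀ {Q : Type u} (g : E → Q), (∀ p ∈ l, g p.1 = g p.2) →
      ∀ i, g (s i) = g (m i) ∧ g (m i) = g (e i)) :
    throughCount R s m e = classCount R l := by
  refine card_quot_congr ?_ ?_
  · rintro x y (hxy | ⟨i, ⟨rfl, rfl⟩ | ⟨rfl, rfl⟩⟩)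
    · exact Quot.sound (Or.inl hxy)
    · exact (h' _ (fun p hp => Quot.sound (Or.inr hp)) i).1
    · exact (h' _ (fun p hp => Quot.sound (Or.inr hp)) i).2
  · rintro x y (hxy | hxy)
    · exact Quot.sound (Or.inl hxy)
    · exact h _ (fun i => ⟨Quot.sound (Or.inr ⟨i, Or.inl ⟨rfl, rfl⟩⟩),
        Quot.sound (Or.inr ⟨i, Or.inr ⟨rfl, rfl⟩⟩)⟩) _ hxy

/-- The arcs `m i` take part in no relation given by `R`, and differ from the arcs `s j`, `e j`. -/
structure Isolated {k : ℕ} (R : E → E → Prop) (s m e : Fin k → E) : Prop where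
  rel : ∀ i a b, R a b → a ≠ m i ∧ b ≠ m i
  inj : Function.Injective m
  ne_start : ∀ i j, s j ≠ m i
  ne_end : ∀ i j, e j ≠ m i

end ClassCount

/-! ### The bracket relations for abstract arcs -/

lemma forall_units {p : ℤˣ → Prop} : (∀ η, p η) ↔ p 1 ∧ p (-1) := by
  refine ⟨fun h => ⟨h _, h _⟩, fun h η => ?_⟩
  rcases Int.units_eq_one_or η with rfl | rfl
  exacts [h.1, h.2]

/-! ### Kinks: one strand crossing itself -/

section Kink

variable {E : Type u} {R : E → E → Prop} {s m e : Fin 1 → E} {a b : Fin 1 → ℤˣ → E}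

/-- The ends at the crossing of a kink. -/
structure KinkEnds (s m e : Fin 1 → E) (a b : Fin 1 → ℤˣ → E) : Prop where
  fst_pos : a 0 1 = m 0
  fst_neg : a 0 (-1) = s 0
  snd_pos : b 0 1 = e 0
  snd_neg : b 0 (-1) = m 0

/-- Here `s` is joined with `m` and `m` with `e`: the loop is run through backwards, but stays on
the strand. -/
lemma KinkEnds.stateCount_one (h : KinkEnds s m e a b) :
    stateCount R a b ![1] = throughCount R s m e := by
  rw [stateCount_eq_classCount (l := [(s 0, m 0), (m 0, e 0)]),
    throughCount_eq_classCount (l := [(s 0, m 0), (m 0, e 0)])]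
  all_goals
    intro Q g
    simp [forall_units, h.fst_pos, h.fst_neg, h.snd_pos, h.snd_neg]
    try grind

/-- Here `s` is joined with `e`, and the two ends of `m` with each other, so that `m` becomes a
separate circle. -/
lemma KinkEnds.stateCount_neg_one [Finite E] (H : Isolated R s m e) (h : KinkEnds s m e a b) :
    stateCount R a b ![-1] = throughCount R s m e + 1 := by
  rw [stateCount_eq_classCount (l := [(s 0, e 0)]),
    throughCount_eq_classCount (l := [(m 0, s 0), (s 0, e 0)]), classCount_attach]
  · exact H.rel 0
  · simpa using ⟨H.ne_start 0 0, H.ne_end 0 0⟩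
  · exact H.ne_start 0 0
  all_goals
    intro Q g
    simp [forall_units, h.fst_pos, h.fst_neg, h.snd_pos, h.snd_neg]
    try grind

end Kink

/-! ### Bigons: two strands crossing twice -/

section Bigon

variable {E : Type u} {R : E → E → Prop} {s m e : Fin 2 → E} {a b : Fin 2 → ℤˣ → E}

/-- The ends at the two crossings of a bigon: first on the strand `0`, then on the strand `1`. -/
structure BigonEnds (s m e : Fin 2 → E) (a b : Fin 2 → ℤˣ → E) : Prop where
  fst_zero_pos : a 0 1 = m 0
  fst_zero_neg : a 0 (-1) = s 0
  snd_zero_pos : b 0 1 = m 1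
  snd_zero_neg : b 0 (-1) = s 1
  fst_one_pos : a 1 1 = e 0
  fst_one_neg : a 1 (-1) = m 0
  snd_one_pos : b 1 1 = e 1
  snd_one_neg : b 1 (-1) = m 1

lemma Isolated.attach_two [Finite E] (H : Isolated R s m e) {l : List (E × E)}
    (hl : ∀ i, ∀ p ∈ l, p.1 ≠ m i ∧ p.2 ≠ m i) {x y : E} (hx : ∀ i, x ≠ m i) (hy : ∀ i, y ≠ m i) :
    classCount R ((m 0, x) :: (m 1, y) :: l) + 2 = classCount R l := by
  have h₁ := classCount_attach (H.rel 1) (hl 1) (hy 1)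
  have h₀ := classCount_attach (l := (m 1, y) :: l) (H.rel 0)
    (List.forall_mem_cons.2 ⟨⟨H.inj.ne (by decide), hy 0⟩, hl 0⟩) (hx 0)
  omega

/-- The arcs become `s 0 - m 1 - e 0` and `s 1 - m 0 - e 1`. The middle parts are exchanged, but the
pairing of starts with ends is that of the strands without crossings. -/
lemma BigonEnds.stateCount_neg_neg [Finite E] (H : Isolated R s m e) (h : BigonEnds s m e a b) :
    stateCount R a b ![-1, -1] = throughCount R s m e := by
  have hl : ∀ i, ∀ p ∈ [(s 0, e 0), (s 1, e 1)], p.1 ≠ m i ∧ p.2 ≠ m i := by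
    simp [H.ne_start, H.ne_end]
  have h₁ := H.attach_two hl (H.ne_end · 1) (H.ne_end · 0)
  have h₂ := H.attach_two hl (H.ne_end · 0) (H.ne_end · 1)
  obtain ⟨e₁, e₂, e₃, e₄, e₅, e₆, e₇, e₈⟩ := h
  rw [stateCount_eq_classCount (l := [(m 0, e 1), (m 1, e 0), (s 0, e 0), (s 1, e 1)]),
    throughCount_eq_classCount (l := [(m 0, e 0), (m 1, e 1), (s 0, e 0), (s 1, e 1)])]
  · omega
  all_goals
    intro Q g
    simp [forall_units, Fin.forall_fin_succ, e₁, e₂, e₃, e₄, e₅, e₆, e₇, e₈]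
    try grind

/-- The first crossing joins the two starts, and both middle parts lie on the arc which joins the
two ends. -/
lemma BigonEnds.stateCount_pos_neg [Finite E] (H : Isolated R s m e) (h : BigonEnds s m e a b) :
    stateCount R a b ![1, -1] + 2 = classCount R [(s 0, s 1), (e 0, e 1)] := by
  rw [← H.attach_two (by simp [H.ne_start, H.ne_end]) (H.ne_end · 0) (H.ne_end · 0),
    stateCount_eq_classCount]
  all_goals
    intro Q g
    obtain ⟨e₁, e₂, e₃, e₄, e₅, e₆, e₇, e₈⟩ := h
    simp [forall_units, Fin.forall_fin_succ, e₁, e₂, e₃, e₄, e₅, e₆, e₇, e₈]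
    try grind

/-- The mirror image of the preceding case: both middle parts lie on the arc which joins the two
starts. -/
lemma BigonEnds.stateCount_neg_pos [Finite E] (H : Isolated R s m e) (h : BigonEnds s m e a b) :
    stateCount R a b ![-1, 1] + 2 = classCount R [(s 0, s 1), (e 0, e 1)] := by
  rw [← H.attach_two (by simp [H.ne_start, H.ne_end]) (H.ne_start · 0) (H.ne_start · 0),
    stateCount_eq_classCount]
  all_goals
    intro Q g
    obtain ⟨e₁, e₂, e₃, e₄, e₅, e₆, e₇, e₈⟩ := h
    simp [forall_units, Fin.forall_fin_succ, e₁, e₂, e₃, e₄, e₅, e₆, e₇, e₈]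
    try grind

/-- The middle parts form a circle of their own. They are attached to each other only, which makes
one attachment instead of two. -/
lemma BigonEnds.stateCount_pos_pos [Finite E] (H : Isolated R s m e) (h : BigonEnds s m e a b) :
    stateCount R a b ![1, 1] + 1 = classCount R [(s 0, s 1), (e 0, e 1)] := by
  rw [← classCount_attach (m := m 0) (x := m 1) (H.rel 0) (by simp [H.ne_start, H.ne_end])
    (H.inj.ne (by decide)), stateCount_eq_classCount]
  all_goals
    intro Q g
    obtain ⟨e₁, e₂, e₃, e₄, e₅, e₆, e₇, e₈⟩ := h
    simp [forall_units, Fin.forall_fin_succ, e₁, e₂, e₃, e₄, e₅, e₆, e₇, e₈]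
    try grind

end Bigon

/-! ### Triangles: three strands crossing pairwise -/

section Triangle

variable {E : Type u} {R : E → E → Prop} {s m e : Fin 3 → E} {a b : Fin 3 → ℤˣ → E}

/-- The ends at the three crossings of a triangle; the strand `i` meets first the strand
`i + 1`. -/
structure TriangleEnds (s m e : Fin 3 → E) (a b : Fin 3 → ℤˣ → E) : Prop where
  fst_pos : ∀ k, a k 1 = m k
  fst_neg : ∀ k, a k (-1) = s k
  snd_pos : ∀ k, b k 1 = m (k + 1)
  snd_neg : ∀ k, b k (-1) = e (k + 1)

lemma Isolated.attach_three [Finite E] (H : Isolated R s m e) {l : List (E × E)}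
    (hl : ∀ i, ∀ p ∈ l, p.1 ≠ m i ∧ p.2 ≠ m i) {x y z : E} (hx : ∀ i, x ≠ m i)
    (hy : ∀ i, y ≠ m i) (hz : ∀ i, z ≠ m i) :
    classCount R ((m 0, x) :: (m 1, y) :: (m 2, z) :: l) + 3 = classCount R l := by
  have h₂ := classCount_attach (H.rel 2) (hl 2) (hz 2)
  have h₁ := classCount_attach (l := (m 2, z) :: l) (H.rel 1)
    (List.forall_mem_cons.2 ⟨⟨H.inj.ne (by decide), hz 1⟩, hl 1⟩) (hy 1)
  have h₀ := classCount_attach (l := (m 1, y) :: (m 2, z) :: l) (H.rel 0)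
    (List.forall_mem_cons.2 ⟨⟨H.inj.ne (by decide), hy 0⟩,
      List.forall_mem_cons.2 ⟨⟨H.inj.ne (by decide), hz 0⟩, hl 0⟩⟩) (hx 0)
  omega

/-- Three middle parts merged into one separate class amount to two attachments only. -/
lemma Isolated.attach_three_loop [Finite E] (H : Isolated R s m e) {l : List (E × E)}
    (hl : ∀ i, ∀ p ∈ l, p.1 ≠ m i ∧ p.2 ≠ m i) :
    classCount R ((m 0, m 1) :: (m 1, m 2) :: l) + 2 = classCount R l := by
  have h₁ := classCount_attach (m := m 1) (x := m 2) (H.rel 1) (hl 1) (H.inj.ne (by decide))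
  have h₀ := classCount_attach (m := m 0) (x := m 1) (l := (m 1, m 2) :: l) (H.rel 0)
    (List.forall_mem_cons.2 ⟨⟨H.inj.ne (by decide), H.inj.ne (by decide)⟩, hl 0⟩)
    (H.inj.ne (by decide))
  omega

/-- The middle parts close up to a circle inside the triangle, while at every crossing a start is
joined with an end. -/
lemma TriangleEnds.stateCount_loop [Finite E] (H : Isolated R s m e) (h : TriangleEnds s m e a b) :
    stateCount R a b ![1, 1, 1] + 2 = classCount R [(s 0, e 1), (s 1, e 2), (s 2, e 0)] := by
  rw [← H.attach_three_loop (by simp [H.ne_start, H.ne_end]), stateCount_eq_classCount]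
  all_goals
    intro Q g
    simp [forall_units, Fin.forall_fin_succ, h.fst_pos, h.fst_neg, h.snd_pos, h.snd_neg]
    try grind

/-- The circle of middle parts is opened at one crossing and inserted in the arc passing there. The
pairing is that of the state with the circle, with one class less. -/
lemma TriangleEnds.stateCount_one_neg [Finite E] (H : Isolated R s m e)
    (h : TriangleEnds s m e a b) {f : Fin 3 → ℤˣ}
    (hf : f = ![1, 1, -1] ∨ f = ![1, -1, 1] ∨ f = ![-1, 1, 1]) :
    stateCount R a b f + 3 = classCount R [(s 0, e 1), (s 1, e 2), (s 2, e 0)] := by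
  -- `x` is the end on the arc which swallows all middle parts.
  obtain ⟨x, hx, hfx⟩ : ∃ x, (∀ i, x ≠ m i) ∧
      (f = ![1, 1, -1] ∧ x = e 0 ∨ f = ![1, -1, 1] ∧ x = e 2 ∨ f = ![-1, 1, 1] ∧ x = e 1) := by
    rcases hf with hf | hf | hf
    exacts [⟨_, (H.ne_end · 0), by simp [hf]⟩, ⟨_, (H.ne_end · 2), by simp [hf]⟩,
      ⟨_, (H.ne_end · 1), by simp [hf]⟩]
  rw [← H.attach_three (by simp [H.ne_start, H.ne_end]) hx hx hx, stateCount_eq_classCount]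
  all_goals
    intro Q g
    rcases hfx with ⟨rfl, rfl⟩ | ⟨rfl, rfl⟩ | ⟨rfl, rfl⟩ <;>
    simp [forall_units, Fin.forall_fin_succ, h.fst_pos, h.fst_neg, h.snd_pos, h.snd_neg] <;>
    try grind

/-- The arcs are `s k - m (k + 1) - e (k + 2)`, which is the opposite cyclic pairing. -/
lemma TriangleEnds.stateCount_neg [Finite E] (H : Isolated R s m e)
    (h : TriangleEnds s m e a b) :
    stateCount R a b ![-1, -1, -1] + 3 = classCount R [(s 0, e 2), (s 1, e 0), (s 2, e 1)] := by
  rw [← H.attach_three (by simp [H.ne_start, H.ne_end]) (H.ne_end · 1) (H.ne_end · 2)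
    (H.ne_end · 0), stateCount_eq_classCount]
  all_goals
    intro Q g
    simp [forall_units, Fin.forall_fin_succ, h.fst_pos, h.fst_neg, h.snd_pos, h.snd_neg]
    try grind

/-- Each of these pairings joins one strand with itself and exchanges the other two. It does not
change if starts and ends are interchanged, and for this reason these states agree on both sides of
`M₃`. -/
lemma TriangleEnds.stateCount_two_neg [Finite E] (H : Isolated R s m e)
    (h : TriangleEnds s m e a b) :
    stateCount R a b ![1, -1, -1] + 3 = classCount R [(s 0, e 1), (s 1, e 0), (s 2, e 2)] ∧
    stateCount R a b ![-1, 1, -1] + 3 = classCount R [(s 0, e 0), (s 1, e 2), (s 2, e 1)] ∧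
    stateCount R a b ![-1, -1, 1] + 3 = classCount R [(s 0, e 2), (s 1, e 1), (s 2, e 0)] := by
  refine ⟨?_, ?_, ?_⟩
  · rw [← H.attach_three (by simp [H.ne_start, H.ne_end]) (H.ne_end · 2) (H.ne_end · 2)
      (H.ne_end · 0), stateCount_eq_classCount]
    all_goals
      intro Q g
      simp [forall_units, Fin.forall_fin_succ, h.fst_pos, h.fst_neg, h.snd_pos, h.snd_neg]
      try grind
  · rw [← H.attach_three (by simp [H.ne_start, H.ne_end]) (H.ne_end · 1) (H.ne_end · 0)
      (H.ne_end · 0), stateCount_eq_classCount]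
    all_goals
      intro Q g
      simp [forall_units, Fin.forall_fin_succ, h.fst_pos, h.fst_neg, h.snd_pos, h.snd_neg]
      try grind
  · rw [← H.attach_three (by simp [H.ne_start, H.ne_end]) (H.ne_end · 1) (H.ne_end · 2)
      (H.ne_end · 1), stateCount_eq_classCount]
    all_goals
      intro Q g
      simp [forall_units, Fin.forall_fin_succ, h.fst_pos, h.fst_neg, h.snd_pos, h.snd_neg]
      try grind

/-- The pairs are indexed by `η`, and `f k * -η = -(f k * η)`; thus reversing the reference
directions of both branches only renames them. -/
lemma stateCount_neg_ends {r : ℕ} (a b : Fin r → ℤˣ → E) (f : Fin r → ℤˣ) :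
    stateCount R (fun k η => a k (-η)) (fun k η => b k (-η)) f = stateCount R a b f := by
  unfold stateCount
  congr 2
  ext x y
  refine or_congr_right (exists_congr fun k => ?_)
  constructor
  · rintro ⟨η, rfl, rfl⟩
    exact ⟨-η, rfl, by rw [mul_neg]⟩
  · rintro ⟨η, rfl, rfl⟩
    exact ⟨-η, by simp, by simp⟩

lemma classCount_swap (l : List (E × E)) :
    classCount R (l.map Prod.swap) = classCount R l := by
  refine card_quot_congr ?_ ?_
  · rintro x y (h | h)
    · exact Quot.sound (Or.inl h)
    · simp only [List.mem_map, Prod.exists, Prod.swap_prod_mk, Prod.mk.injEq] at h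
      obtain ⟨a, b, h, rfl, rfl⟩ := h
      exact (Quot.sound (r := fun a b => R a b ∨ (a, b) ∈ l) (Or.inr h)).symm
  · rintro x y (h | h)
    · exact Quot.sound (Or.inl h)
    · exact (Quot.sound (r := fun a b => R a b ∨ (a, b) ∈ l.map Prod.swap)
        (Or.inr (by simpa using h))).symm

lemma Isolated.reverse {k : ℕ} {s m e : Fin k → E} (H : Isolated R s m e) : Isolated R e m s :=
  ⟨H.rel, H.inj, H.ne_end, H.ne_start⟩

lemma classCount_perm {l l' : List (E × E)} (h : l.Perm l') :
    classCount R l = classCount R l' := by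
  unfold classCount
  simp only [h.mem_iff]

end Triangle

/-! ### Local state sums -/

section StateSum

open LaurentPolynomial

/-- The value `-A² - A⁻²` of a circle. -/
noncomputable def loopValue : LaurentPolynomial ℤ := -T 2 - T (-2)

open Classical in
/-- The weight of a smoothing `η` of a crossing, where `κ` says whether the smoothing `1`
contributes `A⁻¹`. -/
noncomputable def smoothingWeight (κ : Prop) (η : ℤˣ) : LaurentPolynomial ℤ :=
  if η = 1 ↔ κ then T (-1) else T 1

/-- The sum over the smoothings of `r` crossings, where `c f` is the number of curves in the
smoothing `f`. -/
noncomputable def stateSum {r : ℕ} (κ : Fin r → Prop) (c : (Fin r → ℤˣ) → ℕ) :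
    LaurentPolynomial ℤ :=
  ∑ f, loopValue ^ (c f - 1) * ∏ k, smoothingWeight (κ k) (f k)

lemma sum_fin_zero_units {M : Type*} [AddCommMonoid M] (F : (Fin 0 → ℤˣ) → M) :
    ∑ f, F f = F ![] := by
  rw [Fintype.sum_unique]
  exact congrArg F (Subsingleton.elim _ _)

lemma sum_fin_succ_units {M : Type*} [AddCommMonoid M] {r : ℕ} (F : (Fin (r + 1) → ℤˣ) → M) :
    ∑ f, F f = ∑ f : Fin r → ℤˣ, (F (Matrix.vecCons 1 f) + F (Matrix.vecCons (-1) f)) := by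
  rw [← (Fin.consEquiv fun _ : Fin (r + 1) => ℤˣ).sum_comp, Fintype.sum_prod_type,
    Finset.sum_add_distrib]
  rw [show (Finset.univ : Finset ℤˣ) = {1, -1} from rfl,
    Finset.sum_pair (by decide)]
  rfl

lemma T_one_mul_T_neg_one : (T 1 * T (-1) : LaurentPolynomial ℤ) = 1 := by
  rw [← T_add]; simp

lemma loopValue_eq : loopValue = -T 1 ^ 2 - T (-1) ^ 2 := by
  simp [loopValue, T_pow]

lemma smoothingWeight_one {κ : Prop} (h : κ) : smoothingWeight κ 1 = T (-1) := by
  simp [smoothingWeight, h]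

lemma smoothingWeight_one' {κ : Prop} (h : ¬ κ) : smoothingWeight κ 1 = T 1 := by
  simp [smoothingWeight, h]

lemma smoothingWeight_neg_one {κ : Prop} (h : κ) : smoothingWeight κ (-1) = T 1 := by
  simp [smoothingWeight, h]

lemma smoothingWeight_neg_one' {κ : Prop} (h : ¬ κ) : smoothingWeight κ (-1) = T (-1) := by
  simp [smoothingWeight, h]

lemma stateSum_zero (κ : Fin 0 → Prop) (c : (Fin 0 → ℤˣ) → ℕ) :
    stateSum κ c = loopValue ^ (c ![] - 1) := by
  rw [stateSum, sum_fin_zero_units, Fin.prod_univ_zero, mul_one]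

/-- After division by `d ^ (N - 1)` this is `A⁻¹ + A d = -A³` for `e = 1`, and the same identity
with `A` and `A⁻¹` exchanged for `e = -1`. -/
lemma stateSum_kink {κ : Fin 1 → Prop} {c : (Fin 1 → ℤˣ) → ℕ} {N : ℕ} (hN : 1 ≤ N)
    (h₁ : c ![1] = N) (h₂ : c ![-1] = N + 1) (e : ℤˣ) (he : κ 0 ↔ e = 1) :
    stateSum κ c = -T (3 * (e : ℤ)) * loopValue ^ (N - 1) := by
  -- The exponents are truncated differences, so `N` has to be written as a successor.
  obtain ⟨N, rfl⟩ : ∃ M, N = M + 1 := ⟨N - 1, by omega⟩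
  simp only [stateSum, sum_fin_succ_units, sum_fin_zero_units, Fin.prod_univ_one,
    Matrix.cons_val_zero, h₁, h₂, Nat.add_sub_cancel]
  have h := T_one_mul_T_neg_one
  rcases Int.units_eq_one_or e with rfl | rfl
  · rw [smoothingWeight_one (by simp [he]), smoothingWeight_neg_one (by simp [he]), pow_succ,
      loopValue_eq, show (T (3 * ((1 : ℤˣ) : ℤ)) : LaurentPolynomial ℤ) = T 1 ^ 3 by simp [T_pow]]
    linear_combination (-(-T 1 ^ 2 - T (-1) ^ 2) ^ N * T (-1)) * h
  · rw [smoothingWeight_one' (by simp [he]), smoothingWeight_neg_one' (by simp [he]), pow_succ,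
      loopValue_eq,
      show (T (3 * ((-1 : ℤˣ) : ℤ)) : LaurentPolynomial ℤ) = T (-1) ^ 3 by simp [T_pow]]
    linear_combination (-(-T 1 ^ 2 - T (-1) ^ 2) ^ N * T 1) * h

/-- If the two conditions differ, the equal smoothings have weight `A A⁻¹ = 1` and the mixed ones
have weights `A²` and `A⁻²`. The three terms with `N` curves, or with `N + 1`, cancel because `A² +
A⁻² + d = 0`. -/
lemma stateSum_bigon {κ : Fin 2 → Prop} {c : (Fin 2 → ℤˣ) → ℕ} {N N' : ℕ} (hN : 1 ≤ N)
    (hκ : κ 0 ↔ ¬ κ 1)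
    (h₁ : c ![-1, -1] = N') (h₂ : c ![1, -1] = N) (h₃ : c ![-1, 1] = N) (h₄ : c ![1, 1] = N + 1) :
    stateSum κ c = loopValue ^ (N' - 1) := by
  obtain ⟨N, rfl⟩ : ∃ M, N = M + 1 := ⟨N - 1, by omega⟩
  simp only [stateSum, sum_fin_succ_units, sum_fin_zero_units, Fin.prod_univ_two,
    Matrix.cons_val_zero, Matrix.cons_val_one, h₁, h₂, h₃, h₄, Nat.add_sub_cancel]
  have h := T_one_mul_T_neg_one
  by_cases h1 : κ 1
  · have h0 : ¬ κ 0 := by tauto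
    rw [smoothingWeight_one h1, smoothingWeight_neg_one h1, smoothingWeight_one' h0,
      smoothingWeight_neg_one' h0, pow_succ, loopValue_eq]
    linear_combination ((-T 1 ^ 2 - T (-1) ^ 2) ^ (N' - 1) +
      (-T 1 ^ 2 - T (-1) ^ 2) ^ (N + 1)) * h
  · have h0 : κ 0 := by tauto
    rw [smoothingWeight_one' h1, smoothingWeight_neg_one' h1, smoothingWeight_one h0,
      smoothingWeight_neg_one h0, pow_succ, loopValue_eq]
    linear_combination ((-T 1 ^ 2 - T (-1) ^ 2) ^ (N' - 1) +
      (-T 1 ^ 2 - T (-1) ^ 2) ^ (N + 1)) * h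

lemma smoothingWeight_cases (κ : Prop) :
    (κ ∧ smoothingWeight κ 1 = T (-1) ∧ smoothingWeight κ (-1) = T 1) ∨
      (¬ κ ∧ smoothingWeight κ 1 = T 1 ∧ smoothingWeight κ (-1) = T (-1)) := by
  by_cases h : κ
  · exact Or.inl ⟨h, smoothingWeight_one h, smoothingWeight_neg_one h⟩
  · exact Or.inr ⟨h, smoothingWeight_one' h, smoothingWeight_neg_one' h⟩

/-- If one or two corners are dotted, then `d` times the weight of `![1, 1, 1]`, plus the weights of
the three smoothings with one `-1`, equals the weight of `![-1, -1, -1]`. So the coefficients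
belonging to `M` and `N` agree on both sides. For three equal corners this identity fails. -/
lemma stateSum_triangle {κ : Fin 3 → Prop} {c c' : (Fin 3 → ℤˣ) → ℕ} {M N : ℕ} (hM : 1 ≤ M)
    (hN : 1 ≤ N) (hκ : ¬ ∀ k, κ k) (hκ' : ¬ ∀ k, ¬ κ k)
    (h₁ : c ![1, 1, 1] = M + 1) (h₁' : c' ![1, 1, 1] = N + 1)
    (h₂ : ∀ f, (f = ![1, 1, -1] ∨ f = ![1, -1, 1] ∨ f = ![-1, 1, 1]) → c f = M ∧ c' f = N)
    (h₃ : ∀ f, (f = ![1, -1, -1] ∨ f = ![-1, -1, 1] ∨ f = ![-1, 1, -1]) → c f = c' f)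
    (h₄ : c ![-1, -1, -1] = N) (h₄' : c' ![-1, -1, -1] = M) :
    stateSum κ c = stateSum κ c' := by
  obtain ⟨N, rfl⟩ : ∃ M, N = M + 1 := ⟨N - 1, by omega⟩
  obtain ⟨M, rfl⟩ : ∃ N, M = N + 1 := ⟨M - 1, by omega⟩
  have t₁ := h₂ _ (Or.inl rfl)
  have t₂ := h₂ _ (Or.inr (Or.inl rfl))
  have t₃ := h₂ _ (Or.inr (Or.inr rfl))
  have t₄ := h₃ _ (Or.inl rfl)
  have t₅ := h₃ _ (Or.inr (Or.inl rfl))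
  have t₆ := h₃ _ (Or.inr (Or.inr rfl))
  simp only [stateSum, sum_fin_succ_units, sum_fin_zero_units, Fin.prod_univ_three,
    Matrix.cons_val_zero, Matrix.cons_val_one, Matrix.cons_val, h₁, h₁', h₄, h₄', t₁.1, t₁.2,
    t₂.1, t₂.2, t₃.1, t₃.2, t₄, t₅, t₆, Nat.add_sub_cancel]
  have h := T_one_mul_T_neg_one
  simp only [Fin.forall_fin_succ, IsEmpty.forall_iff, and_true] at hκ hκ'
  rw [pow_succ, pow_succ, loopValue_eq]
  rcases smoothingWeight_cases (κ 0) with ⟨k₀, a₀, b₀⟩ | ⟨k₀, a₀, b₀⟩ <;>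
  rcases smoothingWeight_cases (κ 1) with ⟨k₁, a₁, b₁⟩ | ⟨k₁, a₁, b₁⟩ <;>
  rcases smoothingWeight_cases (κ 2) with ⟨k₂, a₂, b₂⟩ | ⟨k₂, a₂, b₂⟩ <;>
  rw [a₀, a₁, a₂, b₀, b₁, b₂]
  · exact absurd ⟨k₀, k₁, k₂⟩ hκ
  all_goals first
    | linear_combination (-((-T 1 ^ 2 - T (-1) ^ 2) ^ M - (-T 1 ^ 2 - T (-1) ^ 2) ^ N) *
        (T 1 ^ 3 + T 1 * T (-1) ^ 2)) * h
    | linear_combination (-((-T 1 ^ 2 - T (-1) ^ 2) ^ M - (-T 1 ^ 2 - T (-1) ^ 2) ^ N) *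
        (T (-1) ^ 3 + T (-1) * T 1 ^ 2)) * h
    | exact absurd ⟨k₀, k₁, k₂⟩ hκ'

end StateSum

/-! ### Cofinite subsets of a union of circles -/

section Rays

variable {n : ℕ}

lemma ray_add (s : Source n) (ε : ℤˣ) (u v : ℝ) : ray (ray s ε u) ε v = ray s ε (u + v) := by
  simp [ray, mul_add, add_assoc]

lemma ray_neg (s : Source n) (ε : ℤˣ) (u : ℝ) : ray s (-ε) u = ray s ε (-u) := by
  simp [ray]

lemma ray_sub (s : Source n) (ε : ℤˣ) (u v : ℝ) : ray (ray s ε u) (-ε) v = ray s ε (u - v) := by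
  rw [ray_neg, ray_add, sub_eq_add_neg]

lemma continuous_ray (s : Source n) (ε : ℤˣ) : Continuous (ray s ε) := by
  unfold ray
  have h : Continuous fun u : ℝ => ((((ε : ℤ) : ℝ) * u : ℝ) : UnitAddCircle) :=
    (AddCircle.continuous_mk' 1).comp (by fun_prop)
  exact continuous_const.prodMk (continuous_const.add h)

lemma isOpenMap_ray (s : Source n) (ε : ℤˣ) : IsOpenMap (ray s ε) := by
  have h₁ : IsOpenMap fun x : UnitAddCircle => ((s.1, x) : Source n) := by
    intro V hV
    have : (fun x : UnitAddCircle => ((s.1, x) : Source n)) '' V = {s.1} ×ˢ V := by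
      ext ⟨i, x⟩; simp [Prod.ext_iff, eq_comm, and_comm]
    rw [this]
    exact (isOpen_discrete _).prod hV
  have h₂ : IsOpenMap fun u : ℝ => (u : UnitAddCircle) := QuotientAddGroup.isOpenMap_coe
  have h₃ : IsOpenMap fun u : ℝ => ((ε : ℤ) : ℝ) * u :=
    (Homeomorph.mulLeft₀ ((ε : ℤ) : ℝ) (by simp)).isOpenMap
  exact h₁.comp ((isOpenMap_add_left s.2).comp (h₂.comp h₃))

lemma ray_eq_iff (s : Source n) (ε : ℤˣ) (u v : ℝ) :
    ray s ε u = ray s ε v ↔ ∃ k : ℤ, (k : ℝ) = u - v := by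
  simp only [ray, Prod.mk.injEq, true_and, add_right_inj]
  rw [← sub_eq_zero, ← AddCircle.coe_sub, AddCircle.coe_eq_zero_iff]
  rcases Int.units_eq_one_or ε with rfl | rfl
  · simp
  · constructor
    · rintro ⟨k, hk⟩
      exact ⟨-k, by simp at hk ⊢; linarith⟩
    · rintro ⟨k, hk⟩
      exact ⟨-k, by simp at hk ⊢; linarith⟩

lemma eq_of_ray_eq {s : Source n} {ε : ℤˣ} {u v : ℝ} (h : ray s ε u = ray s ε v)
    (h₁ : u - v < 1) (h₂ : v - u < 1) : u = v := by
  obtain ⟨k, hk⟩ := (ray_eq_iff s ε u v).1 h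
  have h₃ : k < 1 := by exact_mod_cast hk ▸ h₁
  have h₄ : -1 < k := by
    have : (-1 : ℝ) < k := by rw [hk]; linarith
    exact_mod_cast this
  obtain rfl : k = 0 := by omega
  push_cast at hk
  linarith

lemma nhds_eq_map_ray (s : Source n) (ε : ℤˣ) : 𝓝 s = map (ray s ε) (𝓝 0) := by
  refine le_antisymm ?_ ?_
  · conv_lhs => rw [← ray_zero s ε]
    exact (isOpenMap_ray s ε).nhds_le 0
  · conv_rhs => rw [← ray_zero s ε]
    exact (continuous_ray s ε).tendsto 0

/-- A neighbourhood of `s` consists of `s` and the two half-branches at `s`. -/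
lemma eventually_nhds_of_halfNhds {s : Source n} {P : Source n → Prop} (h : P s)
    (h' : ∀ ε, ∀ᶠ q in halfNhds s ε, P q) : ∀ᶠ q in 𝓝 s, P q := by
  have h₁ := h' 1
  have h₂ := h' (-1)
  rw [halfNhds, eventually_map] at h₁ h₂
  have h₃ : ∀ᶠ u : ℝ in 𝓝[<] 0, P (ray s 1 u) := by
    have ht : Tendsto (Neg.neg : ℝ → ℝ) (𝓝[<] 0) (𝓝[>] 0) := by
      have := tendsto_neg_nhdsLT (a := (0 : ℝ))
      rwa [neg_zero] at this
    filter_upwards [ht.eventually h₂] with u hu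
    rwa [ray_neg, neg_neg] at hu
  rw [nhds_eq_map_ray s 1, eventually_map, ← nhdsNE_sup_pure, ← nhdsLT_sup_nhdsGT,
    eventually_sup, eventually_sup, eventually_pure, ray_zero]
  exact ⟨⟨h₃, h₁⟩, h⟩

instance (s : Source n) (ε : ℤˣ) : (halfNhds s ε).NeBot := by
  unfold halfNhds; infer_instance

lemma halfNhds_le_nhds (s : Source n) (ε : ℤˣ) : halfNhds s ε ≤ 𝓝 s := by
  rw [nhds_eq_map_ray s ε]
  exact map_mono nhdsWithin_le_nhds

lemma eventually_ne_halfNhds (s : Source n) (ε : ℤˣ) : ∀ᶠ q in halfNhds s ε, q ≠ s := by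
  rw [halfNhds, eventually_map]
  filter_upwards [Ioo_mem_nhdsGT one_pos] with u hu h
  rw [← ray_zero s ε, ray_add, zero_add] at h
  exact hu.1.ne' (eq_of_ray_eq h (by linarith [hu.2]) (by linarith [hu.1]))

lemma eventually_mem_halfNhds {U : Set (Source n)} (hU : Uᶜ.Finite) (s : Source n) (ε : ℤˣ) :
    ∀ᶠ q in halfNhds s ε, q ∈ U := by
  have h : (Uᶜ \ {s})ᶜ ∈ 𝓝 s := (hU.subset sdiff_subset).isClosed.isOpen_compl.mem_nhds (by simp)
  filter_upwards [halfNhds_le_nhds s ε h, eventually_ne_halfNhds s ε] with q h₁ h₂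
  by_contra h₃
  exact h₁ ⟨h₃, h₂⟩

end Rays

/-! ### Components of the cut domain and the half-branches in which they end -/

section Arcs

variable {n : ℕ} {U : Set (Source n)}

lemma mk_eq_mk_iff (p q : U) :
    (p : ConnectedComponents U) = q ↔ (q : Source n) ∈ connectedComponentIn U p := by
  rw [eq_comm, ConnectedComponents.coe_eq_coe', connectedComponentIn_eq_image p.2]
  simp

/-- The points of the half-branch at `s` in the direction `ε` close to `s` lie in one component
of `U`. -/
lemma exists_branchEnd (hU : Uᶜ.Finite) (s : Source n) (ε : ℤˣ) :
    ∃ x : ConnectedComponents U, ∀ᶠ q in halfNhds s ε, ∃ h : q ∈ U, (⟨q, h⟩ : U) = x := by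
  have h := eventually_mem_halfNhds hU s ε
  rw [halfNhds, eventually_map, eventually_nhdsWithin_iff, Metric.eventually_nhds_iff] at h
  obtain ⟨r, hr, h⟩ := h
  have hU' : ∀ u ∈ Ioo 0 r, ray s ε u ∈ U := fun u hu =>
    h (by rw [Real.dist_eq, sub_zero, abs_lt]; constructor <;> linarith [hu.1, hu.2]) hu.1
  have hm : r / 2 ∈ Ioo 0 r := ⟨by linarith, by linarith⟩
  refine ⟨(⟨ray s ε (r / 2), hU' _ hm⟩ : U), ?_⟩
  rw [halfNhds, eventually_map]
  filter_upwards [Ioo_mem_nhdsGT hr] with u hu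
  refine ⟨hU' u hu, ?_⟩
  rw [eq_comm, mk_eq_mk_iff]
  exact (isPreconnected_Ioo.image _ (continuous_ray s ε).continuousOn).subset_connectedComponentIn
    (mem_image_of_mem _ hm) (by rintro _ ⟨v, hv, rfl⟩; exact hU' v hv) (mem_image_of_mem _ hu)

/-- The component of `U` which contains the germ of the half-branch at `s` in the direction
`ε`. -/
noncomputable def branchEnd (hU : Uᶜ.Finite) (s : Source n) (ε : ℤˣ) : ConnectedComponents U :=
  (exists_branchEnd hU s ε).choose

lemma eventually_branchEnd (hU : Uᶜ.Finite) (s : Source n) (ε : ℤˣ) :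
    ∀ᶠ q in halfNhds s ε, ∃ h : q ∈ U, (⟨q, h⟩ : U) = branchEnd hU s ε :=
  (exists_branchEnd hU s ε).choose_spec

/-- The germ lies eventually in a single component, so one common point close to `s` identifies it.
-/
lemma eq_branchEnd (hU : Uᶜ.Finite) {s : Source n} {ε : ℤˣ} {x : ConnectedComponents U}
    (h : ∃ᶠ q in halfNhds s ε, ∃ h : q ∈ U, (⟨q, h⟩ : U) = x) : x = branchEnd hU s ε := by
  obtain ⟨q, ⟨h₁, rfl⟩, h₂, h₃⟩ := (h.and_eventually (eventually_branchEnd hU s ε)).exists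
  exact h₃

/-- This turns the condition of `EndsWith` into an equation in the set of components. -/
lemma endsIn_iff (hU : Uᶜ.Finite) (p : U) (s : Source n) (ε : ℤˣ) :
    (∀ᶠ q in halfNhds s ε, q ∈ connectedComponentIn U p) ↔
      (p : ConnectedComponents U) = branchEnd hU s ε := by
  constructor
  · intro h
    refine eq_branchEnd hU (Eventually.frequently ?_)
    filter_upwards [h, eventually_mem_halfNhds hU s ε] with q h₁ h₂
    exact ⟨h₂, ((mk_eq_mk_iff p ⟨q, h₂⟩).2 h₁).symm⟩
  · intro h
    filter_upwards [eventually_branchEnd hU s ε] with q ⟨h₁, h₂⟩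
    exact (mk_eq_mk_iff p ⟨q, h₁⟩).1 (h.trans h₂.symm)

/-- At a point which is not cut out, a whole interval around it lies in one component. -/
lemma branchEnd_of_mem (hU : Uᶜ.Finite) {s : Source n} (hs : s ∈ U) (ε : ℤˣ) :
    branchEnd hU s ε = (⟨s, hs⟩ : U) := by
  have h : U ∈ 𝓝 s := by simpa using hU.isClosed.isOpen_compl.mem_nhds (by simpa using hs)
  rw [nhds_eq_map_ray s ε, mem_map, Metric.mem_nhds_iff] at h
  obtain ⟨r, hr, h⟩ := h
  refine (eq_branchEnd hU (Eventually.frequently ?_)).symm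
  rw [halfNhds, eventually_map]
  filter_upwards [Ioo_mem_nhdsGT hr] with u hu
  have hu' : u ∈ Metric.ball 0 r := by
    rw [Metric.mem_ball, Real.dist_eq, sub_zero, abs_lt]; constructor <;> linarith [hu.1, hu.2]
  refine ⟨h hu', ?_⟩
  rw [eq_comm, mk_eq_mk_iff]
  refine ((convex_ball (0 : ℝ) r).isPreconnected.image _
    (continuous_ray s ε).continuousOn).subset_connectedComponentIn
    ⟨0, Metric.mem_ball_self hr, ray_zero s ε⟩ ?_ (mem_image_of_mem _ hu')
  rintro _ ⟨v, hv, rfl⟩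
  exact h hv

lemma eventually_nhds_branchEnd (hU : Uᶜ.Finite) (s : Source n) :
    ∀ᶠ q in 𝓝 s, ∀ h : q ∈ U, ∃ ε, (⟨q, h⟩ : U) = branchEnd hU s ε := by
  refine eventually_nhds_of_halfNhds (fun h => ⟨1, (branchEnd_of_mem hU h 1).symm⟩) fun ε => ?_
  filter_upwards [eventually_branchEnd hU s ε] with q ⟨h₁, h₂⟩ h₃
  exact ⟨_, h₂⟩

/-- By compactness: each point has a neighbourhood whose points in `U` belong to the components of
its two half-branches, and finitely many such neighbourhoods cover the circles. -/
lemma finite_connectedComponents (hU : Uᶜ.Finite) : Finite (ConnectedComponents U) := by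
  obtain ⟨F, -, hF⟩ := isCompact_univ.elim_nhds_subcover _
    fun s (_ : s ∈ univ) => eventually_nhds_branchEnd hU s
  have h : Function.Surjective fun z : F × ℤˣ => branchEnd hU (z.1 : Source n) z.2 := by
    intro x
    obtain ⟨⟨q, hq⟩, rfl⟩ := ConnectedComponents.surjective_coe x
    obtain ⟨s, hs, h⟩ := mem_iUnion₂.1 (hF (mem_univ q))
    obtain ⟨ε, hε⟩ := h hq
    exact ⟨(⟨s, hs⟩, ε), hε.symm⟩
  exact Finite.of_surjective _ h

/-- The number of curves obtained from `U` by joining half-branches as prescribed by `J`. -/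
noncomputable def arcCount (U : Set (Source n)) (J : Source n → ℤˣ → Source n → ℤˣ → Prop) : ℕ :=
  Nat.card (Quot fun p q : U => (q : Source n) ∈ connectedComponentIn U p ∨
    ∃ s ε t δ, J s ε t δ ∧ (∀ᶠ x in halfNhds s ε, x ∈ connectedComponentIn U p) ∧
      ∀ᶠ x in halfNhds t δ, x ∈ connectedComponentIn U q)

/-- The gain is that in `arcCount` the set `U` is arbitrary, so that the curves may be cut at points
other than crossings. -/
lemma smoothingCount_eq_arcCount {Y : Type*} (c : Source n → Y)
    (J : Source n → ℤˣ → Source n → ℤˣ → Prop) :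
    smoothingCount c J = arcCount (cutSource c) J := rfl

/-- The relation between components of `U` which end with joined half-branches. -/
def EndsJoined (hU : Uᶜ.Finite) (J : Source n → ℤˣ → Source n → ℤˣ → Prop)
    (x y : ConnectedComponents U) : Prop :=
  ∃ s ε t δ, J s ε t δ ∧ x = branchEnd hU s ε ∧ y = branchEnd hU t δ

/-- Points of the same component are identified in any case, hence the quotient of the points is a
quotient of the finite set of components. -/
lemma arcCount_eq_card (hU : Uᶜ.Finite) (J : Source n → ℤˣ → Source n → ℤˣ → Prop) :
    arcCount U J = Nat.card (Quot (EndsJoined hU J)) := by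
  unfold arcCount
  refine Nat.card_eq_of_bijective
    (Quot.lift (fun p : U => Quot.mk _ (p : ConnectedComponents U)) ?_) ⟨?_, ?_⟩
  · rintro p q (h | ⟨s, ε, t, δ, h, h₁, h₂⟩)
    · rw [(mk_eq_mk_iff p q).2 h]
    · exact Quot.sound ⟨s, ε, t, δ, h, (endsIn_iff hU p s ε).1 h₁, (endsIn_iff hU q t δ).1 h₂⟩
  · rintro ⟨p⟩ ⟨q⟩ h
    have key : ∀ p q : U, (p : ConnectedComponents U) = q →
        Quot.mk (fun p q : U => (q : Source n) ∈ connectedComponentIn U p ∨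
          ∃ s ε t δ, J s ε t δ ∧ (∀ᶠ x in halfNhds s ε, x ∈ connectedComponentIn U p) ∧
          ∀ᶠ x in halfNhds t δ, x ∈ connectedComponentIn U q) p = Quot.mk _ q :=
      fun p q h => Quot.sound (Or.inl ((mk_eq_mk_iff p q).1 h))
    let g : ConnectedComponents U → Quot _ := Quotient.lift (Quot.mk _)
      fun p q h => key p q (Quotient.sound h)
    have hg : ∀ x y, EndsJoined hU J x y → g x = g y := by
      rintro x y ⟨s, ε, t, δ, h, h₁, h₂⟩
      obtain ⟨p, rfl⟩ := ConnectedComponents.surjective_coe x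
      obtain ⟨q, rfl⟩ := ConnectedComponents.surjective_coe y
      exact Quot.sound (Or.inr ⟨s, ε, t, δ, h, (endsIn_iff hU p s ε).2 h₁,
        (endsIn_iff hU q t δ).2 h₂⟩)
    exact congrArg (Quot.lift g hg) h
  · rintro ⟨x⟩
    obtain ⟨p, rfl⟩ := ConnectedComponents.surjective_coe x
    exact ⟨Quot.mk _ p, rfl⟩

/-- Cutting `U` at finitely many points and rejoining the pieces does not change the number of
curves. -/
lemma arcCount_cut {V : Set (Source n)} (hU : Uᶜ.Finite) (hV : Vᶜ.Finite) (hVU : V ⊆ U)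
    (J : Source n → ℤˣ → Source n → ℤˣ → Prop) :
    arcCount U J = Nat.card (Quot fun x y : ConnectedComponents V => EndsJoined hV J x y ∨
      ∃ s ∈ U \ V, x = branchEnd hV s (-1) ∧ y = branchEnd hV s 1) := by
  classical
  rw [arcCount_eq_card hU]
  set r : ConnectedComponents V → ConnectedComponents V → Prop := fun x y =>
    EndsJoined hV J x y ∨ ∃ s ∈ U \ V, x = branchEnd hV s (-1) ∧ y = branchEnd hV s 1 with hr
  let ι := (continuous_inclusion hVU).connectedComponentsMap
  have hι : ∀ s ε, ι (branchEnd hV s ε) = branchEnd hU s ε := by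
    intro s ε
    refine eq_branchEnd hU (Eventually.frequently ?_)
    filter_upwards [eventually_branchEnd hV s ε] with q ⟨h₁, h₂⟩
    exact ⟨hVU h₁, by rw [← h₂]; rfl⟩
  -- At a point of `U` missing from `V` one of the two adjacent pieces has to be chosen. By `hgε`
  -- the choice does not matter, as `r` glues the two pieces.
  let g : U → Quot r := fun p => if h : (p : Source n) ∈ V then
    Quot.mk r ((⟨p, h⟩ : V) : ConnectedComponents V) else Quot.mk r (branchEnd hV p 1)
  have hgε : ∀ (p : U) ε, g p = Quot.mk r (branchEnd hV p ε) := by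
    intro p ε
    by_cases h : (p : Source n) ∈ V
    · simp only [g, h, dif_pos, branchEnd_of_mem hV h]
    · simp only [g, h, dif_neg, not_false_eq_true]
      rcases Int.units_eq_one_or ε with rfl | rfl
      · rfl
      · exact (Quot.sound (r := r) (Or.inr ⟨p, ⟨p.2, h⟩, rfl, rfl⟩)).symm
  -- Along both half-branches at any point of `U` the value of `g` is that at the point, so `g` is
  -- locally constant and factors through the components of `U`.
  have hg : IsLocallyConstant g := by
    rw [IsLocallyConstant.iff_eventually_eq]
    intro p
    rw [nhds_subtype_eq_comap, eventually_comap]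
    have : ∀ᶠ q in 𝓝 (p : Source n), ∀ h : q ∈ U, g ⟨q, h⟩ = g p := by
      refine eventually_nhds_of_halfNhds (fun _ => rfl) fun ε => ?_
      filter_upwards [eventually_branchEnd hV (p : Source n) ε] with q ⟨h₁, h₂⟩ h₃
      rw [hgε p ε, ← h₂]
      simp only [g, h₁, dif_pos]
    filter_upwards [this] with q hq q' hq'
    subst hq'
    exact hq q'.2
  let G : ConnectedComponents U → Quot r := Quotient.lift g fun p q h =>
    hg.apply_eq_of_isPreconnected isPreconnected_connectedComponent mem_connectedComponent
      (by rw [← connectedComponent_eq_iff_mem]; exact h.symm)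
  have hGε : ∀ s ε, G (branchEnd hU s ε) = Quot.mk r (branchEnd hV s ε) := by
    intro s ε
    obtain ⟨q, ⟨h₁, h₂⟩, h₃, h₄⟩ :=
      ((eventually_branchEnd hU s ε).and (eventually_branchEnd hV s ε)).exists
    rw [← h₂, ← h₄]
    change g _ = _
    simp only [g, h₃, dif_pos]
  refine Nat.card_congr
    { toFun := Quot.lift G ?_
      invFun := Quot.lift (fun x => Quot.mk _ (ι x)) ?_
      left_inv := ?_
      right_inv := ?_ }
  · rintro x y ⟨s, ε, t, δ, h, rfl, rfl⟩
    rw [hGε, hGε]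
    exact Quot.sound (Or.inl ⟨s, ε, t, δ, h, rfl, rfl⟩)
  · rintro x y (⟨s, ε, t, δ, h, rfl, rfl⟩ | ⟨s, hs, rfl, rfl⟩)
    · rw [hι, hι]
      exact Quot.sound ⟨s, ε, t, δ, h, rfl, rfl⟩
    · rw [hι, hι, branchEnd_of_mem hU hs.1, branchEnd_of_mem hU hs.1]
  · rintro ⟨x⟩
    obtain ⟨p, rfl⟩ := ConnectedComponents.surjective_coe x
    change Quot.lift (fun x => Quot.mk _ (ι x)) _ (g p) = _
    rw [hgε p 1]
    change Quot.mk _ (ι _) = _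
    rw [hι, branchEnd_of_mem hU p.2]
  · rintro ⟨x⟩
    obtain ⟨p, rfl⟩ := ConnectedComponents.surjective_coe x
    change g _ = _
    have := p.2
    simp only [g, inclusion, this, dif_pos]

/-- A homeomorphism of the domain induces a bijection between the components. -/
lemma exists_components_equiv (hU : Uᶜ.Finite) {θ : Source n ≃ₜ Source n} {e : Fin n → ℤˣ}
    (hθ : ∀ s ε, Tendsto θ (halfNhds s ε) (halfNhds (θ s) (e s.1 * ε)))
    (hV : (θ ⁻¹' U)ᶜ.Finite) :
    ∃ ψ : ConnectedComponents (θ ⁻¹' U) ≃ ConnectedComponents U,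
      ∀ s ε, ψ (branchEnd hV s ε) = branchEnd hU (θ s) (e s.1 * ε) := by
  let τ : (θ ⁻¹' U) ≃ₜ U := θ.sets rfl
  refine ⟨⟨τ.continuous.connectedComponentsMap, τ.symm.continuous.connectedComponentsMap, ?_, ?_⟩,
    ?_⟩
  · intro x
    obtain ⟨p, rfl⟩ := ConnectedComponents.surjective_coe x
    exact congrArg ConnectedComponents.mk (τ.symm_apply_apply p)
  · intro x
    obtain ⟨p, rfl⟩ := ConnectedComponents.surjective_coe x
    exact congrArg ConnectedComponents.mk (τ.apply_symm_apply p)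
  · intro s ε
    obtain ⟨q, ⟨h₁, h₂⟩, h₃, h₄⟩ := ((eventually_branchEnd hV s ε).and
      ((hθ s ε).eventually (eventually_branchEnd hU _ _))).exists
    rw [← h₂, ← h₄]
    rfl

lemma endsJoined_preimage_iff (hU : Uᶜ.Finite) {θ : Source n ≃ₜ Source n} {e : Fin n → ℤˣ}
    (hV : (θ ⁻¹' U)ᶜ.Finite) {ψ : ConnectedComponents (θ ⁻¹' U) ≃ ConnectedComponents U}
    (hψ : ∀ s ε, ψ (branchEnd hV s ε) = branchEnd hU (θ s) (e s.1 * ε))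
    (J : Source n → ℤˣ → Source n → ℤˣ → Prop) (x y : ConnectedComponents (θ ⁻¹' U)) :
    EndsJoined hV (fun s ε t δ => J (θ s) (e s.1 * ε) (θ t) (e t.1 * δ)) x y ↔
      EndsJoined hU J (ψ x) (ψ y) := by
  constructor
  · rintro ⟨s, ε, t, δ, h, rfl, rfl⟩
    exact ⟨_, _, _, _, h, hψ s ε, hψ t δ⟩
  · rintro ⟨s, ε, t, δ, h, h₁, h₂⟩
    obtain ⟨s, rfl⟩ := θ.surjective s
    obtain ⟨t, rfl⟩ := θ.surjective t
    -- Signs are their own inverses, which allows every direction at `θ s` to be written as the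
    -- image of one at `s`.
    have hε : ∀ (i : Fin n) (ε : ℤˣ), ε = e i * (e i * ε) := fun i ε => by
      rw [← mul_assoc, Int.units_mul_self, one_mul]
    rw [hε s.1 ε] at h h₁
    rw [hε t.1 δ] at h h₂
    exact ⟨_, _, _, _, h, ψ.injective (h₁.trans (hψ s _).symm),
      ψ.injective (h₂.trans (hψ t _).symm)⟩

/-- Homeomorphisms of the domain preserve the number of curves. -/
lemma arcCount_preimage (hU : Uᶜ.Finite) (J : Source n → ℤˣ → Source n → ℤˣ → Prop)
    {θ : Source n ≃ₜ Source n} {e : Fin n → ℤˣ}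
    (hθ : ∀ s ε, Tendsto θ (halfNhds s ε) (halfNhds (θ s) (e s.1 * ε))) :
    arcCount (θ ⁻¹' U) (fun s ε t δ => J (θ s) (e s.1 * ε) (θ t) (e t.1 * δ)) = arcCount U J := by
  have hV : (θ ⁻¹' U)ᶜ.Finite := by
    rw [← preimage_compl]
    exact hU.preimage θ.injective.injOn
  obtain ⟨ψ, hψ⟩ := exists_components_equiv hU hθ hV
  rw [arcCount_eq_card hU, arcCount_eq_card hV]
  exact Nat.card_congr (Quot.congr ψ (endsJoined_preimage_iff hU hV hψ J))

/-- An interval without cut points lies in one component. -/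
lemma branchEnd_interval (hU : Uᶜ.Finite) {s : Source n} {ε : ℤˣ} {a b : ℝ} (hab : a < b)
    (h : ∀ u ∈ Ioo a b, ray s ε u ∈ U) :
    branchEnd hU (ray s ε a) ε = branchEnd hU (ray s ε b) (-ε) := by
  have hm : (a + b) / 2 ∈ Ioo a b := ⟨by linarith, by linarith⟩
  have hc : ∀ u (hu : u ∈ Ioo a b), ((⟨ray s ε u, h u hu⟩ : U) : ConnectedComponents U) =
      (⟨ray s ε ((a + b) / 2), h _ hm⟩ : U) := fun u hu => by
    rw [eq_comm, mk_eq_mk_iff]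
    exact (isPreconnected_Ioo.image _
      (continuous_ray s ε).continuousOn).subset_connectedComponentIn (mem_image_of_mem _ hm)
      (by rintro _ ⟨v, hv, rfl⟩; exact h v hv) (mem_image_of_mem _ hu)
  refine Eq.trans (eq_branchEnd hU (x := (⟨ray s ε ((a + b) / 2), h _ hm⟩ : U))
    (Eventually.frequently ?_)).symm (eq_branchEnd hU (Eventually.frequently ?_))
  · rw [halfNhds, eventually_map]
    filter_upwards [Ioo_mem_nhdsGT (sub_pos.2 hab)] with u hu
    have hu' : a + u ∈ Ioo a b := ⟨by linarith [hu.1], by linarith [hu.2]⟩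
    rw [ray_add]
    exact ⟨h _ hu', hc _ hu'⟩
  · rw [halfNhds, eventually_map]
    filter_upwards [Ioo_mem_nhdsGT (sub_pos.2 hab)] with u hu
    have hu' : b - u ∈ Ioo a b := ⟨by linarith [hu.2], by linarith [hu.1]⟩
    rw [ray_sub]
    exact ⟨h _ hu', hc _ hu'⟩

/-- Only the points of an interval between two cut points lie in its component. -/
lemma eventually_mem_of_branchEnd_eq (hU : Uᶜ.Finite) {s : Source n} {ε : ℤˣ} {a b : ℝ}
    (hab : a < b) (h : ∀ u ∈ Ioo a b, ray s ε u ∈ U) (ha : ray s ε a ∉ U) (hb : ray s ε b ∉ U)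
    {t : Source n} {δ : ℤˣ} (ht : branchEnd hU t δ = branchEnd hU (ray s ε a) ε) :
    ∀ᶠ q in halfNhds t δ, q ∈ ray s ε '' Ioo a b := by
  -- The endpoints are not in `U`, so within `U` the open interval coincides with the closed one and
  -- is clopen.
  have hcl : IsClopen (Subtype.val ⁻¹' (ray s ε '' Ioo a b) : Set U) := by
    constructor
    · have : (Subtype.val ⁻¹' (ray s ε '' Ioo a b) : Set U) =
          Subtype.val ⁻¹' (ray s ε '' Icc a b) := by
        ext ⟨q, hq⟩
        constructor
        · rintro ⟨u, hu, rfl⟩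
          exact ⟨u, Ioo_subset_Icc_self hu, rfl⟩
        · rintro ⟨u, hu, rfl⟩
          refine ⟨u, ⟨lt_of_le_of_ne hu.1 ?_, lt_of_le_of_ne hu.2 ?_⟩, rfl⟩
          · rintro rfl; exact ha hq
          · rintro rfl; exact hb hq
      rw [this]
      exact ((isCompact_Icc.image (continuous_ray s ε)).isClosed).preimage continuous_subtype_val
    · exact ((isOpenMap_ray s ε) _ isOpen_Ioo).preimage continuous_subtype_val
  have h₁ : ∀ᶠ q in halfNhds (ray s ε a) ε, q ∈ ray s ε '' Ioo a b := by
    rw [halfNhds, eventually_map]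
    filter_upwards [Ioo_mem_nhdsGT (sub_pos.2 hab)] with u hu
    rw [ray_add]
    exact mem_image_of_mem _ ⟨by linarith [hu.1], by linarith [hu.2]⟩
  obtain ⟨p, hp, hp', hp''⟩ := (h₁.and (eventually_branchEnd hU _ _)).exists
  filter_upwards [eventually_branchEnd hU t δ] with q ⟨hq, hq'⟩
  have : (⟨q, hq⟩ : U) ∈ connectedComponent (⟨p, hp'⟩ : U) := by
    rw [← ConnectedComponents.coe_eq_coe', hq', ht, hp'']
  exact hcl.connectedComponent_subset (x := ⟨p, hp'⟩) hp this

end Arcs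

/-! ### Moving points along strands -/

section LineMaps

lemma exists_orderIso_glue (f g : ℝ ≃o ℝ) {c : ℝ} (h : f c = g c) :
    ∃ k : ℝ ≃o ℝ, (∀ x ≤ c, k x = f x) ∧ ∀ x, c ≤ x → k x = g x := by
  let k : ℝ → ℝ := fun x => if x ≤ c then f x else g x
  have hk : StrictMono k := by
    intro x y hxy
    simp only [k]
    split_ifs with h₁ h₂ h₂
    · exact f.strictMono hxy
    · exact (f.monotone h₁).trans_lt (h ▸ g.strictMono (not_le.1 h₂))
    · exact absurd (hxy.le.trans h₂) h₁
    · exact g.strictMono hxy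
  have hs : Function.Surjective k := by
    intro y
    rcases le_or_gt y (f c) with hy | hy
    · refine ⟨f.symm y, ?_⟩
      have : f.symm y ≤ c := by rwa [f.symm_apply_le]
      simp [k, this]
    · refine ⟨g.symm y, ?_⟩
      have : ¬ g.symm y ≤ c := by rw [g.symm_apply_le, ← h]; exact not_le.2 hy
      simp [k, this]
  refine ⟨hk.orderIsoOfSurjective k hs, fun x hx => ?_, fun x hx => ?_⟩
  · simp [k, hx]
  · rcases hx.eq_or_lt with rfl | hx
    · simp [k, h]
    · simp [k, not_le.2 hx]

lemma exists_orderIso_affine {p q p' q' : ℝ} (h : p < q) (h' : p' < q') :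
    ∃ f : ℝ ≃o ℝ, f p = p' ∧ f q = q' := by
  have hs : 0 < (q' - p') / (q - p) := div_pos (sub_pos.2 h') (sub_pos.2 h)
  have hne : q - p ≠ 0 := (sub_pos.2 h).ne'
  refine ⟨(OrderIso.addRight (-p)).trans ((OrderIso.mulLeft₀ _ hs).trans (OrderIso.addRight p')),
    ?_, ?_⟩
  · simp
  · simp only [OrderIso.trans_apply, OrderIso.addRight_apply, OrderIso.mulLeft₀_apply]
    field_simp
    ring

/-- The identity, three affine pieces and again the identity are glued at `0`, `a`, `b` and `l`. -/
lemma exists_orderIso_move {a b a' b' l : ℝ} (ha : 0 < a) (hab : a < b) (hb : b < l)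
    (ha' : 0 < a') (hab' : a' < b') (hb' : b' < l) :
    ∃ h : ℝ ≃o ℝ, h a = a' ∧ h b = b' ∧ (∀ x ≤ 0, h x = x) ∧ ∀ x, l ≤ x → h x = x := by
  obtain ⟨f₁, h₁, h₁'⟩ := exists_orderIso_affine ha ha'
  obtain ⟨f₂, h₂, h₂'⟩ := exists_orderIso_affine hab hab'
  obtain ⟨f₃, h₃, h₃'⟩ := exists_orderIso_affine hb hb'
  obtain ⟨k₁, l₁, r₁⟩ := exists_orderIso_glue (OrderIso.refl ℝ) f₁ (c := 0) (by simp [h₁])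
  obtain ⟨k₂, l₂, r₂⟩ := exists_orderIso_glue k₁ f₂ (c := a) (by rw [r₁ a ha.le, h₁', h₂])
  obtain ⟨k₃, l₃, r₃⟩ := exists_orderIso_glue k₂ f₃ (c := b) (by rw [r₂ b hab.le, h₂', h₃])
  obtain ⟨k₄, l₄, r₄⟩ := exists_orderIso_glue k₃ (OrderIso.refl ℝ) (c := l)
    (by rw [r₃ l hb.le, h₃']; rfl)
  refine ⟨k₄, ?_, ?_, fun x hx => ?_, r₄⟩
  · rw [l₄ a (hab.trans hb).le, l₃ a hab.le, l₂ a le_rfl, r₁ a ha.le, h₁']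
  · rw [l₄ b hb.le, l₃ b le_rfl, r₂ b hab.le, h₂']
  · rw [l₄ x (by linarith), l₃ x (by linarith), l₂ x (by linarith), l₁ x hx]
    rfl

/-- An increasing bijection of the unit interval extends to a bijection of the line commuting with
the unit translation. -/
lemma exists_orderIso_periodic (h : ℝ ≃o ℝ) (h0 : h 0 = 0) (h1 : h 1 = 1) :
    ∃ H : ℝ ≃o ℝ, (∀ x, H (x + 1) = H x + 1) ∧ ∀ x ∈ Ico (0 : ℝ) 1, H x = h x := by
  let H : ℝ → ℝ := fun x => ⌊x⌋ + h (Int.fract x)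
  have hf0 : ∀ x, 0 ≤ h (Int.fract x) := fun x => by
    have := h.monotone (Int.fract_nonneg x); rwa [h0] at this
  have hf1 : ∀ x, h (Int.fract x) < 1 := fun x => by
    have := h.strictMono (Int.fract_lt_one x); rwa [h1] at this
  have hH : StrictMono H := by
    intro x y hxy
    rcases (Int.floor_mono hxy.le).eq_or_lt with e | e
    · simp only [H, e, add_lt_add_iff_left]
      refine h.strictMono ?_
      rw [Int.fract, Int.fract, e]
      linarith
    · have e' : (⌊x⌋ : ℝ) + 1 ≤ ⌊y⌋ := by exact_mod_cast e
      simp only [H]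
      linarith [hf1 x, hf0 y]
  have hs : Function.Surjective H := by
    intro y
    have h₁ : 0 ≤ h.symm (Int.fract y) := by
      rw [h.le_symm_apply, h0]; exact Int.fract_nonneg y
    have h₂ : h.symm (Int.fract y) < 1 := by
      rw [h.symm_apply_lt, h1]; exact Int.fract_lt_one y
    refine ⟨⌊y⌋ + h.symm (Int.fract y), ?_⟩
    simp only [H, Int.floor_intCast_add, Int.fract_intCast_add, Int.floor_eq_zero_iff.2 ⟨h₁, h₂⟩,
      Int.fract_eq_self.2 ⟨h₁, h₂⟩, h.apply_symm_apply]
    simp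
  refine ⟨hH.orderIsoOfSurjective H hs, fun x => ?_, fun x hx => ?_⟩
  · simp only [StrictMono.coe_orderIsoOfSurjective, H, Int.floor_add_one, Int.fract_add_one]
    push_cast; ring
  · simp [H, Int.floor_eq_zero_iff.2 hx, Int.fract_eq_self.2 hx]

/-- Transport of `H` along the parametrization `u ↦ r + ε u` of a strand. Conjugation by a
reflection again gives an increasing map, and commutation with the unit translation lets it descend
to the circle. -/
lemma exists_orderIso_conj (H : ℝ ≃o ℝ) (hH : ∀ x, H (x + 1) = H x + 1) (r : ℝ) (ε : ℤˣ) :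
    ∃ G : ℝ ≃o ℝ, (∀ x, G (x + 1) = G x + 1) ∧
      ∀ u, G (r + ((ε : ℤ) : ℝ) * u) = r + ((ε : ℤ) : ℝ) * H u := by
  rcases Int.units_eq_one_or ε with rfl | rfl
  · refine ⟨(OrderIso.addLeft (-r)).trans (H.trans (OrderIso.addLeft r)), fun x => ?_,
      fun u => ?_⟩
    · simp [← add_assoc, hH]
    · simp
  · have hH' : ∀ x, H (x - 1) = H x - 1 := fun x => by
      have := hH (x - 1); rw [sub_add_cancel] at this; linarith
    refine ⟨⟨⟨fun x => r - H (r - x), fun x => r - H.symm (r - x), fun x => by simp,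
      fun x => by simp⟩, fun {x y} => ?_⟩, fun x => ?_, fun u => ?_⟩
    · change r - H (r - x) ≤ r - H (r - y) ↔ x ≤ y
      rw [sub_le_sub_iff_left, H.le_iff_le, sub_le_sub_iff_left]
    · change r - H (r - (x + 1)) = r - H (r - x) + 1
      rw [← sub_sub, hH']; ring
    · change r - H (r - (r + _)) = _
      simp [sub_eq_add_neg]

end LineMaps

/-! ### Homeomorphisms of the circles which slide points along strands -/

section Homeo

variable {n : ℕ}

lemma exists_circle_homeo (G : ℝ ≃o ℝ) (hG : ∀ x, G (x + 1) = G x + 1) :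
    ∃ T : UnitAddCircle ≃ₜ UnitAddCircle, ∀ x : ℝ, T x = (G x : ℝ) := by
  have key : ∀ G : ℝ ≃o ℝ, (∀ x, G (x + 1) = G x + 1) → ∃ T : UnitAddCircle → UnitAddCircle,
      Continuous T ∧ ∀ x : ℝ, T x = (G x : ℝ) := by
    intro G hG
    have hp : Function.Periodic (fun x : ℝ => ((G x : ℝ) : UnitAddCircle)) 1 := fun x => by
      simp [hG]
    refine ⟨hp.lift, ?_, fun x => hp.lift_coe x⟩
    refine (QuotientAddGroup.isQuotientMap_mk
      (N := AddSubgroup.zmultiples (1 : ℝ))).continuous_iff.2 ?_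
    exact (AddCircle.continuous_mk' 1).comp G.continuous
  have hG' : ∀ x, G.symm (x + 1) = G.symm x + 1 := fun x => by
    rw [G.symm_apply_eq, hG, G.apply_symm_apply]
  obtain ⟨T, hT, hTG⟩ := key G hG
  obtain ⟨T', hT', hTG'⟩ := key G.symm hG'
  refine ⟨⟨⟨T, T', ?_, ?_⟩, hT, hT'⟩, hTG⟩
  · intro x
    induction x using QuotientAddGroup.induction_on with
    | H x =>
      have : T (x : UnitAddCircle) = (G x : ℝ) := hTG x
      erw [this, hTG', G.symm_apply_apply]
  · intro x
    induction x using QuotientAddGroup.induction_on with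
    | H x =>
      have : T' (x : UnitAddCircle) = (G.symm x : ℝ) := hTG' x
      erw [this, hTG, G.apply_symm_apply]

/-- As `G` increases, forward half-branches go to forward half-branches; the circles other than the
`i`-th are fixed. -/
lemma exists_source_homeo (i : Fin n) (G : ℝ ≃o ℝ) (hG : ∀ x, G (x + 1) = G x + 1) :
    ∃ θ : Source n ≃ₜ Source n, (∀ x : ℝ, θ (i, x) = (i, ((G x : ℝ) : UnitAddCircle))) ∧
      (∀ s : Source n, s.1 ≠ i → θ s = s) ∧
      ∀ s ε, Tendsto θ (halfNhds s ε) (halfNhds (θ s) ε) := by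
  classical
  obtain ⟨T, hT⟩ := exists_circle_homeo G hG
  let Θ : Fin n → UnitAddCircle ≃ₜ UnitAddCircle := fun j =>
    if j = i then T else Homeomorph.refl _
  have hc : ∀ Θ : Fin n → UnitAddCircle ≃ₜ UnitAddCircle,
      Continuous fun s : Source n => ((s.1, Θ s.1 s.2) : Source n) := fun Θ => by
    rw [continuous_prod_of_discrete_left]
    exact fun j => continuous_const.prodMk (Θ j).continuous
  let θ : Source n ≃ₜ Source n :=
    { toFun := fun s => (s.1, Θ s.1 s.2)
      invFun := fun s => (s.1, (Θ s.1).symm s.2)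
      left_inv := fun s => by simp
      right_inv := fun s => by simp
      continuous_toFun := hc Θ
      continuous_invFun := hc fun j => (Θ j).symm }
  have h₁ : ∀ x : ℝ, θ (i, x) = (i, ((G x : ℝ) : UnitAddCircle)) := fun x => by
    change ((i, Θ i x) : Source n) = _
    simp [Θ, hT]
  have h₂ : ∀ s : Source n, s.1 ≠ i → θ s = s := fun s hs => by
    change ((s.1, Θ s.1 s.2) : Source n) = _
    simp [Θ, hs]
  refine ⟨θ, h₁, h₂, ?_⟩
  rintro ⟨j, z⟩ ε
  by_cases hj : j = i
  · subst hj
    induction z using QuotientAddGroup.induction_on with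
    | H x =>
      -- The distance travelled by the image along its own ray; it tends to `0` and is positive for
      -- `u > 0`.
      have hr : ∀ u, θ (ray (j, (x : UnitAddCircle)) ε u) = ray (θ (j, (x : UnitAddCircle))) ε
          (((ε : ℤ) : ℝ) * (G (x + ((ε : ℤ) : ℝ) * u) - G x)) := fun u => by
        have e₁ : ray (j, (x : UnitAddCircle)) ε u =
            (j, ((x + ((ε : ℤ) : ℝ) * u : ℝ) : UnitAddCircle)) := by simp [ray]
        have e₂ : ((ε : ℤ) : ℝ) * ((ε : ℤ) : ℝ) = 1 := by
          rcases Int.units_eq_one_or ε with rfl | rfl <;> simp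
        rw [e₁, h₁, h₁, ray, ← mul_assoc, e₂, one_mul, ← AddCircle.coe_add, add_sub_cancel]
      change Tendsto θ (halfNhds (j, (x : UnitAddCircle)) ε)
        (halfNhds (θ (j, (x : UnitAddCircle))) ε)
      rw [halfNhds, tendsto_map'_iff, Function.comp_def]
      simp only [hr]
      refine tendsto_map.comp (tendsto_nhdsWithin_iff.2 ⟨?_, ?_⟩)
      · have : Continuous fun u : ℝ => ((ε : ℤ) : ℝ) * (G (x + ((ε : ℤ) : ℝ) * u) - G x) := by
          have := G.continuous
          fun_prop
        have h := this.tendsto 0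
        simp only [mul_zero, add_zero, sub_self] at h
        exact h.mono_left nhdsWithin_le_nhds
      · filter_upwards [self_mem_nhdsWithin] with u hu
        have hu : (0 : ℝ) < u := hu
        rcases Int.units_eq_one_or ε with rfl | rfl
        · simpa using hu
        · simpa using hu
  · have : ∀ᶠ q in halfNhds (j, z) ε, θ q = q := by
      rw [halfNhds, eventually_map]
      exact Eventually.of_forall fun u => h₂ _ hj
    rw [h₂ (j, z) hj]
    exact tendsto_id.congr' (this.mono fun q hq => hq.symm)

/-- A homeomorphism of the domain which moves two points along a strand. -/
lemma exists_homeo_strand (σ : Strand n) {a b a' b' : ℝ} (ha : 0 < a) (hab : a < b)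
    (hb : b < σ.len) (ha' : 0 < a') (hab' : a' < b') (hb' : b' < σ.len) :
    ∃ θ : Source n ≃ₜ Source n, (∀ s ε, Tendsto θ (halfNhds s ε) (halfNhds (θ s) ε)) ∧
      (∀ s, (∀ u ∈ Icc 0 σ.len, s ≠ σ.pos u) → θ s = s) ∧
      (∀ u ∈ Icc 0 σ.len, ∃ v ∈ Icc 0 σ.len, θ (σ.pos u) = σ.pos v) ∧
      θ (σ.pos a) = σ.pos a' ∧ θ (σ.pos b) = σ.pos b' := by
  obtain ⟨h, hha, hhb, hh0, hhl⟩ := exists_orderIso_move ha hab hb ha' hab' hb'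
  have hl := σ.len_lt_one
  obtain ⟨H, hH, hHh⟩ := exists_orderIso_periodic h (hh0 0 le_rfl) (hhl 1 hl.le)
  obtain ⟨⟨i, z⟩, ε, l, hl₀, hl₁⟩ := σ
  simp only [Strand.pos] at *
  induction z using QuotientAddGroup.induction_on with
  | H r =>
  obtain ⟨G, hG, hGH⟩ := exists_orderIso_conj H hH r ε
  obtain ⟨θ, h₁, h₂, h₃⟩ := exists_source_homeo i G hG
  have hp : ∀ u, ray (i, (r : UnitAddCircle)) ε u =
      (i, ((r + ((ε : ℤ) : ℝ) * u : ℝ) : UnitAddCircle)) := fun u => by simp [ray]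
  have hθ : ∀ u ∈ Ico (0 : ℝ) 1, θ (ray (i, (r : UnitAddCircle)) ε u) =
      ray (i, (r : UnitAddCircle)) ε (h u) := fun u hu => by
    rw [hp, h₁, hGH, hHh u hu, hp]
  refine ⟨θ, h₃, ?_, ?_, ?_, ?_⟩
  · rintro ⟨j, w⟩ hs
    by_cases hj : j = i
    · subst hj
      obtain ⟨x, rfl⟩ := QuotientAddGroup.mk_surjective w
      -- `v` is the coordinate in `[0, 1)` of the point, measured along the direction of the strand.
      -- Off the strand it exceeds `l`, where `h` is the identity.
      set v := Int.fract (((ε : ℤ) : ℝ) * (x - r)) with hv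
      have hv₀ : v ∈ Ico (0 : ℝ) 1 := ⟨Int.fract_nonneg _, Int.fract_lt_one _⟩
      have hx : ((j, (x : UnitAddCircle)) : Source n) = ray (j, (r : UnitAddCircle)) ε v := by
        have e₁ : ((j, (x : UnitAddCircle)) : Source n) =
            ray (j, (r : UnitAddCircle)) ε (((ε : ℤ) : ℝ) * (x - r)) := by
          rw [hp, ← mul_assoc]
          rcases Int.units_eq_one_or ε with rfl | rfl <;> simp
        rw [e₁, ray_eq_iff]
        exact ⟨⌊((ε : ℤ) : ℝ) * (x - r)⌋, by rw [hv, Int.fract]; ring⟩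
      have hv₁ : l < v := by
        by_contra hlt
        exact hs v ⟨hv₀.1, not_lt.1 hlt⟩ hx
      change θ (j, (x : UnitAddCircle)) = (j, (x : UnitAddCircle))
      rw [hx]
      exact (hθ v hv₀).trans (by rw [hhl v hv₁.le])
    · exact h₂ _ hj
  · intro u hu
    refine ⟨h u, ⟨?_, ?_⟩, hθ u ⟨hu.1, hu.2.trans_lt hl⟩⟩
    · have := h.monotone hu.1
      rwa [hh0 0 le_rfl] at this
    · have := h.monotone hu.2
      rwa [hhl l le_rfl] at this
  · exact (hθ a ⟨ha.le, by linarith⟩).trans (by rw [hha])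
  · exact (hθ b ⟨by linarith, by linarith⟩).trans (by rw [hhb])

/-- A homeomorphism of the domain which moves two points along each of several disjoint
strands. -/
lemma exists_homeo_strands {k : ℕ} (σ : Fin k → Strand n)
    (hσ : ∀ i j, ∀ u ∈ Icc 0 (σ i).len, ∀ v ∈ Icc 0 (σ j).len,
      (σ i).pos u = (σ j).pos v → i = j ∧ u = v)
    {a b a' b' : Fin k → ℝ} (h : ∀ i, 0 < a i ∧ a i < b i ∧ b i < (σ i).len)
    (h' : ∀ i, 0 < a' i ∧ a' i < b' i ∧ b' i < (σ i).len) :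
    ∃ θ : Source n ≃ₜ Source n, (∀ s ε, Tendsto θ (halfNhds s ε) (halfNhds (θ s) ε)) ∧
      (∀ s, (∀ i, ∀ u ∈ Icc 0 (σ i).len, s ≠ (σ i).pos u) → θ s = s) ∧
      (∀ i, ∀ u ∈ Icc 0 (σ i).len, ∃ v ∈ Icc 0 (σ i).len, θ ((σ i).pos u) = (σ i).pos v) ∧
      ∀ i, θ ((σ i).pos (a i)) = (σ i).pos (a' i) ∧ θ ((σ i).pos (b i)) = (σ i).pos (b' i) := by
  classical
  -- The strands are moved one after the other; since they are disjoint, the homeomorphism for one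
  -- of them fixes all the others pointwise.
  suffices ∀ F : Finset (Fin k), ∃ θ : Source n ≃ₜ Source n,
      (∀ s ε, Tendsto θ (halfNhds s ε) (halfNhds (θ s) ε)) ∧
      (∀ s, (∀ i ∈ F, ∀ u ∈ Icc 0 (σ i).len, s ≠ (σ i).pos u) → θ s = s) ∧
      (∀ i ∈ F, ∀ u ∈ Icc 0 (σ i).len, ∃ v ∈ Icc 0 (σ i).len, θ ((σ i).pos u) = (σ i).pos v) ∧
      ∀ i ∈ F, θ ((σ i).pos (a i)) = (σ i).pos (a' i) ∧
        θ ((σ i).pos (b i)) = (σ i).pos (b' i) by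
    simpa using this Finset.univ
  intro F
  induction F using Finset.induction_on with
  | empty => exact ⟨Homeomorph.refl _, fun s ε => tendsto_id, by simp, by simp, by simp⟩
  | insert j F hj ih =>
    obtain ⟨θ, t₁, t₂, t₃, t₄⟩ := ih
    obtain ⟨τ, s₁, s₂, s₃, s₄, s₅⟩ := exists_homeo_strand (σ j) (h j).1 (h j).2.1 (h j).2.2
      (h' j).1 (h' j).2.1 (h' j).2.2
    have hθ : ∀ u ∈ Icc 0 (σ j).len, θ ((σ j).pos u) = (σ j).pos u := fun u hu =>
      t₂ _ fun i hi v hv e => hj ((hσ j i u hu v hv e).1 ▸ hi)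
    have hτ : ∀ i ∈ F, ∀ u ∈ Icc 0 (σ i).len, τ ((σ i).pos u) = (σ i).pos u := fun i hi u hu =>
      s₂ _ fun v hv e => hj ((hσ i j u hu v hv e).1 ▸ hi)
    have ha : ∀ i, a i ∈ Icc 0 (σ i).len := fun i =>
      ⟨(h i).1.le, ((h i).2.1.trans (h i).2.2).le⟩
    have hb : ∀ i, b i ∈ Icc 0 (σ i).len := fun i =>
      ⟨((h i).1.trans (h i).2.1).le, (h i).2.2.le⟩
    have ha' : ∀ i, a' i ∈ Icc 0 (σ i).len := fun i =>
      ⟨(h' i).1.le, ((h' i).2.1.trans (h' i).2.2).le⟩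
    have hb' : ∀ i, b' i ∈ Icc 0 (σ i).len := fun i =>
      ⟨((h' i).1.trans (h' i).2.1).le, (h' i).2.2.le⟩
    refine ⟨θ.trans τ, fun s ε => (s₁ (θ s) ε).comp (t₁ s ε), ?_, ?_, ?_⟩
    · intro s hs
      simp only [Finset.mem_insert, forall_eq_or_imp] at hs
      rw [Homeomorph.trans_apply, t₂ s hs.2, s₂ s hs.1]
    · simp only [Finset.mem_insert, forall_eq_or_imp, Homeomorph.trans_apply]
      refine ⟨fun u hu => by rw [hθ u hu]; exact s₃ u hu, fun i hi u hu => ?_⟩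
      obtain ⟨v, hv, e⟩ := t₃ i hi u hu
      exact ⟨v, hv, by rw [e, hτ i hi v hv]⟩
    · simp only [Finset.mem_insert, forall_eq_or_imp, Homeomorph.trans_apply]
      refine ⟨⟨by rw [hθ _ (ha j), s₄], by rw [hθ _ (hb j), s₅]⟩, fun i hi => ⟨?_, ?_⟩⟩
      · rw [(t₄ i hi).1, hτ i hi _ (ha' i)]
      · rw [(t₄ i hi).2, hτ i hi _ (hb' i)]

end Homeo

/-! ### Brackets of links with given crossings in a region -/

section LocalCrossings

open LaurentPolynomial

variable {X : Type*} [TopologicalSpace X] {n r : ℕ}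

lemma Link.finite_compl_cutSource (L : Link X n) : (cutSource L.curve)ᶜ.Finite := by
  refine L.finite_multiple.subset fun s hs => ?_
  simp only [cutSource, mem_compl_iff, mem_ofPred_eq, not_forall] at hs
  obtain ⟨t, h, h'⟩ := hs
  exact ⟨t, h', h⟩

lemma Link.mem_crossingSet (L : Link X n) (y : X) :
    y ∈ L.crossingSet ↔ ∃ s t, s ≠ t ∧ L.curve s = y ∧ L.curve t = y := by
  simp [crossingSet, crossings]

lemma Link.mem_selfCrossingSet (L : Link X n) (i : Fin n) (y : X) :
    y ∈ L.selfCrossingSet i ↔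
      ∃ s t, s ≠ t ∧ s.1 = i ∧ t.1 = i ∧ L.curve s = y ∧ L.curve t = y := by
  simp [selfCrossingSet, selfCrossings]

/-- Reversing one of the two directions toggles the dot, so the dot depends on the product `ε δ`
alone. -/
lemma Link.dotted_iff (L : Link X n) {s t : Source n} (hst : s ≠ t) (h : L.curve s = L.curve t)
    (ε δ : ℤˣ) : L.dotted s ε t δ ↔ (ε * δ = 1 ↔ L.dotted s 1 t 1) := by
  have h₁ := L.dotted_neg s 1 t 1 hst h
  have h₂ := L.dotted_neg t 1 s 1 hst.symm h.symm
  have h₃ := L.dotted_neg s (-1) t 1 hst h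
  have hc : ∀ ε δ, L.dotted s ε t δ ↔ L.dotted t δ s ε := fun ε δ =>
    ⟨L.dotted_symm _ _ _ _, L.dotted_symm _ _ _ _⟩
  rw [← hc, ← hc] at h₂
  rcases Int.units_eq_one_or ε with rfl | rfl <;> rcases Int.units_eq_one_or δ with rfl | rfl <;>
    simp <;> tauto

/-- The crossings of `L` in `D` are the points `L.curve (x k) = L.curve (x' k)`. -/
structure LocalCrossings (L : Link X n) (D : Set X) (x x' : Fin r → Source n) : Prop where
  mem : ∀ k, L.curve (x k) ∈ D
  iff : ∀ s t, L.curve s ∈ D → ((s ≠ t ∧ L.curve s = L.curve t) ↔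
    ∃ k, (s = x k ∧ t = x' k) ∨ (s = x' k ∧ t = x k))
  inj : Function.Injective fun k => L.curve (x k)

open Classical in
/-- The crossings outside of `D`. -/
noncomputable def Link.outerCrossings (L : Link X n) (D : Set X) : Finset X :=
  L.crossingSet.filter (· ∉ D)

/-- The smoothing of the crossings outside of `D`. -/
def Link.outerSmoothing (L : Link X n) (D : Set X) (C : Finset X) (s : Source n) (ε : ℤˣ)
    (t : Source n) (δ : ℤˣ) : Prop :=
  L.curve s ∉ D ∧ L.smoothing C s ε t δ

/-- The components of the cut domain which end at the points `x k`. -/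
noncomputable def crossingEnds {U : Set (Source n)} (hU : Uᶜ.Finite) (x : Fin r → Source n)
    (ε : Fin r → ℤˣ) (k : Fin r) (η : ℤˣ) : ConnectedComponents U :=
  branchEnd hU (x k) (η * ε k)

variable {L : Link X n} {D : Set X} {x x' : Fin r → Source n}

lemma LocalCrossings.pair (H : LocalCrossings L D x x') (k : Fin r) :
    x k ≠ x' k ∧ L.curve (x k) = L.curve (x' k) :=
  (H.iff _ _ (H.mem k)).2 ⟨k, Or.inl ⟨rfl, rfl⟩⟩

open Classical in
lemma LocalCrossings.crossingSet_eq (H : LocalCrossings L D x x') :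
    L.crossingSet = L.outerCrossings D ∪ Finset.univ.image fun k => L.curve (x k) := by
  ext y
  simp only [Finset.mem_union, Link.outerCrossings, Finset.mem_filter, Finset.mem_image,
    Finset.mem_univ, true_and]
  constructor
  · intro h
    by_cases hy : y ∈ D
    · right
      obtain ⟨s, t, hst, rfl, h⟩ := (L.mem_crossingSet y).1 h
      obtain ⟨k, ⟨rfl, rfl⟩ | ⟨rfl, rfl⟩⟩ := (H.iff s t hy).1 ⟨hst, h.symm⟩
      · exact ⟨k, rfl⟩
      · exact ⟨k, h⟩
    · exact Or.inl ⟨h, hy⟩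
  · rintro (h | ⟨k, rfl⟩)
    · exact h.1
    · exact (L.mem_crossingSet _).2 ⟨x k, x' k, (H.pair k).1, rfl, (H.pair k).2.symm⟩

open Classical in
lemma LocalCrossings.disjoint (H : LocalCrossings L D x x') :
    Disjoint (L.outerCrossings D) (Finset.univ.image fun k => L.curve (x k)) := by
  rw [Finset.disjoint_left]
  intro y hy hy'
  simp only [Finset.mem_image, Finset.mem_univ, true_and] at hy'
  obtain ⟨k, rfl⟩ := hy'
  exact (Finset.mem_filter.1 hy).2 (H.mem k)

lemma LocalCrossings.card_crossingSet (H : LocalCrossings L D x x') :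
    L.crossingSet.card = (L.outerCrossings D).card + r := by
  classical
  rw [H.crossingSet_eq, Finset.card_union_of_disjoint H.disjoint,
    Finset.card_image_of_injective _ H.inj, Finset.card_univ, Fintype.card_fin]

/-- The number of curves in a smoothing, computed from the outer smoothing and the local
crossings. -/
lemma LocalCrossings.numCurves_eq (H : LocalCrossings L D x x') (ε ε' : Fin r → ℤˣ)
    {C C' : Finset X} (hC : ∀ y ∉ D, y ∈ C' ↔ y ∈ C) {f : Fin r → ℤˣ}
    (hf : ∀ k, f k = 1 ↔ (L.curve (x k) ∈ C' ↔ ¬ L.dotted (x k) (ε k) (x' k) (ε' k))) :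
    L.numCurves C' =
      stateCount (EndsJoined L.finite_compl_cutSource (L.outerSmoothing D C))
        (crossingEnds L.finite_compl_cutSource x ε)
        (crossingEnds L.finite_compl_cutSource x' ε') f := by
  set hU := L.finite_compl_cutSource
  -- At the `k`-th local crossing the smoothing joins exactly the ends `η` and `f k * η`, measured
  -- from the reference directions `ε k` and `ε' k`. This is a finite check of signs.
  have hd : ∀ k η η', L.smoothing C' (x k) (η * ε k) (x' k) (η' * ε' k) ↔ η' = f k * η := by
    intro k η η'
    obtain ⟨h₁, h₂⟩ := H.pair k
    have h₃ := L.dotted_iff h₁ h₂ (ε k) (ε' k)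
    have h₄ := L.dotted_iff h₁ h₂ (η * ε k) (η' * ε' k)
    have h₅ := hf k
    have h₆ : L.smoothing C' (x k) (η * ε k) (x' k) (η' * ε' k) ↔
        (L.curve (x k) ∈ C' ↔ ¬ L.dotted (x k) (η * ε k) (x' k) (η' * ε' k)) := by
      simp only [Link.smoothing, h₁, h₂, ne_eq, not_false_eq_true, true_and]
      tauto
    rw [h₆, h₄]
    rw [h₃] at h₅
    clear h₆ h₄ h₃ h₂ h₁
    generalize f k = φ at *
    generalize ε k = α at *
    generalize ε' k = β at *
    rcases Int.units_eq_one_or φ with rfl | rfl <;> rcases Int.units_eq_one_or α with rfl | rfl <;>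
    rcases Int.units_eq_one_or β with rfl | rfl <;> rcases Int.units_eq_one_or η with rfl | rfl <;>
    rcases Int.units_eq_one_or η' with rfl | rfl <;> simp at h₅ ⊢ <;> tauto
  -- An arbitrary direction is rewritten relative to the reference direction.
  have hη : ∀ ε η : ℤˣ, ε = (ε * η) * η := fun ε η => by
    rw [mul_assoc, Int.units_mul_self, mul_one]
  rw [Link.numCurves, smoothingCount_eq_arcCount, arcCount_eq_card hU]
  refine card_quot_congr ?_ ?_
  · rintro _ _ ⟨s, α, t, β, h, rfl, rfl⟩
    by_cases hs : L.curve s ∈ D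
    · obtain ⟨k, ⟨rfl, rfl⟩ | ⟨rfl, rfl⟩⟩ := (H.iff s t hs).1 ⟨h.1, h.2.1⟩
      · rw [hη α (ε k), hη β (ε' k)] at h ⊢
        rw [hd] at h
        exact Quot.sound (Or.inr ⟨k, _, rfl, by rw [crossingEnds, h]⟩)
      · have h' : L.smoothing C' (x k) β (x' k) α := by
          refine ⟨h.1.symm, h.2.1.symm, ?_⟩
          rw [← h.2.1]
          refine h.2.2.imp (And.imp_right fun h₁ h₂ => h₁ (L.dotted_symm _ _ _ _ h₂))
            (And.imp_right (L.dotted_symm _ _ _ _))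
        rw [hη β (ε k), hη α (ε' k)] at h' ⊢
        rw [hd] at h'
        refine Eq.symm (Quot.sound (Or.inr ⟨k, _, rfl, by rw [crossingEnds, h']⟩))
    · refine Quot.sound (Or.inl ⟨s, α, t, β, ⟨hs, h.1, h.2.1, ?_⟩, rfl, rfl⟩)
      rw [← hC _ hs]
      exact h.2.2
  · rintro a b (⟨s, α, t, β, ⟨hs, h⟩, rfl, rfl⟩ | ⟨k, η, rfl, rfl⟩)
    · refine Quot.sound ⟨s, α, t, β, ⟨h.1, h.2.1, ?_⟩, rfl, rfl⟩
      rw [hC _ hs]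
      exact h.2.2
    · exact Quot.sound ⟨_, _, _, _, (hd k η _).2 rfl, rfl, rfl⟩

lemma prod_T_ite {p : Fin r → Prop} [DecidablePred p] :
    ∏ k, (if p k then T 1 else T (-1) : LaurentPolynomial ℤ) =
      T (2 * ((Finset.univ.filter p).card : ℤ) - r) := by
  have h : ∀ k, (if p k then T 1 else T (-1) : LaurentPolynomial ℤ) =
      T (if p k then 1 else -1) := fun k => by split_ifs <;> rfl
  have h' : ∀ (F : Finset (Fin r)) (g : Fin r → ℤ),
      ∏ k ∈ F, (T (g k) : LaurentPolynomial ℤ) = T (∑ k ∈ F, g k) := by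
    intro F g
    induction F using Finset.induction_on with
    | empty => simp
    | insert a F ha ih => rw [Finset.prod_insert ha, Finset.sum_insert ha, ih, T_add]
  simp only [h]
  rw [h']
  congr 1
  have : ∀ k, (if p k then (1 : ℤ) else -1) = 2 * (if p k then 1 else 0) - 1 := fun k => by
    split_ifs <;> rfl
  simp only [this, Finset.sum_sub_distrib, ← Finset.mul_sum, Finset.sum_boole]
  simp

/-- A set of crossings is a set of outer crossings together with a smoothing of each local one, and
the weight `A ^ (2|C| - cro)` is the outer weight times one factor `A` or `A⁻¹` per local crossing.
-/
lemma LocalCrossings.bracket_eq (H : LocalCrossings L D x x') (ε ε' : Fin r → ℤˣ) :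
    L.bracket = ∑ C ∈ (L.outerCrossings D).powerset,
      stateSum (fun k => L.dotted (x k) (ε k) (x' k) (ε' k))
        (stateCount (EndsJoined L.finite_compl_cutSource (L.outerSmoothing D C))
          (crossingEnds L.finite_compl_cutSource x ε)
          (crossingEnds L.finite_compl_cutSource x' ε')) *
        T (2 * (C.card : ℤ) - ((L.outerCrossings D).card : ℤ)) := by
  classical
  simp only [stateSum, Finset.sum_mul]
  rw [← Finset.sum_product', Link.bracket]
  set κ : Fin r → Prop := fun k => L.dotted (x k) (ε k) (x' k) (ε' k)
  -- The local crossings at which `f` has weight `A`, that is, those which belong to the set of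
  -- crossings encoded by `f`.
  let Y : (Fin r → ℤˣ) → Finset (Fin r) := fun f => Finset.univ.filter fun k => ¬ (f k = 1 ↔ κ k)
  have hout : ∀ C ⊆ L.outerCrossings D, ∀ k, L.curve (x k) ∉ C := fun C hC k h =>
    (Finset.mem_filter.1 (hC h)).2 (H.mem k)
  have hinn : ∀ (F : Finset (Fin r)) k, L.curve (x k) ∈ F.image (fun k => L.curve (x k)) ↔
      k ∈ F := fun F k => by
    rw [Finset.mem_image]
    exact ⟨fun ⟨l, hl, h⟩ => H.inj h ▸ hl, fun h => ⟨k, h, rfl⟩⟩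
  have hinD : ∀ (F : Finset (Fin r)), ∀ y ∈ F.image (fun k => L.curve (x k)), y ∈ D := by
    intro F y hy
    obtain ⟨k, -, rfl⟩ := Finset.mem_image.1 hy
    exact H.mem k
  symm
  refine Finset.sum_bij' (fun p _ => p.1 ∪ (Y p.2).image fun k => L.curve (x k))
    (fun C _ => (C.filter (· ∉ D), fun k => if L.curve (x k) ∈ C ↔ ¬ κ k then 1 else -1))
    ?_ ?_ ?_ ?_ ?_
  · rintro ⟨C, f⟩ hp
    simp only [Finset.mem_product, Finset.mem_powerset, Finset.mem_univ, and_true] at hp ⊢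
    rw [H.crossingSet_eq]
    exact Finset.union_subset_union hp (Finset.image_subset_image (Finset.subset_univ _))
  · intro C hC
    simp only [Finset.mem_product, Finset.mem_powerset, Finset.mem_univ, and_true] at hC ⊢
    exact Finset.filter_subset_filter _ hC
  · rintro ⟨C, f⟩ hp
    simp only [Finset.mem_product, Finset.mem_powerset, Finset.mem_univ, and_true] at hp
    ext1
    · ext y
      simp only [Finset.mem_filter, Finset.mem_union]
      constructor
      · rintro ⟨h | h, h'⟩
        · exact h
        · exact absurd (hinD _ _ h) h'
      · exact fun h => ⟨Or.inl h, (Finset.mem_filter.1 (hp h)).2⟩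
    · funext k
      simp only [Finset.mem_union, hout C hp k, hinn, false_or]
      simp only [Y, Finset.mem_filter, Finset.mem_univ, true_and]
      rcases Int.units_eq_one_or (f k) with h | h <;> rw [h] <;> by_cases hk : κ k <;> simp [hk]
  · intro C hC
    rw [Finset.mem_powerset] at hC
    ext y
    simp only [Finset.mem_filter, Finset.mem_union]
    by_cases hy : y ∈ D
    · simp only [hy, not_true, and_false, false_or]
      constructor
      · intro h
        obtain ⟨k, hk, rfl⟩ := Finset.mem_image.1 h
        simp only [Y, Finset.mem_filter, Finset.mem_univ, true_and] at hk
        by_contra hC'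
        by_cases hκ : κ k <;> simp [hκ, hC'] at hk
      · intro h
        have h' := hC h
        rw [H.crossingSet_eq, Finset.mem_union] at h'
        rcases h' with h' | h'
        · exact absurd hy (Finset.mem_filter.1 h').2
        · obtain ⟨k, -, rfl⟩ := Finset.mem_image.1 h'
          rw [hinn]
          by_cases hκ : κ k <;> simp [Y, hκ, h]
    · simp only [hy, not_false_eq_true, and_true, or_iff_left_iff_imp]
      exact fun h => absurd (hinD _ _ h) hy
  · rintro ⟨C, f⟩ hp
    simp only [Finset.mem_product, Finset.mem_powerset, Finset.mem_univ, and_true] at hp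
    have hcard : (C ∪ (Y f).image fun k => L.curve (x k)).card = C.card + (Y f).card := by
      rw [Finset.card_union_of_disjoint, Finset.card_image_of_injective _ H.inj]
      exact H.disjoint.mono hp (Finset.image_subset_image (Finset.subset_univ _))
    have hw : ∏ k, smoothingWeight (κ k) (f k) = T (2 * ((Y f).card : ℤ) - r) := by
      rw [← prod_T_ite]
      refine Finset.prod_congr rfl fun k _ => ?_
      unfold smoothingWeight
      split_ifs <;> rfl
    rw [hw, H.numCurves_eq ε ε' (C := C) (f := f), hcard, H.card_crossingSet, mul_assoc, ← T_add,
      loopValue]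
    · congr 2
      push_cast
      ring
    · intro y hy
      rw [Finset.mem_union]
      exact or_iff_left fun h => hy (hinD _ _ h)
    · intro k
      rw [Finset.mem_union, or_iff_right (hout C hp k), hinn]
      simp only [Y, Finset.mem_filter, Finset.mem_univ, true_and, κ]
      tauto

end LocalCrossings

/-! ### The writhe as a sum over crossings -/

section Writhe

variable {X : Type*} [TopologicalSpace X] {n r : ℕ}

open Classical in
/-- The sign of a self-crossing; zero at all other points. -/
noncomputable def Link.selfSign (L : Link X n) (y : X) : ℤ :=
  if ∃ s t, s ≠ t ∧ s.1 = t.1 ∧ L.curve s = y ∧ L.curve t = y then L.sign y else 0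

open Classical in
/-- The contribution of the crossing with preimages `s`, `t` to the writhe. -/
noncomputable def Link.localSign (L : Link X n) (s t : Source n) : ℤ :=
  if s.1 = t.1 then if L.dotted s 1 t 1 then 1 else -1 else 0

/-- There are no triple points, so a crossing determines its two preimages up to order. -/
lemma Link.pair_unique (L : Link X n) {s t s' t' : Source n} (hst : s ≠ t) (hst' : s' ≠ t')
    (h : L.curve s = L.curve t) (h' : L.curve s' = L.curve t') (h'' : L.curve s' = L.curve s) :
    (s' = s ∧ t' = t) ∨ (s' = t ∧ t' = s) := by
  have h₁ := L.double s' s t h'' h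
  have h₂ := L.double t' s t (h'.symm.trans h'') h
  grind

/-- The two preimages of a self-crossing lie on one circle, so it is counted for exactly one
component. -/
lemma Link.wri_eq_sum (L : Link X n) : L.wri = ∑ y ∈ L.crossingSet, L.selfSign y := by
  classical
  have h₁ : ∀ i, ∑ y ∈ L.selfCrossingSet i, L.sign y =
      ∑ y ∈ L.crossingSet, if y ∈ L.selfCrossingSet i then L.sign y else 0 := by
    intro i
    rw [← Finset.sum_filter]
    refine Finset.sum_congr ?_ fun _ _ => rfl
    ext y
    rw [Finset.mem_filter, iff_and_self]
    intro h
    obtain ⟨s, t, hst, -, -, h⟩ := (L.mem_selfCrossingSet i y).1 h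
    exact (L.mem_crossingSet y).2 ⟨s, t, hst, h⟩
  rw [Link.wri, Finset.sum_congr rfl fun i _ => h₁ i, Finset.sum_comm]
  refine Finset.sum_congr rfl fun y hy => ?_
  unfold Link.selfSign
  split_ifs with h
  · obtain ⟨s, t, hst, hi, hs, ht⟩ := h
    rw [Finset.sum_eq_single s.1]
    · rw [if_pos]
      exact (L.mem_selfCrossingSet _ y).2 ⟨s, t, hst, rfl, hi.symm, hs, ht⟩
    · intro j _ hj
      refine if_neg fun h => hj ?_
      obtain ⟨s', t', hst', rfl, -, hs', ht'⟩ := (L.mem_selfCrossingSet _ y).1 h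
      rcases L.pair_unique hst hst' (hs.trans ht.symm) (hs'.trans ht'.symm)
        (hs'.trans hs.symm) with h | h
      · rw [h.1]
      · rw [h.1, hi]
    · simp
  · refine Finset.sum_eq_zero fun i _ => if_neg fun h' => h ?_
    obtain ⟨s, t, hst, rfl, hi, hs, ht⟩ := (L.mem_selfCrossingSet _ y).1 h'
    exact ⟨s, t, hst, hi.symm, hs, ht⟩

lemma Link.selfSign_eq_localSign (L : Link X n) {s t : Source n} (hst : s ≠ t)
    (h : L.curve s = L.curve t) : L.selfSign (L.curve s) = L.localSign s t := by
  classical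
  have h₁ : (∃ s' t', s' ≠ t' ∧ s'.1 = t'.1 ∧ L.curve s' = L.curve s ∧ L.curve t' = L.curve s) ↔
      s.1 = t.1 := by
    constructor
    · rintro ⟨s', t', hst', hi, hs', ht'⟩
      rcases L.pair_unique hst hst' h (hs'.trans ht'.symm) hs' with h | h
      · rw [← h.1, ← h.2, hi]
      · rw [← h.1, ← h.2, hi]
    · exact fun hi => ⟨s, t, hst, hi, rfl, h.symm⟩
  have h₂ : (∃ s' t', L.curve s' = L.curve s ∧ L.curve t' = L.curve s ∧ L.dotted s' 1 t' 1) ↔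
      L.dotted s 1 t 1 := by
    constructor
    · rintro ⟨s', t', hs', ht', hd⟩
      rcases L.pair_unique hst (L.dotted_crossing _ _ _ _ hd).1 h (hs'.trans ht'.symm) hs' with
        ⟨rfl, rfl⟩ | ⟨rfl, rfl⟩
      · exact hd
      · exact L.dotted_symm _ _ _ _ hd
    · exact fun hd => ⟨s, t, rfl, h.symm, hd⟩
  simp only [Link.selfSign, Link.localSign, Link.sign, h₁, h₂]

lemma LocalCrossings.wri_eq {L : Link X n} {D : Set X} {x x' : Fin r → Source n}
    (H : LocalCrossings L D x x') :
    L.wri = ∑ y ∈ L.outerCrossings D, L.selfSign y + ∑ k, L.localSign (x k) (x' k) := by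
  classical
  rw [L.wri_eq_sum, H.crossingSet_eq, Finset.sum_union H.disjoint,
    Finset.sum_image fun _ _ _ _ h => H.inj h]
  congr 1
  exact Finset.sum_congr rfl fun k _ => L.selfSign_eq_localSign (H.pair k).1 (H.pair k).2

/-- The sign refers to the parametrization and the picture of a move to the directions of the
strands. A dot in one area determines the dots in all four, so it is enough to compare the dots in
any one area. -/
lemma Link.localSign_congr {L L' : Link X n} {s t s' t' : Source n} (h : s ≠ t) (h' : s' ≠ t')
    (hc : L.curve s = L.curve t) (hc' : L'.curve s' = L'.curve t') (hs : s'.1 = s.1)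
    (ht : t'.1 = t.1) {ε δ : ℤˣ} (hd : L'.dotted s' ε t' δ ↔ L.dotted s ε t δ) :
    L'.localSign s' t' = L.localSign s t := by
  rw [L.dotted_iff h hc, L'.dotted_iff h' hc'] at hd
  have : L'.dotted s' 1 t' 1 ↔ L.dotted s 1 t 1 := by tauto
  rw [Link.localSign, Link.localSign, hs, ht]
  by_cases h₁ : L.dotted s 1 t 1
  · rw [if_pos h₁, if_pos (this.2 h₁)]
  · rw [if_neg h₁, if_neg (this.not.2 h₁)]

end Writhe

/-! ### Replacing strands -/

section Replaces

variable {X : Type*} [TopologicalSpace X] {n k r : ℕ} {L L' : Link X n} {D bd : Set X}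
  {σ : Fin k → Strand n}

lemma Replaces.mem_iff (H : Replaces L L' D bd σ) (s : Source n) :
    L'.curve s ∈ D ↔ L.curve s ∈ D :=
  (H.meets'.mem_iff s).trans (H.meets.mem_iff s).symm

lemma Replaces.curve_eq_iff (H : Replaces L L' D bd σ) {y : X} (hy : y ∉ D) (s : Source n) :
    L'.curve s = y ↔ L.curve s = y := by
  constructor
  · rintro rfl
    exact (H.off s (by rwa [← H.mem_iff])).symm
  · rintro rfl
    exact H.off s hy

lemma Replaces.outerCrossings (H : Replaces L L' D bd σ) :
    L'.outerCrossings D = L.outerCrossings D := by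
  classical
  ext y
  simp only [Link.outerCrossings, Finset.mem_filter, Link.mem_crossingSet]
  refine and_congr_left fun hy => ?_
  simp only [H.curve_eq_iff hy]

lemma Replaces.selfSign (H : Replaces L L' D bd σ) {y : X} (hy : y ∉ D) :
    L'.selfSign y = L.selfSign y := by
  classical
  have h : (∃ s t, L'.curve s = y ∧ L'.curve t = y ∧ L'.dotted s 1 t 1) ↔
      ∃ s t, L.curve s = y ∧ L.curve t = y ∧ L.dotted s 1 t 1 := by
    simp only [H.curve_eq_iff hy]
    refine exists_congr fun s => exists_congr fun t => and_congr_right fun hs => ?_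
    rw [H.dots_off s 1 t 1 (by rwa [hs])]
  have h' : L'.sign y = L.sign y := by
    rw [Link.sign, Link.sign]
    exact if_congr h rfl rfl
  rw [Link.selfSign, Link.selfSign, h']
  exact if_congr (by simp only [H.curve_eq_iff hy]) rfl rfl

/-- The two links have the same preimages of a point outside `D` and the same dots there. -/
lemma Replaces.outerSmoothing (H : Replaces L L' D bd σ) (C : Finset X) :
    L'.outerSmoothing D C = L.outerSmoothing D C := by
  funext s ε t δ
  simp only [Link.outerSmoothing, H.mem_iff, eq_iff_iff]
  refine and_congr_right fun hs => ?_
  rw [Link.smoothing, Link.smoothing, H.dots_off s ε t δ hs, H.off s hs, eq_comm (b := L'.curve t),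
    H.curve_eq_iff hs, eq_comm (b := L.curve s)]

lemma Replaces.wri_eq (H : Replaces L L' D bd σ) {x x' : Fin r → Source n} {r' : ℕ}
    {z z' : Fin r' → Source n} (hL : LocalCrossings L D x x') (hL' : LocalCrossings L' D z z') :
    L'.wri = L.wri - ∑ k, L.localSign (x k) (x' k) + ∑ k, L'.localSign (z k) (z' k) := by
  classical
  rw [hL.wri_eq, hL'.wri_eq, H.outerCrossings, add_sub_cancel_right]
  congr 1
  exact Finset.sum_congr rfl fun y hy => H.selfSign (Finset.mem_filter.1 hy).2

/-- Brackets can be compared separately for every smoothing of the outer crossings. -/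
lemma Replaces.bracket_eq (H : Replaces L L' D bd σ) {x x' : Fin r → Source n} {r' : ℕ}
    {z z' : Fin r' → Source n} (hL : LocalCrossings L D x x') (hL' : LocalCrossings L' D z z')
    (ε ε' : Fin r → ℤˣ) (δ δ' : Fin r' → ℤˣ) (a : LaurentPolynomial ℤ)
    (h : ∀ C,
      stateSum (fun k => L'.dotted (z k) (δ k) (z' k) (δ' k))
        (stateCount (EndsJoined L'.finite_compl_cutSource (L.outerSmoothing D C))
          (crossingEnds L'.finite_compl_cutSource z δ)
          (crossingEnds L'.finite_compl_cutSource z' δ')) =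
      a * stateSum (fun k => L.dotted (x k) (ε k) (x' k) (ε' k))
        (stateCount (EndsJoined L.finite_compl_cutSource (L.outerSmoothing D C))
          (crossingEnds L.finite_compl_cutSource x ε)
          (crossingEnds L.finite_compl_cutSource x' ε'))) :
    L'.bracket = a * L.bracket := by
  rw [hL.bracket_eq ε ε', hL'.bracket_eq δ δ', H.outerCrossings, Finset.mul_sum]
  refine Finset.sum_congr rfl fun C _ => ?_
  rw [H.outerSmoothing, h C, mul_assoc]

lemma Replaces.mem_cutSource_iff (H : Replaces L L' D bd σ) {s : Source n} (hs : L.curve s ∉ D) :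
    s ∈ cutSource L'.curve ↔ s ∈ cutSource L.curve := by
  simp only [cutSource, mem_ofPred_eq]
  rw [H.off s hs]
  exact forall_congr' fun t => by rw [H.curve_eq_iff hs]

lemma outerSmoothing_off {C : Finset X} {s t : Source n} {ε δ : ℤˣ}
    (h : L.outerSmoothing D C s ε t δ) : L.curve s ∉ D ∧ L.curve t ∉ D :=
  ⟨h.1, h.2.2.1 ▸ h.1⟩

/-- The crossings on the strands are `(i l, u l), (j l, v l)`. -/
lemma MeetsAlong.localCrossings (H : MeetsAlong L D bd σ)
    (hσ : ∀ i j, ∀ u ∈ Icc 0 (σ i).len, ∀ v ∈ Icc 0 (σ j).len,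
      (σ i).pos u = (σ j).pos v → i = j ∧ u = v)
    {P : Fin k → ℝ → Fin k → ℝ → Prop} (hP : CrossExactly L σ P) {i j : Fin r → Fin k}
    {u v : Fin r → ℝ} (hu : ∀ l, u l ∈ Icc 0 (σ (i l)).len) (hv : ∀ l, v l ∈ Icc 0 (σ (j l)).len)
    (hPl : ∀ a b c d, P a b c d ↔ ∃ l, a = i l ∧ b = u l ∧ c = j l ∧ d = v l)
    (hne : ∀ l, i l = j l → u l ≠ v l)
    (hinj : ∀ l l', (i l = i l' ∧ u l = u l') ∨ P (i l) (u l) (i l') (u l') → l = l') :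
    LocalCrossings L D (fun l => (σ (i l)).pos (u l)) (fun l => (σ (j l)).pos (v l)) where
  mem l := (H.mem_iff _).2 ⟨i l, u l, hu l, rfl⟩
  iff s t hs := by
    constructor
    · rintro ⟨hst, h⟩
      obtain ⟨a, b, hb, rfl⟩ := (H.mem_iff s).1 hs
      obtain ⟨c, d, hd, rfl⟩ := (H.mem_iff t).1 (h ▸ hs)
      rcases (hP a c b hb d hd).1 h with ⟨rfl, rfl⟩ | h | h
      · exact absurd rfl hst
      · obtain ⟨l, rfl, rfl, rfl, rfl⟩ := (hPl _ _ _ _).1 h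
        exact ⟨l, Or.inl ⟨rfl, rfl⟩⟩
      · obtain ⟨l, rfl, rfl, rfl, rfl⟩ := (hPl _ _ _ _).1 h
        exact ⟨l, Or.inr ⟨rfl, rfl⟩⟩
    · have h₁ : ∀ l, (σ (i l)).pos (u l) ≠ (σ (j l)).pos (v l) := fun l h =>
        hne l (hσ _ _ _ (hu l) _ (hv l) h).1 (hσ _ _ _ (hu l) _ (hv l) h).2
      have h₂ : ∀ l, L.curve ((σ (i l)).pos (u l)) = L.curve ((σ (j l)).pos (v l)) := fun l =>
        (hP _ _ _ (hu l) _ (hv l)).2 (Or.inr (Or.inl ((hPl _ _ _ _).2 ⟨l, rfl, rfl, rfl, rfl⟩)))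
      rintro ⟨l, ⟨rfl, rfl⟩ | ⟨rfl, rfl⟩⟩
      · exact ⟨h₁ l, h₂ l⟩
      · exact ⟨(h₁ l).symm, (h₂ l).symm⟩
  inj l l' h := by
    rcases (hP _ _ _ (hu l) _ (hu l')).1 h with h | h | h
    · exact hinj l l' (Or.inl h)
    · exact hinj l l' (Or.inr h)
    · exact (hinj l' l (Or.inr h)).symm

lemma LocalCrossings.mem_cutSource_iff {x x' : Fin r → Source n} (H : LocalCrossings L D x x')
    {s : Source n} (hs : L.curve s ∈ D) :
    s ∈ cutSource L.curve ↔ ∀ l, s ≠ x l ∧ s ≠ x' l := by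
  simp only [cutSource, mem_ofPred_eq]
  constructor
  · intro h l
    have h₁ := H.pair l
    constructor
    · rintro rfl
      exact h₁.1 (h _ h₁.2.symm).symm
    · rintro rfl
      exact h₁.1 (h _ h₁.2)
  · intro h t ht
    by_contra hts
    obtain ⟨l, h' | h'⟩ := (H.iff s t hs).1 ⟨Ne.symm hts, ht.symm⟩
    · exact (h l).1 h'.1
    · exact (h l).2 h'.1

end Replaces

/-! ### Cutting strands at two points -/

section CutStrands

variable {n k r : ℕ} {U : Set (Source n)} {σ : Fin k → Strand n} {a b : Fin k → ℝ}

lemma Strand.pos_add (τ : Strand n) (u v : ℝ) : ray (τ.pos u) τ.dir v = τ.pos (u + v) :=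
  ray_add _ _ _ _

lemma Strand.pos_sub (τ : Strand n) (u v : ℝ) : ray (τ.pos u) (-τ.dir) v = τ.pos (u - v) :=
  ray_sub _ _ _ _

/-- The components ending at the points at distance `a i` on the strands, before these points. -/
noncomputable def branchBefore (hU : Uᶜ.Finite) (σ : Fin k → Strand n) (a : Fin k → ℝ) (i : Fin k) :
    ConnectedComponents U :=
  branchEnd hU ((σ i).pos (a i)) (-(σ i).dir)

/-- The components ending at the points at distance `a i` on the strands, after these points. -/
noncomputable def branchAfter (hU : Uᶜ.Finite) (σ : Fin k → Strand n) (a : Fin k → ℝ) (i : Fin k) :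
    ConnectedComponents U :=
  branchEnd hU ((σ i).pos (a i)) (σ i).dir

/-- The pairwise disjoint strands `σ` are cut exactly at the points at distance `a i` and `b i`. -/
structure CutTwice (U : Set (Source n)) (σ : Fin k → Strand n) (a b : Fin k → ℝ) : Prop where
  disjoint : ∀ i j, ∀ u ∈ Icc 0 (σ i).len, ∀ v ∈ Icc 0 (σ j).len,
    (σ i).pos u = (σ j).pos v → i = j ∧ u = v
  lt : ∀ i, 0 < a i ∧ a i < b i ∧ b i < (σ i).len
  not_mem_iff : ∀ i, ∀ u ∈ Icc 0 (σ i).len, (σ i).pos u ∉ U ↔ u = a i ∨ u = b i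

namespace CutTwice

lemma fst_mem (H : CutTwice U σ a b) (i : Fin k) : a i ∈ Icc 0 (σ i).len :=
  ⟨(H.lt i).1.le, ((H.lt i).2.1.trans (H.lt i).2.2).le⟩

lemma snd_mem (H : CutTwice U σ a b) (i : Fin k) : b i ∈ Icc 0 (σ i).len :=
  ⟨((H.lt i).1.trans (H.lt i).2.1).le, (H.lt i).2.2.le⟩

lemma mem_of_mem_Ioo (H : CutTwice U σ a b) (i : Fin k) :
    ∀ u ∈ Ioo (a i) (b i), (σ i).pos u ∈ U := by
  intro u hu
  by_contra h
  rcases (H.not_mem_iff i u ⟨((H.lt i).1.trans hu.1).le, (hu.2.trans (H.lt i).2.2).le⟩).1 h with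
    h | h
  · exact hu.1.ne' h
  · exact hu.2.ne h

lemma branchEnd_eq (H : CutTwice U σ a b) (hU : Uᶜ.Finite) (i : Fin k) :
    branchAfter hU σ a i = branchBefore hU σ b i :=
  branchEnd_interval hU (H.lt i).2.1 (H.mem_of_mem_Ioo i)

lemma eventually_mem (H : CutTwice U σ a b) (hU : Uᶜ.Finite) (i : Fin k) {t : Source n} {δ : ℤˣ}
    (h : branchEnd hU t δ = branchAfter hU σ a i) :
    ∀ᶠ q in halfNhds t δ, q ∈ (σ i).pos '' Ioo (a i) (b i) :=
  eventually_mem_of_branchEnd_eq hU (H.lt i).2.1 (H.mem_of_mem_Ioo i)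
    ((H.not_mem_iff i _ (H.fst_mem i)).2 (Or.inl rfl))
    ((H.not_mem_iff i _ (H.snd_mem i)).2 (Or.inr rfl)) h

lemma exists_of_branchEnd_eq (H : CutTwice U σ a b) (hU : Uᶜ.Finite) (i : Fin k) {t : Source n}
    {δ : ℤˣ} (h : branchEnd hU t δ = branchAfter hU σ a i) :
    ∃ u ∈ Icc 0 (σ i).len, t = (σ i).pos u := by
  have hc : IsClosed ((σ i).pos '' Icc (a i) (b i)) :=
    (isCompact_Icc.image (continuous_ray (σ i).start (σ i).dir)).isClosed
  have h₁ : ∀ᶠ q in halfNhds t δ, q ∈ (σ i).pos '' Icc (a i) (b i) :=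
    (H.eventually_mem hU i h).mono fun q hq => image_mono Ioo_subset_Icc_self hq
  obtain ⟨u, hu, rfl⟩ := hc.mem_of_frequently_of_tendsto h₁.frequently (halfNhds_le_nhds t δ)
  exact ⟨u, ⟨(H.lt i).1.le.trans hu.1, hu.2.trans (H.lt i).2.2.le⟩, rfl⟩

lemma isolated (H : CutTwice U σ a b) (hU : Uᶜ.Finite)
    {J : Source n → ℤˣ → Source n → ℤˣ → Prop}
    (hJ : ∀ s ε t δ, J s ε t δ → ∀ i, ∀ u ∈ Icc 0 (σ i).len, s ≠ (σ i).pos u ∧ t ≠ (σ i).pos u) :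
    Isolated (EndsJoined hU J) (branchBefore hU σ a)
      (branchAfter hU σ a)
      (branchAfter hU σ b) where
  rel := by
    rintro i _ _ ⟨s, ε, t, δ, h, rfl, rfl⟩
    constructor
    · intro he
      obtain ⟨u, hu, rfl⟩ := H.exists_of_branchEnd_eq hU i he
      exact (hJ _ _ _ _ h i u hu).1 rfl
    · intro he
      obtain ⟨u, hu, rfl⟩ := H.exists_of_branchEnd_eq hU i he
      exact (hJ _ _ _ _ h i u hu).2 rfl
  inj i j h := by
    obtain ⟨u, hu, h⟩ := H.exists_of_branchEnd_eq hU j h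
    exact (H.disjoint i j _ (H.fst_mem i) u hu h).1
  ne_start i j h := by
    obtain ⟨u, hu, e⟩ := H.exists_of_branchEnd_eq hU i h
    obtain ⟨rfl, -⟩ := H.disjoint j i _ (H.fst_mem j) u hu e
    -- Otherwise points just before `a j` would also have a parameter greater than `a j`,
    -- contradicting injectivity of the strand.
    have h₁ := H.eventually_mem hU j h
    rw [halfNhds, eventually_map] at h₁
    obtain ⟨u, ⟨v, hv, hv'⟩, hu⟩ := (h₁.and (Ioo_mem_nhdsGT (H.lt j).1)).exists
    rw [Strand.pos_sub] at hv'
    have := (H.disjoint j j v ⟨((H.lt j).1.trans hv.1).le, (hv.2.trans (H.lt j).2.2).le⟩ _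
      ⟨by linarith [hu.2], by linarith [hu.1, (H.fst_mem j).2]⟩ hv').2
    linarith [hv.1, hu.1]
  ne_end i j h := by
    obtain ⟨u, hu, e⟩ := H.exists_of_branchEnd_eq hU i h
    obtain ⟨rfl, -⟩ := H.disjoint j i _ (H.snd_mem j) u hu e
    have h₁ := H.eventually_mem hU j h
    rw [halfNhds, eventually_map] at h₁
    obtain ⟨u, ⟨v, hv, hv'⟩, hu⟩ :=
      (h₁.and (Ioo_mem_nhdsGT (sub_pos.2 (H.lt j).2.2))).exists
    rw [Strand.pos_add] at hv'
    have := (H.disjoint j j v ⟨((H.lt j).1.trans hv.1).le, (hv.2.trans (H.lt j).2.2).le⟩ _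
      ⟨by linarith [hu.1, (H.snd_mem j).1], by linarith [hu.2]⟩ hv').2
    linarith [hv.2, hu.1]

/-- Cutting uncut strands twice and joining the three parts. -/
lemma arcCount_eq_throughCount {V : Set (Source n)} (H : CutTwice V σ a b) (hU : Uᶜ.Finite)
    (hV : Vᶜ.Finite) (hUV : ∀ s, (∀ i, ∀ u ∈ Icc 0 (σ i).len, s ≠ (σ i).pos u) → (s ∈ V ↔ s ∈ U))
    (hσU : ∀ i, ∀ u ∈ Icc 0 (σ i).len, (σ i).pos u ∈ U)
    (J : Source n → ℤˣ → Source n → ℤˣ → Prop) :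
    arcCount U J = throughCount (EndsJoined hV J)
      (branchBefore hV σ a)
      (branchAfter hV σ a)
      (branchAfter hV σ b) := by
  have hVU : V ⊆ U := by
    intro s hs
    by_cases h : ∀ i, ∀ u ∈ Icc 0 (σ i).len, s ≠ (σ i).pos u
    · exact (hUV s h).1 hs
    · push Not at h
      obtain ⟨i, u, hu, rfl⟩ := h
      exact hσU i u hu
  have hdiff : ∀ s ∈ U \ V, ∃ i, s = (σ i).pos (a i) ∨ s = (σ i).pos (b i) := by
    rintro s ⟨hs, hs'⟩
    by_cases h : ∀ i, ∀ u ∈ Icc 0 (σ i).len, s ≠ (σ i).pos u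
    · exact absurd ((hUV s h).2 hs) hs'
    · push Not at h
      obtain ⟨i, u, hu, rfl⟩ := h
      rcases (H.not_mem_iff i u hu).1 hs' with rfl | rfl
      exacts [⟨i, Or.inl rfl⟩, ⟨i, Or.inr rfl⟩]
  -- `arcCount_cut` uses the directions of the circles and `throughCount` those of the strands; the
  -- equation to be proved is the same for both, up to symmetry.
  have hu : ∀ {E : Type _} (g : ℤˣ → E) (ε : ℤˣ), g (-1) = g 1 ↔ g (-ε) = g ε := by
    intro E g ε
    rcases Int.units_eq_one_or ε with rfl | rfl
    · rfl
    · rw [neg_neg, eq_comm]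
  rw [arcCount_cut hU hV hVU]
  refine card_quot_congr ?_ ?_
  · rintro _ _ (h | ⟨s, hs, rfl, rfl⟩)
    · exact Quot.sound (Or.inl h)
    · obtain ⟨i, rfl | rfl⟩ := hdiff s hs
      · refine (hu (fun ε => Quot.mk _ (branchEnd hV _ ε)) (σ i).dir).2 (Quot.sound (Or.inr ?_))
        exact ⟨i, Or.inl ⟨rfl, rfl⟩⟩
      · refine (hu (fun ε => Quot.mk _ (branchEnd hV _ ε)) (σ i).dir).2 (Quot.sound (Or.inr ?_))
        exact ⟨i, Or.inr ⟨(H.branchEnd_eq hV i).symm, rfl⟩⟩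
  · rintro _ _ (h | ⟨i, ⟨rfl, rfl⟩ | ⟨rfl, rfl⟩⟩)
    · exact Quot.sound (Or.inl h)
    · refine (hu (fun ε => Quot.mk _ (branchEnd hV _ ε)) (σ i).dir).1 (Quot.sound (Or.inr ?_))
      exact ⟨_, ⟨hσU i _ (H.fst_mem i), (H.not_mem_iff i _ (H.fst_mem i)).2 (Or.inl rfl)⟩,
        rfl, rfl⟩
    · rw [H.branchEnd_eq hV i]
      refine (hu (fun ε => Quot.mk _ (branchEnd hV _ ε)) (σ i).dir).1 (Quot.sound (Or.inr ?_))
      exact ⟨_, ⟨hσU i _ (H.snd_mem i), (H.not_mem_iff i _ (H.snd_mem i)).2 (Or.inr rfl)⟩,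
        rfl, rfl⟩

end CutTwice

lemma crossingEnds_one {U : Set (Source n)} (hU : Uᶜ.Finite) (x : Fin r → Source n)
    (ε : Fin r → ℤˣ) (l : Fin r) : crossingEnds hU x ε l 1 = branchEnd hU (x l) (ε l) := by
  rw [crossingEnds, one_mul]

lemma crossingEnds_neg_one {U : Set (Source n)} (hU : Uᶜ.Finite) (x : Fin r → Source n)
    (ε : Fin r → ℤˣ) (l : Fin r) : crossingEnds hU x ε l (-1) = branchEnd hU (x l) (-ε l) := by
  rw [crossingEnds, neg_one_mul]

lemma stateCount_zero {U : Set (Source n)} (hU : Uᶜ.Finite)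
    (J : Source n → ℤˣ → Source n → ℤˣ → Prop) (a b : Fin 0 → ℤˣ → ConnectedComponents U)
    (f : Fin 0 → ℤˣ) : stateCount (EndsJoined hU J) a b f = arcCount U J := by
  rw [arcCount_eq_card hU, stateCount]
  simp

/-- Homeomorphisms of the domain preserve the numbers of curves in smoothings. -/
lemma stateCount_transfer {U V : Set (Source n)} (hU : Uᶜ.Finite) (hV : Vᶜ.Finite)
    {θ : Source n ≃ₜ Source n} (hθ : ∀ s ε, Tendsto θ (halfNhds s ε) (halfNhds (θ s) ε))
    (hVU : V = θ ⁻¹' U) {J J' : Source n → ℤˣ → Source n → ℤˣ → Prop}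
    (hJ : ∀ s ε t δ, J' s ε t δ ↔ J (θ s) ε (θ t) δ) {x x' z z' : Fin r → Source n}
    (hx : ∀ l, x l = θ (z l)) (hx' : ∀ l, x' l = θ (z' l)) (ε ε' : Fin r → ℤˣ) (f : Fin r → ℤˣ) :
    stateCount (EndsJoined hU J) (crossingEnds hU x ε) (crossingEnds hU x' ε') f =
      stateCount (EndsJoined hV J') (crossingEnds hV z ε) (crossingEnds hV z' ε') f := by
  subst hVU
  obtain ⟨ψ, hψ⟩ := exists_components_equiv hU (e := 1) (by simpa using hθ) hV
  have h := endsJoined_preimage_iff hU hV hψ J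
  simp only [Pi.one_apply, one_mul] at hψ h
  refine (Nat.card_congr (Quot.congr ψ fun y y' => or_congr ?_ ?_)).symm
  · rw [← h]
    have : J' = fun s ε t δ => J (θ s) ε (θ t) δ := by
      funext s ε t δ
      exact propext (hJ s ε t δ)
    rw [this]
  · refine exists_congr fun l => exists_congr fun η => and_congr ?_ ?_
    · rw [crossingEnds, crossingEnds, hx, ← hψ, ψ.apply_eq_iff_eq]
    · rw [crossingEnds, crossingEnds, hx', ← hψ, ψ.apply_eq_iff_eq]

end CutStrands

/-! ### The effect of the moves -/

section MoveInvariance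

open LaurentPolynomial

variable {X : Type*} [TopologicalSpace X] {n k : ℕ} {L L' : Link X n} {D bd : Set X}
  {σ : Fin k → Strand n}

lemma MeetsAlong.localCrossings_empty (H : MeetsAlong L D bd σ)
    (hσ : ∀ i j, ∀ u ∈ Icc 0 (σ i).len, ∀ v ∈ Icc 0 (σ j).len,
      (σ i).pos u = (σ j).pos v → i = j ∧ u = v) (h : NoCrossings L σ) :
    LocalCrossings L D (fun l : Fin 0 => l.elim0) (fun l : Fin 0 => l.elim0) := by
  have := H.localCrossings hσ h (r := 0) (i := fun l => l.elim0)
    (j := fun l => l.elim0) (u := fun l => l.elim0) (v := fun l => l.elim0) (fun l => l.elim0)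
    (fun l => l.elim0) (by simp) (fun l => l.elim0) (fun l => l.elim0)
  convert this using 2 with l l

lemma Replaces.off_of_outerSmoothing (H : Replaces L L' D bd σ) {C : Finset X} :
    ∀ s ε t δ, L.outerSmoothing D C s ε t δ → ∀ i, ∀ u ∈ Icc 0 (σ i).len,
      s ≠ (σ i).pos u ∧ t ≠ (σ i).pos u := by
  intro s ε t δ h i u hu
  obtain ⟨h₁, h₂⟩ := outerSmoothing_off h
  rw [H.meets.mem_iff] at h₁ h₂
  exact ⟨fun h => h₁ ⟨i, u, hu, h⟩, fun h => h₂ ⟨i, u, hu, h⟩⟩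

lemma Replaces.not_mem_of_off (H : Replaces L L' D bd σ) {s : Source n}
    (hs : ∀ i, ∀ u ∈ Icc 0 (σ i).len, s ≠ (σ i).pos u) : L.curve s ∉ D := by
  rw [H.meets.mem_iff]
  rintro ⟨i, u, hu, h⟩
  exact hs i u hu h

lemma Replaces.pos_mem (H : Replaces L L' D bd σ) (i : Fin k) {u : ℝ}
    (hu : u ∈ Icc 0 (σ i).len) : L.curve ((σ i).pos u) ∈ D :=
  (H.meets.mem_iff _).2 ⟨i, u, hu, rfl⟩

lemma Replaces.pos_mem' (H : Replaces L L' D bd σ) (i : Fin k) {u : ℝ}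
    (hu : u ∈ Icc 0 (σ i).len) : L'.curve ((σ i).pos u) ∈ D :=
  (H.meets'.mem_iff _).2 ⟨i, u, hu, rfl⟩

lemma Replaces.pos_eq_iff (H : Replaces L L' D bd σ) {i j : Fin k} {u v : ℝ}
    (hu : u ∈ Icc 0 (σ i).len) (hv : v ∈ Icc 0 (σ j).len) :
    (σ i).pos u = (σ j).pos v ↔ i = j ∧ u = v := by
  refine ⟨H.disjoint i j u hu v hv, ?_⟩
  rintro ⟨rfl, rfl⟩
  rfl

/-- The state sum of a link without crossings in `D`, in terms of the cuts of the other link. -/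
lemma Replaces.stateSum_empty (H : Replaces L L' D bd σ) (h : NoCrossings L σ) {a b : Fin k → ℝ}
    (hc : CutTwice (cutSource L'.curve) σ a b) (C : Finset X) (κ : Fin 0 → Prop)
    (x y : Fin 0 → ℤˣ → ConnectedComponents (cutSource L.curve)) :
    stateSum κ (stateCount (EndsJoined L.finite_compl_cutSource (L.outerSmoothing D C)) x y) =
      loopValue ^ (throughCount
        (EndsJoined L'.finite_compl_cutSource (L.outerSmoothing D C))
        (branchBefore L'.finite_compl_cutSource σ a)
        (branchAfter L'.finite_compl_cutSource σ a)
        (branchAfter L'.finite_compl_cutSource σ b) - 1) := by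
  rw [stateSum_zero, stateCount_zero, hc.arcCount_eq_throughCount L.finite_compl_cutSource
    L'.finite_compl_cutSource]
  · exact fun s hs => H.mem_cutSource_iff (H.not_mem_of_off hs)
  · intro i u hu
    rw [(H.meets.localCrossings_empty H.disjoint h).mem_cutSource_iff (H.pos_mem i hu)]
    exact fun l => l.elim0

/-- Positivity makes the truncated exponent `count - 1` the true one. -/
lemma throughCount_pos {E : Type*} [Finite E] [Nonempty E] {R : E → E → Prop}
    {s m e : Fin k → E} : 1 ≤ throughCount R s m e := by
  have : Nonempty (Quot fun x y => R x y ∨ ∃ i, (x = s i ∧ y = m i) ∨ (x = m i ∧ y = e i)) :=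
    ⟨Quot.mk _ (Classical.arbitrary E)⟩
  exact Nat.card_pos

lemma stateCount_pos {E : Type*} [Finite E] [Nonempty E] {r : ℕ} {R : E → E → Prop}
    {a b : Fin r → ℤˣ → E} {f : Fin r → ℤˣ} : 1 ≤ stateCount R a b f := by
  have : Nonempty (Quot fun x y => R x y ∨ ∃ k η, x = a k η ∧ y = b k (f k * η)) :=
    ⟨Quot.mk _ (Classical.arbitrary E)⟩
  exact Nat.card_pos

lemma nonempty_components {U : Set (Source n)} (hU : Uᶜ.Finite) (s : Source n) :
    Nonempty (ConnectedComponents U) := ⟨branchEnd hU s 1⟩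

lemma Replaces.cutSource_eq_preimage (H : Replaces L L' D bd σ) {θ : Source n ≃ₜ Source n}
    (hoff : ∀ s, (∀ i, ∀ u ∈ Icc 0 (σ i).len, s ≠ (σ i).pos u) → θ s = s)
    (h : ∀ i, ∀ u ∈ Icc 0 (σ i).len,
      (σ i).pos u ∈ cutSource L'.curve ↔ θ ((σ i).pos u) ∈ cutSource L.curve) :
    cutSource L'.curve = θ ⁻¹' cutSource L.curve := by
  ext s
  by_cases hs : ∀ i, ∀ u ∈ Icc 0 (σ i).len, s ≠ (σ i).pos u
  · rw [mem_preimage, hoff s hs, H.mem_cutSource_iff (H.not_mem_of_off hs)]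
  · push Not at hs
    obtain ⟨i, u, hu, rfl⟩ := hs
    exact h i u hu

lemma Replaces.param_eq_iff (H : Replaces L L' D bd σ) {θ : Source n ≃ₜ Source n} {i : Fin k}
    {u v a b : ℝ} (e : θ ((σ i).pos u) = (σ i).pos v) (hu : u ∈ Icc 0 (σ i).len)
    (hv : v ∈ Icc 0 (σ i).len) (ha : a ∈ Icc 0 (σ i).len) (hb : b ∈ Icc 0 (σ i).len)
    (h : θ ((σ i).pos a) = (σ i).pos b) : u = a ↔ v = b := by
  have h₁ := H.pos_eq_iff (i := i) (j := i) hv hb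
  rw [← h, ← e, θ.injective.eq_iff, H.pos_eq_iff hu ha] at h₁
  simpa using h₁

/-- `θ` is the identity off the strands and maps the strands to themselves, where no outer crossing
has a preimage. -/
lemma Replaces.outerSmoothing_homeo_iff (H : Replaces L L' D bd σ) (C : Finset X)
    {θ : Source n ≃ₜ Source n}
    (hoff : ∀ s, (∀ i, ∀ u ∈ Icc 0 (σ i).len, s ≠ (σ i).pos u) → θ s = s)
    (hon : ∀ i, ∀ u ∈ Icc 0 (σ i).len, ∃ v ∈ Icc 0 (σ i).len, θ ((σ i).pos u) = (σ i).pos v)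
    (s : Source n) (ε : ℤˣ) (t : Source n) (δ : ℤˣ) :
    L.outerSmoothing D C s ε t δ ↔ L.outerSmoothing D C (θ s) ε (θ t) δ := by
  have h : ∀ s, L.curve s ∈ D → L.curve (θ s) ∈ D := by
    intro s hs
    obtain ⟨i, u, hu, rfl⟩ := (H.meets.mem_iff s).1 hs
    obtain ⟨v, hv, e⟩ := hon i u hu
    rw [e]
    exact H.pos_mem i hv
  have h' : ∀ s, L.curve s ∉ D → θ s = s := fun s hs =>
    hoff s fun i u hu e => hs (e ▸ H.pos_mem i hu)
  by_cases hs : L.curve s ∈ D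
  · exact iff_of_false (fun h₁ => h₁.1 hs) fun h₁ => h₁.1 (h s hs)
  · by_cases ht : L.curve t ∈ D
    · exact iff_of_false (fun h₁ => (outerSmoothing_off h₁).2 ht)
        fun h₁ => (outerSmoothing_off h₁).2 (h t ht)
    · rw [h' s hs, h' t ht]

theorem MoveOne.bracket_wri {e : ℤˣ} (h : MoveOne e L L') :
    L'.bracket = -T (3 * (e : ℤ)) * L.bracket ∧ L'.wri = L.wri + e := by
  classical
  obtain ⟨D, bd, σ, -, H, -, -, hL, p, q, hp, hpq, hq, hL', hd⟩ := h
  have hpm : p ∈ Icc 0 (σ 0).len := ⟨hp.le, (hpq.trans hq).le⟩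
  have hqm : q ∈ Icc 0 (σ 0).len := ⟨(hp.trans hpq).le, hq.le⟩
  have hX := H.meets.localCrossings_empty H.disjoint hL
  have hX' := H.meets'.localCrossings H.disjoint hL' (r := 1) (i := fun _ => 0) (j := fun _ => 0)
    (u := fun _ => p) (v := fun _ => q) (fun _ => hpm) (fun _ => hqm)
    (by intro a b c d; simp [Fin.fin_one_eq_zero a, Fin.fin_one_eq_zero c]) (fun _ _ => hpq.ne)
    (fun _ _ _ => Subsingleton.elim _ _)
  have hcut : CutTwice (cutSource L'.curve) σ (fun _ => p) (fun _ => q) :=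
    { disjoint := H.disjoint
      lt := fun i => by rw [Fin.fin_one_eq_zero i]; exact ⟨hp, hpq, hq⟩
      not_mem_iff := by
        intro i u hu
        obtain rfl := Fin.fin_one_eq_zero i
        rw [hX'.mem_cutSource_iff (H.pos_mem' 0 hu)]
        simp only [ne_eq, H.pos_eq_iff hu hpm, H.pos_eq_iff hu hqm, true_and, forall_const]
        tauto }
  constructor
  · refine H.bracket_eq hX hX' (fun l => l.elim0) (fun l => l.elim0) (fun _ => (σ 0).dir)
      (fun _ => (σ 0).dir) _ fun C => ?_
    rw [H.stateSum_empty hL hcut]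
    have hI := hcut.isolated L'.finite_compl_cutSource (J := L.outerSmoothing D C)
      H.off_of_outerSmoothing
    have := finite_connectedComponents L'.finite_compl_cutSource
    have := nonempty_components L'.finite_compl_cutSource (σ 0).start
    have hk : KinkEnds (branchBefore L'.finite_compl_cutSource σ fun _ => p)
        (branchAfter L'.finite_compl_cutSource σ fun _ => p)
        (branchAfter L'.finite_compl_cutSource σ fun _ => q) (crossingEnds L'.finite_compl_cutSource
        (fun _ : Fin 1 => (σ 0).pos p) fun _ => (σ 0).dir)
        (crossingEnds L'.finite_compl_cutSource (fun _ : Fin 1 => (σ 0).pos q)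
          fun _ => (σ 0).dir) :=
      { fst_pos := crossingEnds_one _ _ _ _
        fst_neg := crossingEnds_neg_one _ _ _ _
        snd_pos := crossingEnds_one _ _ _ _
        snd_neg := (crossingEnds_neg_one _ _ _ _).trans (hcut.branchEnd_eq _ 0).symm }
    exact stateSum_kink throughCount_pos hk.stateCount_one (hk.stateCount_neg_one hI) e hd
  · rw [H.wri_eq hX hX']
    have h₁ := hX'.pair 0
    -- Both branches of the kink have the same strand direction, whose square is `1`; so the sign
    -- does not depend on it.
    rw [L'.dotted_iff h₁.1 h₁.2, Int.units_mul_self] at hd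
    simp only [Finset.univ_eq_empty, Finset.sum_empty, sub_zero, Fin.sum_univ_one, add_right_inj]
    rw [Link.localSign, if_pos (show ((σ 0).pos p).1 = ((σ 0).pos q).1 from rfl)]
    rcases Int.units_eq_one_or e with rfl | rfl
    · rw [if_pos (by simpa using hd)]; rfl
    · rw [if_neg (by simpa using hd)]; rfl

theorem MoveTwo.bracket_wri (h : MoveTwo L L') : L'.bracket = L.bracket ∧ L'.wri = L.wri := by
  classical
  obtain ⟨D, bd, σ, -, H, -, -, hL, p, q, hpq, hL', hd⟩ := h
  have hpm : ∀ i, p i ∈ Icc 0 (σ i).len := fun i =>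
    ⟨(hpq i).1.le, ((hpq i).2.1.trans (hpq i).2.2).le⟩
  have hqm : ∀ i, q i ∈ Icc 0 (σ i).len := fun i =>
    ⟨((hpq i).1.trans (hpq i).2.1).le, (hpq i).2.2.le⟩
  have hne : ∀ i, p i ≠ q i := fun i => (hpq i).2.1.ne
  have hX := H.meets.localCrossings_empty H.disjoint hL
  have hX' := H.meets'.localCrossings H.disjoint hL' (r := 2) (i := fun _ => 0) (j := fun _ => 1)
    (u := ![p 0, q 0]) (v := ![p 1, q 1])
    (by simp only [Fin.forall_fin_two]; exact ⟨hpm 0, hqm 0⟩)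
    (by simp only [Fin.forall_fin_two]; exact ⟨hpm 1, hqm 1⟩)
    (by intro a b c d; simp only [Fin.exists_fin_two, Matrix.cons_val_zero, Matrix.cons_val_one]
        tauto)
    (by simp) (by simp [Fin.forall_fin_two, hne 0, (hne 0).symm])
  have hcut : CutTwice (cutSource L'.curve) σ p q :=
    { disjoint := H.disjoint
      lt := hpq
      not_mem_iff := by
        intro i u hu
        rw [hX'.mem_cutSource_iff (H.pos_mem' i hu)]
        simp only [Fin.forall_fin_two, Matrix.cons_val_zero, Matrix.cons_val_one, ne_eq,
          H.pos_eq_iff hu (hpm 0), H.pos_eq_iff hu (hpm 1), H.pos_eq_iff hu (hqm 0),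
          H.pos_eq_iff hu (hqm 1)]
        fin_cases i <;> simp <;> tauto }
  have hp0 := hX'.pair 0
  have hp1 := hX'.pair 1
  simp only [Matrix.cons_val_zero, Matrix.cons_val_one] at hp0 hp1
  constructor
  · rw [← one_mul L.bracket]
    refine H.bracket_eq hX hX' (fun l => l.elim0) (fun l => l.elim0) (fun _ => (σ 0).dir)
      (fun _ => (σ 1).dir) _ fun C => ?_
    rw [H.stateSum_empty hL hcut, one_mul]
    have hI := hcut.isolated L'.finite_compl_cutSource (J := L.outerSmoothing D C)
      H.off_of_outerSmoothing
    have := finite_connectedComponents L'.finite_compl_cutSource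
    have := nonempty_components L'.finite_compl_cutSource (σ 0).start
    have hb : BigonEnds (branchBefore L'.finite_compl_cutSource σ p)
        (branchAfter L'.finite_compl_cutSource σ p) (branchAfter L'.finite_compl_cutSource σ q) (crossingEnds L'.finite_compl_cutSource
        (fun l : Fin 2 => (σ 0).pos (![p 0, q 0] l)) fun _ => (σ 0).dir)
        (crossingEnds L'.finite_compl_cutSource (fun l : Fin 2 => (σ 1).pos (![p 1, q 1] l))
          fun _ => (σ 1).dir) :=
      { fst_zero_pos := crossingEnds_one _ _ _ _
        fst_zero_neg := crossingEnds_neg_one _ _ _ _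
        snd_zero_pos := crossingEnds_one _ _ _ _
        snd_zero_neg := crossingEnds_neg_one _ _ _ _
        fst_one_pos := crossingEnds_one _ _ _ _
        fst_one_neg := (crossingEnds_neg_one _ _ _ _).trans (hcut.branchEnd_eq _ 0).symm
        snd_one_pos := crossingEnds_one _ _ _ _
        snd_one_neg := (crossingEnds_neg_one _ _ _ _).trans (hcut.branchEnd_eq _ 1).symm }
    have h₁ := hb.stateCount_neg_neg hI
    have h₂ := hb.stateCount_pos_neg hI
    have h₃ := hb.stateCount_neg_pos hI
    have h₄ := hb.stateCount_pos_pos hI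
    refine stateSum_bigon stateCount_pos ?_ h₁ rfl (by omega) (by omega)
    simp only [Matrix.cons_val_zero, Matrix.cons_val_one]
    -- The second corner of the bigon lies between the backward half-branches. The opposite area
    -- between the forward ones carries the same dots, which gives the form needed in
    -- `stateSum_bigon`.
    rw [L'.dotted_iff hp1.1 hp1.2, neg_mul_neg, ← L'.dotted_iff hp1.1 hp1.2] at hd
    exact hd
  · rw [H.wri_eq hX hX']
    rw [L'.dotted_iff hp1.1 hp1.2, L'.dotted_iff hp0.1 hp0.2, neg_mul_neg] at hd
    -- If the strands belong to one component the two signs are opposite; otherwise neither crossing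
    -- is counted.
    have h₁ : L'.localSign ((σ 0).pos (p 0)) ((σ 1).pos (p 1)) +
        L'.localSign ((σ 0).pos (q 0)) ((σ 1).pos (q 1)) = 0 := by
      have hq : L'.localSign ((σ 0).pos (q 0)) ((σ 1).pos (q 1)) =
        if (σ 0).start.1 = (σ 1).start.1 then
          if L'.dotted ((σ 0).pos (q 0)) 1 ((σ 1).pos (q 1)) 1 then 1 else -1 else 0 := rfl
      have hp : L'.localSign ((σ 0).pos (p 0)) ((σ 1).pos (p 1)) =
        if (σ 0).start.1 = (σ 1).start.1 then
          if L'.dotted ((σ 0).pos (p 0)) 1 ((σ 1).pos (p 1)) 1 then 1 else -1 else 0 := rfl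
      rw [hp, hq]
      have hd' : L'.dotted ((σ 0).pos (p 0)) 1 ((σ 1).pos (p 1)) 1 ↔
          ¬ L'.dotted ((σ 0).pos (q 0)) 1 ((σ 1).pos (q 1)) 1 := by tauto
      split_ifs <;> first | rfl | (exfalso; tauto)
    simp only [Finset.univ_eq_empty, Finset.sum_empty, sub_zero, Fin.sum_univ_two, add_eq_left]
    exact h₁

/-- After the move the triangle has the same combinatorics with starts and ends interchanged. This
exchanges the two cyclic pairings and preserves the other three, as required in `stateSum_triangle`.
-/
lemma TriangleEnds.stateSum_eq {E : Type*} [Finite E] {R : E → E → Prop} {s m e : Fin 3 → E}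
    {a b a' b' : Fin 3 → ℤˣ → E} (H : TriangleEnds s m e a b) (H' : TriangleEnds e m s a' b')
    (hI : Isolated R s m e) {κ : Fin 3 → Prop} (hκ : ¬ ∀ k, κ k) (hκ' : ¬ ∀ k, ¬ κ k) :
    stateSum κ (stateCount R a b) = stateSum κ (stateCount R a' b') := by
  have := Nonempty.intro (s 0)
  have e₁ := H.stateCount_loop hI
  have e₂ := fun f => H.stateCount_one_neg hI (f := f)
  have e₃ := H.stateCount_neg hI
  obtain ⟨e₄, e₅, e₆⟩ := H.stateCount_two_neg hI
  have e₁' := H'.stateCount_loop hI.reverse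
  have e₂' := fun f => H'.stateCount_one_neg hI.reverse (f := f)
  have e₀' := e₁'
  have e₃' := H'.stateCount_neg hI.reverse
  obtain ⟨e₄', e₅', e₆'⟩ := H'.stateCount_two_neg hI.reverse
  rw [← classCount_swap] at e₁' e₃' e₄' e₅' e₆'
  simp only [List.map_cons, List.map_nil, Prod.swap_prod_mk] at e₁' e₃' e₄' e₅' e₆'
  have p₁ : ∀ x y z : E × E, classCount R [x, y, z] = classCount R [z, x, y] := fun x y z =>
    classCount_perm (List.perm_append_comm (l₁ := [x, y]) (l₂ := [z]))
  have p₂ : ∀ x y z : E × E, classCount R [x, y, z] = classCount R [y, x, z] := fun x y z =>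
    classCount_perm (List.Perm.swap _ _ _)
  have p₃ : ∀ x y z : E × E, classCount R [x, y, z] = classCount R [z, y, x] := fun x y z =>
    (p₂ x y z).trans ((p₁ y x z))
  have q₁ := e₂ ![1, 1, -1] (by simp)
  have r₁ := p₁ (s 1, e 0) (s 2, e 1) (s 0, e 2)
  have r₂ := (p₁ (s 2, e 0) (s 0, e 1) (s 1, e 2)).trans (p₁ _ _ _)
  have r₄ := p₂ (s 1, e 0) (s 0, e 1) (s 2, e 2)
  refine stateSum_triangle (M := stateCount R a b ![1, 1, -1])
    (N := stateCount R a b ![-1, -1, -1]) stateCount_pos stateCount_pos hκ hκ' (by omega)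
    (by omega) (fun f hf => ?_) (fun f hf => ?_) rfl (by omega)
  · have h := e₂ f hf
    have h' := e₂' f hf
    omega
  · rcases hf with rfl | rfl | rfl
    · omega
    · have := p₃ (s 2, e 0) (s 1, e 1) (s 0, e 2)
      omega
    · have h := (p₁ (s 0, e 0) (s 2, e 1) (s 1, e 2)).trans (p₂ _ _ _)
      omega

theorem MoveThree.bracket_wri (h : MoveThree L L') :
    L'.bracket = L.bracket ∧ L'.wri = L.wri := by
  classical
  obtain ⟨D, bd, σ, -, H, -, -, p, q, p', q', ⟨hpqm, hL⟩, ⟨hpqm', hL'⟩, hpq, hpq', hd, hn₁, hn₂⟩ := h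
  have hIcc : ∀ {p q : Fin 3 → ℝ}, (∀ i, p i ∈ Ioo 0 (σ i).len ∧ q i ∈ Ioo 0 (σ i).len) →
      (∀ i, p i ∈ Icc 0 (σ i).len) ∧ ∀ i, q i ∈ Icc 0 (σ i).len := fun h =>
    ⟨fun i => Ioo_subset_Icc_self (h i).1, fun i => Ioo_subset_Icc_self (h i).2⟩
  obtain ⟨hp, hq⟩ := hIcc hpqm
  obtain ⟨hp', hq'⟩ := hIcc hpqm'
  have key : ∀ {L : Link X n} {p q : Fin 3 → ℝ}, MeetsAlong L D bd σ →
      (∀ i, p i ∈ Icc 0 (σ i).len) → (∀ i, q i ∈ Icc 0 (σ i).len) → (∀ i, p i ≠ q i) →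
      CrossExactly L σ (fun i u j v => j = i + 1 ∧ u = p i ∧ v = q j) →
      LocalCrossings L D (fun l => (σ l).pos (p l)) (fun l => (σ (l + 1)).pos (q (l + 1))) := by
    intro L p q hm hp hq hne hL
    refine hm.localCrossings H.disjoint hL (i := id) (j := fun l => l + 1) (u := p)
      (v := fun l => q (l + 1)) hp (fun l => hq _) ?_ ?_ ?_
    · intro a b c d
      constructor
      · rintro ⟨rfl, rfl, rfl⟩
        exact ⟨a, rfl, rfl, rfl, rfl⟩
      · rintro ⟨l, rfl, rfl, rfl, rfl⟩
        exact ⟨rfl, rfl, rfl⟩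
    · intro l h
      exact absurd h (by revert l; decide)
    · rintro l l' (h | h)
      · exact h.1
      · exact absurd h.2.2 (hne l')
  have hX := key H.meets hp hq (fun i => (hpq i).ne) hL
  have hX' := key H.meets' hp' hq' (fun i => (hpq' i).ne') hL'
  have hmem : ∀ {L : Link X n} {p q : Fin 3 → ℝ}, (∀ i, p i ∈ Icc 0 (σ i).len) →
      (∀ i, q i ∈ Icc 0 (σ i).len) → (∀ i, ∀ u ∈ Icc 0 (σ i).len, L.curve ((σ i).pos u) ∈ D) →
      LocalCrossings L D (fun l => (σ l).pos (p l)) (fun l => (σ (l + 1)).pos (q (l + 1))) →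
      ∀ i, ∀ u ∈ Icc 0 (σ i).len, (σ i).pos u ∉ cutSource L.curve ↔ u = p i ∨ u = q i := by
    intro L p q hp hq hm hX i u hu
    rw [hX.mem_cutSource_iff (hm i u hu)]
    simp only [ne_eq, H.pos_eq_iff hu (hp _), H.pos_eq_iff hu (hq _)]
    push Not
    constructor
    · rintro ⟨l, hl⟩
      by_cases h : i = l ∧ u = p l
      · obtain ⟨rfl, h⟩ := h
        exact Or.inl h
      · obtain ⟨rfl, h'⟩ := hl fun h₁ h₂ => h ⟨h₁, h₂⟩
        exact Or.inr h'
    · rintro (rfl | rfl)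
      · exact ⟨i, fun h => absurd rfl (h rfl)⟩
      · refine ⟨i - 1, fun _ => ?_⟩
        rw [sub_add_cancel]
        exact ⟨rfl, rfl⟩
  -- After the move the crossing `q' i` comes first on the strand `i`, so it plays the role of the
  -- first cut.
  have hcut : CutTwice (cutSource L'.curve) σ q' p' :=
    { disjoint := H.disjoint
      lt := fun i => ⟨(hpqm' i).2.1, hpq' i, (hpqm' i).1.2⟩
      not_mem_iff := fun i u hu => by
        rw [hmem hp' hq' (fun i u hu => H.pos_mem' i hu) hX' i u hu, or_comm] }
  -- `θ` matches the cut points by their order on each strand, not by the crossing they come from.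
  -- Thus `q'` goes to `p` and `p'` to `q`, and on the cut domain of `L'` the crossings of `L` are
  -- seen at the pairs `q' l`, `p' (l + 1)`.
  obtain ⟨θ, hθ, hoff, hon, hθσ⟩ := exists_homeo_strands σ H.disjoint (a := q') (b := p') (a' := p)
    (b' := q) hcut.lt fun i => ⟨(hpqm i).1.1, hpq i, (hpqm i).2.2⟩
  have hUV : cutSource L'.curve = θ ⁻¹' cutSource L.curve := by
    refine H.cutSource_eq_preimage hoff fun i u hu => ?_
    rw [← not_iff_not, hcut.not_mem_iff i u hu]
    obtain ⟨v, hv, e⟩ := hon i u hu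
    rw [e, hmem hp hq (fun i u hu => H.pos_mem i hu) hX i v hv,
      H.param_eq_iff e hu hv (hq' i) (hp i) (hθσ i).1,
      H.param_eq_iff e hu hv (hp' i) (hq i) (hθσ i).2]
  constructor
  · rw [← one_mul L.bracket]
    refine H.bracket_eq hX hX' (fun l => (σ l).dir) (fun l => -(σ (l + 1)).dir)
      (fun l => (σ l).dir) (fun l => -(σ (l + 1)).dir) _ fun C => ?_
    rw [one_mul]
    have htr := stateCount_transfer L.finite_compl_cutSource L'.finite_compl_cutSource hθ hUV
      (H.outerSmoothing_homeo_iff C hoff hon)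
      (x := fun l => (σ l).pos (p l)) (x' := fun l => (σ (l + 1)).pos (q (l + 1)))
      (z := fun l => (σ l).pos (q' l)) (z' := fun l => (σ (l + 1)).pos (p' (l + 1)))
      (fun l => (hθσ l).1.symm) (fun l => (hθσ (l + 1)).2.symm) (fun l => (σ l).dir)
      (fun l => -(σ (l + 1)).dir)
    rw [funext htr]
    have hκ : (fun l => L'.dotted ((σ l).pos (p' l)) (σ l).dir ((σ (l + 1)).pos (q' (l + 1)))
        (-(σ (l + 1)).dir)) = fun l => L.dotted ((σ l).pos (p l)) (σ l).dir
        ((σ (l + 1)).pos (q (l + 1))) (-(σ (l + 1)).dir) := funext fun l => propext (hd l)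
    rw [hκ]
    clear htr
    set hU := L'.finite_compl_cutSource
    have hI := hcut.isolated hU (J := L.outerSmoothing D C) H.off_of_outerSmoothing
    have := finite_connectedComponents hU
    have := nonempty_components hU (σ 0).start
    have ht : TriangleEnds (branchBefore hU σ q') (branchAfter hU σ q') (branchAfter hU σ p')
        (crossingEnds hU (fun l => (σ l).pos (q' l)) fun l => (σ l).dir)
        (crossingEnds hU (fun l => (σ (l + 1)).pos (p' (l + 1))) fun l => -(σ (l + 1)).dir) :=
      { fst_pos := fun l => crossingEnds_one _ _ _ _
        fst_neg := fun l => crossingEnds_neg_one _ _ _ _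
        snd_pos := fun l => (crossingEnds_one _ _ _ _).trans (hcut.branchEnd_eq _ _).symm
        snd_neg := fun l => by rw [crossingEnds_neg_one, neg_neg]; rfl }
    -- With the ends at all crossings of `L'` reversed, the strand `l` runs back from its second
    -- cut. The picture is again that of `TriangleEnds`, entered from the other side.
    have ht' : TriangleEnds (branchAfter hU σ p') (branchAfter hU σ q') (branchBefore hU σ q')
        (fun l η => crossingEnds hU (fun l => (σ l).pos (p' l)) (fun l => (σ l).dir) l (-η))
        (fun l η => crossingEnds hU (fun l => (σ (l + 1)).pos (q' (l + 1)))
          (fun l => -(σ (l + 1)).dir) l (-η)) :=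
      { fst_pos := fun l => (crossingEnds_neg_one _ _ _ _).trans (hcut.branchEnd_eq _ _).symm
        fst_neg := fun l => by rw [neg_neg, crossingEnds_one]; rfl
        snd_pos := fun l => by rw [crossingEnds_neg_one, neg_neg]; rfl
        snd_neg := fun l => by rw [neg_neg, crossingEnds_one]; rfl }
    have hneg : stateCount (EndsJoined hU (L.outerSmoothing D C))
        (crossingEnds hU (fun l => (σ l).pos (p' l)) fun l => (σ l).dir)
        (crossingEnds hU (fun l => (σ (l + 1)).pos (q' (l + 1))) fun l => -(σ (l + 1)).dir) =
        stateCount (EndsJoined hU (L.outerSmoothing D C))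
        (fun l η => crossingEnds hU (fun l => (σ l).pos (p' l)) (fun l => (σ l).dir) l (-η))
        (fun l η => crossingEnds hU (fun l => (σ (l + 1)).pos (q' (l + 1)))
          (fun l => -(σ (l + 1)).dir) l (-η)) :=
      funext fun f => (stateCount_neg_ends _ _ f).symm
    rw [hneg]
    exact (ht.stateSum_eq ht' hI hn₁ hn₂).symm
  · rw [H.wri_eq hX hX', sub_add, sub_eq_self, sub_eq_zero]
    refine Finset.sum_congr rfl fun l _ => (Link.localSign_congr (hX.pair l).1 (hX'.pair l).1
      (hX.pair l).2 (hX'.pair l).2 rfl rfl (hd l)).symm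

/-- The local crossing and its dots are the same before and after; only its parameters on the two
strands change, which a homeomorphism of the domain undoes. -/
theorem MoveFive.bracket_wri {e : ℤˣ} (h : MoveFive e L L') :
    L'.bracket = L.bracket ∧ L'.wri = L.wri := by
  classical
  obtain ⟨φ, σ, -, H, -, -, r, r', p, p', hr, hr', hp, hp', hL, hL', hd, hd'⟩ := h
  have hpl : ∀ i, 0 < p i ∧ p i < (σ i).len := fun i => ⟨(hp i).1, (hp i).2.trans (hr i).1.2⟩
  have hpl' : ∀ i, 0 < p' i ∧ p' i < (σ i).len := fun i =>
    ⟨(hr' i).1.1.trans (hp' i).1, (hp' i).2⟩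
  have hpm : ∀ i, p i ∈ Icc 0 (σ i).len := fun i => ⟨(hpl i).1.le, (hpl i).2.le⟩
  have hpm' : ∀ i, p' i ∈ Icc 0 (σ i).len := fun i => ⟨(hpl' i).1.le, (hpl' i).2.le⟩
  have key : ∀ {L : Link X n} {p : Fin 2 → ℝ}, MeetsAlong L (range φ) (ridgeDiscRim φ) σ →
      (∀ i, p i ∈ Icc 0 (σ i).len) →
      CrossExactly L σ (fun i u j v => i = 0 ∧ j = 1 ∧ u = p 0 ∧ v = p 1) →
      LocalCrossings L (range φ) (fun _ : Fin 1 => (σ 0).pos (p 0)) (fun _ => (σ 1).pos (p 1)) := by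
    intro L p hm hp hL
    refine hm.localCrossings H.disjoint hL (i := fun _ => 0) (j := fun _ => 1) (u := fun _ => p 0)
      (v := fun _ => p 1) (fun _ => hp 0) (fun _ => hp 1) ?_ (by simp)
      fun _ _ _ => Subsingleton.elim _ _
    intro a b c d
    simp only [exists_const]
    tauto
  have hX := key H.meets hpm hL
  have hX' := key H.meets' hpm' hL'
  have hmem : ∀ {L : Link X n} {p : Fin 2 → ℝ}, (∀ i, p i ∈ Icc 0 (σ i).len) →
      (∀ i, ∀ u ∈ Icc 0 (σ i).len, L.curve ((σ i).pos u) ∈ range φ) →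
      LocalCrossings L (range φ) (fun _ : Fin 1 => (σ 0).pos (p 0)) (fun _ => (σ 1).pos (p 1)) →
      ∀ i, ∀ u ∈ Icc 0 (σ i).len, (σ i).pos u ∉ cutSource L.curve ↔ u = p i := by
    intro L p hp hm hX i u hu
    rw [hX.mem_cutSource_iff (hm i u hu)]
    simp only [ne_eq, H.pos_eq_iff hu (hp _), forall_const]
    fin_cases i <;> simp
  have hmem₁ := hmem hpm (fun i u hu => H.pos_mem i hu) hX
  have hmem₂ := hmem hpm' (fun i u hu => H.pos_mem' i hu) hX'
  -- Each strand has only one cut. The second point to be moved is a dummy, halfway between the cut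
  -- and the end of the strand.
  obtain ⟨θ, hθ, hoff, hon, hθσ⟩ := exists_homeo_strands σ H.disjoint (a := p')
    (b := fun i => (p' i + (σ i).len) / 2) (a' := p) (b' := fun i => (p i + (σ i).len) / 2)
    (fun i => by have := hpl' i; constructor <;> [skip; constructor] <;> linarith)
    (fun i => by have := hpl i; constructor <;> [skip; constructor] <;> linarith)
  have hUV : cutSource L'.curve = θ ⁻¹' cutSource L.curve := by
    refine H.cutSource_eq_preimage hoff fun i u hu => ?_
    rw [← not_iff_not, hmem₂ i u hu]
    obtain ⟨v, hv, e⟩ := hon i u hu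
    rw [e, hmem₁ i v hv, H.param_eq_iff e hu hv (hpm' i) (hpm i) (hθσ i).1]
  constructor
  · rw [← one_mul L.bracket]
    refine H.bracket_eq hX hX' (fun _ => (σ 0).dir) (fun _ => (σ 1).dir)
      (fun _ => (σ 0).dir) (fun _ => (σ 1).dir) _ fun C => ?_
    rw [one_mul]
    have htr := stateCount_transfer L.finite_compl_cutSource L'.finite_compl_cutSource hθ hUV
      (H.outerSmoothing_homeo_iff C hoff hon)
      (x := fun _ : Fin 1 => (σ 0).pos (p 0)) (x' := fun _ => (σ 1).pos (p 1))
      (z := fun _ => (σ 0).pos (p' 0)) (z' := fun _ => (σ 1).pos (p' 1))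
      (fun l => (hθσ 0).1.symm) (fun l => (hθσ 1).1.symm) (fun _ => (σ 0).dir)
      (fun _ => (σ 1).dir)
    rw [funext htr]
    congr 1
    funext
    exact propext (hd'.trans hd.symm)
  · rw [H.wri_eq hX hX', sub_add, sub_eq_self, sub_eq_zero]
    refine Finset.sum_congr rfl fun l _ => (Link.localSign_congr (hX.pair l).1 (hX'.pair l).1
      (hX.pair l).2 (hX'.pair l).2 rfl rfl (hd'.trans hd.symm)).symm

/-- Without crossings in `D` on either side, the cut domains and all joined ends of the two links
are literally equal. -/
lemma Replaces.bracket_wri_of_noCrossings (H : Replaces L L' D bd σ) (hL : NoCrossings L σ)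
    (hL' : NoCrossings L' σ) : L'.bracket = L.bracket ∧ L'.wri = L.wri := by
  have hX := H.meets.localCrossings_empty H.disjoint hL
  have hX' := H.meets'.localCrossings_empty H.disjoint hL'
  have hU : cutSource L'.curve = cutSource L.curve := by
    ext s
    by_cases hs : L.curve s ∈ D
    · rw [hX.mem_cutSource_iff hs, hX'.mem_cutSource_iff ((H.mem_iff s).2 hs)]
    · exact H.mem_cutSource_iff hs
  constructor
  · rw [← one_mul L.bracket]
    refine H.bracket_eq hX hX' (fun l => l.elim0) (fun l => l.elim0) (fun l => l.elim0)
      (fun l => l.elim0) _ fun C => ?_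
    rw [one_mul, stateSum_zero, stateSum_zero, stateCount_zero, stateCount_zero, hU]
  · rw [H.wri_eq hX hX']
    simp

theorem MoveFour.bracket_wri (h : MoveFour L L') : L'.bracket = L.bracket ∧ L'.wri = L.wri := by
  obtain ⟨φ, σ, -, H, -, -, hL, hL', -⟩ := h
  exact H.bracket_wri_of_noCrossings hL hL'

theorem MoveSix.bracket_wri (h : MoveSix L L') : L'.bracket = L.bracket ∧ L'.wri = L.wri := by
  obtain ⟨φ, σ, -, H, -, -, hL, hL', -⟩ := h
  exact H.bracket_wri_of_noCrossings hL hL'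

theorem MoveSeven.bracket_wri (h : MoveSeven L L') : L'.bracket = L.bracket ∧ L'.wri = L.wri := by
  obtain ⟨x, G, N, h, γ, σ, -, -, -, -, H, hL, hL'⟩ := h
  exact H.bracket_wri_of_noCrossings hL hL'

end MoveInvariance

/-! ### Reparametrizations, ambient isotopies and local links -/

section Transport

open LaurentPolynomial

variable {X : Type*} [TopologicalSpace X] {n : ℕ} {L L' : Link X n}

/-- The circle is connected, so each circle is mapped into a single one. -/
lemma component_eq_of_homeo (θ : Source n ≃ₜ Source n) {s t : Source n} (h : s.1 = t.1) :
    (θ s).1 = (θ t).1 := by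
  obtain ⟨i, x⟩ := s
  obtain ⟨j, y⟩ := t
  obtain rfl : i = j := h
  have hc : Continuous fun x : UnitAddCircle => (θ (i, x)).1 :=
    continuous_fst.comp (θ.continuous.comp (by fun_prop))
  exact PreconnectedSpace.constant inferInstance hc

theorem Reparametrizes.bracket_wri (h : Reparametrizes L L') :
    L'.bracket = L.bracket ∧ L'.wri = L.wri := by
  classical
  obtain ⟨θ, e, hθ, hc, hd⟩ := h
  have hcross : L'.crossingSet = L.crossingSet := by
    ext y
    rw [L'.mem_crossingSet, L.mem_crossingSet]
    constructor
    · rintro ⟨s, t, hst, hs, ht⟩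
      exact ⟨θ s, θ t, θ.injective.ne hst, hc s ▸ hs, hc t ▸ ht⟩
    · rintro ⟨s, t, hst, hs, ht⟩
      exact ⟨θ.symm s, θ.symm t, θ.symm.injective.ne hst, by simp [hc, hs], by simp [hc, ht]⟩
  have hcut : cutSource L'.curve = θ ⁻¹' cutSource L.curve := by
    ext s
    simp only [cutSource, mem_ofPred_eq, mem_preimage, hc]
    constructor
    · intro h t ht
      rw [← h (θ.symm t) (by simpa using ht), θ.apply_symm_apply]
    · exact fun h t ht => θ.injective (h _ ht)
  constructor
  · have hnum : ∀ C, L'.numCurves C = L.numCurves C := by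
      intro C
      rw [Link.numCurves, Link.numCurves, smoothingCount_eq_arcCount, smoothingCount_eq_arcCount,
        hcut, ← arcCount_preimage L.finite_compl_cutSource _ hθ]
      congr 1
      funext s ε t δ
      simp only [Link.smoothing, hc, hd, ne_eq, θ.injective.eq_iff]
    simp only [Link.bracket, hcross, hnum]
  · rw [Link.wri_eq_sum, Link.wri_eq_sum, hcross]
    refine Finset.sum_congr rfl fun y hy => ?_
    rw [← hcross, Link.mem_crossingSet] at hy
    obtain ⟨s, t, hst, rfl, ht⟩ := hy
    have hst' := θ.injective.ne hst
    have ht' : L.curve (θ s) = L.curve (θ t) := by rw [← hc, ← hc, ht]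
    rw [L'.selfSign_eq_localSign hst ht.symm, hc, L.selfSign_eq_localSign hst' ht', Link.localSign,
      Link.localSign]
    by_cases hi : s.1 = t.1
    · rw [if_pos hi, if_pos (component_eq_of_homeo θ hi)]
      refine if_congr ?_ rfl rfl
      -- At a self-crossing both directions change by the same sign `e`, and `e * e = 1`. This is
      -- why the writhe does not depend on the directions.
      rw [hd, L.dotted_iff hst' ht', hi]
      simp [Int.units_mul_self]
    · rw [if_neg hi, if_neg fun h => hi (by simpa using component_eq_of_homeo θ.symm h)]

lemma cutSource_comp {Y Z : Type*} {g : Y → Z} (hg : Function.Injective g) (c : Source n → Y) :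
    cutSource (g ∘ c) = cutSource c := by
  simp only [cutSource, Function.comp, hg.eq_iff]

/-- The count depends only on which points of the circles have equal images, and an injective map
does not change this. -/
lemma smoothingCount_comp {Y Z : Type*} {g : Y → Z} (hg : Function.Injective g)
    (c : Source n → Y) (J : Source n → ℤˣ → Source n → ℤˣ → Prop) :
    smoothingCount (g ∘ c) J = smoothingCount c J := by
  rw [smoothingCount_eq_arcCount, smoothingCount_eq_arcCount, cutSource_comp hg]

lemma crossings_comp {Y Z : Type*} {g : Y → Z} (hg : Function.Injective g) (c : Source n → Y) :
    crossings (g ∘ c) = g '' crossings c := by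
  ext z
  constructor
  · rintro ⟨s, t, hst, rfl, ht⟩
    exact ⟨c s, ⟨s, t, hst, rfl, hg ht⟩, rfl⟩
  · rintro ⟨y, ⟨s, t, hst, rfl, ht⟩, rfl⟩
    exact ⟨s, t, hst, rfl, congrArg g ht⟩

lemma selfCrossings_comp {Y Z : Type*} {g : Y → Z} (hg : Function.Injective g) (c : Source n → Y)
    (i : Fin n) : selfCrossings (g ∘ c) i = g '' selfCrossings c i := by
  ext z
  constructor
  · rintro ⟨s, t, hst, hs, ht, rfl, h⟩
    exact ⟨c s, ⟨s, t, hst, hs, ht, rfl, hg h⟩, rfl⟩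
  · rintro ⟨y, ⟨s, t, hst, hs, ht, rfl, h⟩, rfl⟩
    exact ⟨s, t, hst, hs, ht, rfl, congrArg g h⟩

lemma sum_powerset_image {Y Z M : Type*} [DecidableEq Z] [AddCommMonoid M] {g : Y → Z}
    (hg : Function.Injective g) (S : Finset Y) (F : Finset Z → M) :
    ∑ C ∈ (S.image g).powerset, F C = ∑ C ∈ S.powerset, F (C.image g) := by
  rw [Finset.powerset_image, Finset.sum_image]
  exact (Finset.image_injective hg).injOn

theorem AmbientIsotopic.bracket_wri (h : AmbientIsotopic L L') :
    L'.bracket = L.bracket ∧ L'.wri = L.wri := by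
  classical
  obtain ⟨H, -, -, hc, hd⟩ := h
  have hg := (H 1).injective
  set g : X → X := ⇑(H 1)
  have hc' : L'.curve = g ∘ L.curve := funext hc
  have hcross : L'.crossingSet = L.crossingSet.image g := by
    rw [← Finset.coe_inj]
    simp [Link.crossingSet, hc', crossings_comp hg]
  constructor
  · rw [Link.bracket, Link.bracket, hcross, sum_powerset_image hg]
    refine Finset.sum_congr rfl fun C _ => ?_
    rw [Finset.card_image_of_injective _ hg, Finset.card_image_of_injective _ hg]
    congr 3
    rw [Link.numCurves, Link.numCurves, hc', smoothingCount_comp hg]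
    congr 1
    funext s ε t δ
    simp only [Link.smoothing, hc, hd, hg.eq_iff, Finset.mem_image, exists_eq_right]
  · rw [Link.wri_eq_sum, Link.wri_eq_sum, hcross, Finset.sum_image hg.injOn]
    refine Finset.sum_congr rfl fun y hy => ?_
    obtain ⟨s, t, hst, rfl, ht⟩ := (L.mem_crossingSet y).1 hy
    have ht' : L'.curve s = L'.curve t := by rw [hc, hc, ht]
    rw [← hc, L'.selfSign_eq_localSign hst ht', L.selfSign_eq_localSign hst ht.symm]
    exact Link.localSign_congr hst hst ht.symm ht' rfl rfl (hd s 1 t 1)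

/-- Swept areas are dotted areas, so the smoothings correspond, and `A ^ |C| (A⁻¹) ^ (cro - |C|)` is
`A ^ (2|C| - cro)`. -/
theorem Diagram.localLink_bracket (D : Diagram n) (f : ℝ × ℝ → X) (hf : IsOpenEmbedding f)
    (hX : range f ⊆ interiorPts X) : (D.localLink f hf hX).bracket = D.kauffmanBracket := by
  classical
  have hg := hf.injective
  have hcross : (D.localLink f hf hX).crossingSet = D.crossingSet.image f := by
    rw [← Finset.coe_inj]
    simp [Link.crossingSet, Diagram.crossingSet, Diagram.localLink, crossings_comp hg]
  rw [Link.bracket, Diagram.kauffmanBracket, hcross, sum_powerset_image hg]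
  refine Finset.sum_congr rfl fun C hC => ?_
  rw [Finset.card_image_of_injective _ hg, Finset.card_image_of_injective _ hg, mul_comm]
  have hnum : (D.localLink f hf hX).numCurves (C.image f) = smoothingCount D.curve (D.state C) := by
    rw [Link.numCurves, ← smoothingCount_comp hg]
    congr 1
    funext s ε t δ
    simp only [Link.smoothing, Diagram.state, Diagram.localLink, Function.comp, hg.eq_iff,
      Finset.mem_image, exists_eq_right]
  have hcard := Finset.card_le_card (Finset.mem_powerset.1 hC)
  rw [hnum, T_pow, T_pow, ← T_add]
  congr 2
  -- `|C| ≤ cro` is needed to cast the truncated difference.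
  push_cast [hcard]
  ring

/-- The area between the outgoing half-branches is swept exactly if the underpassing direction lies
counterclockwise from the overpassing one, which is the usual definition of a positive crossing. -/
theorem Diagram.localLink_wri (D : Diagram n) (f : ℝ × ℝ → X) (hf : IsOpenEmbedding f)
    (hX : range f ⊆ interiorPts X) : (D.localLink f hf hX).wri = D.selfWrithe := by
  classical
  have hg := hf.injective
  refine Finset.sum_congr rfl fun i _ => ?_
  have hself : (D.localLink f hf hX).selfCrossingSet i = (D.selfCrossingSet i).image f := by
    rw [← Finset.coe_inj]
    simp [Link.selfCrossingSet, Diagram.selfCrossingSet, Diagram.localLink, selfCrossings_comp hg]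
  rw [hself, Finset.sum_image hg.injOn]
  refine Finset.sum_congr rfl fun y _ => ?_
  rw [Link.sign, Diagram.sign]
  refine if_congr ?_ rfl rfl
  simp only [Diagram.localLink, Function.comp, hg.eq_iff, Diagram.Swept, Units.val_one,
    Int.cast_one, one_mul]
  constructor
  · rintro ⟨s, t, hs, ht, hst, -, h | h⟩
    · exact ⟨s, t, hst, hs, ht, h⟩
    · exact ⟨t, s, hst.symm, ht, hs, h⟩
  · rintro ⟨s, t, hst, hs, ht, h⟩
    exact ⟨s, t, hs, ht, hst, hs.trans ht.symm, Or.inl h⟩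

lemma Link.normalizedBracket_congr (h : L'.bracket = L.bracket ∧ L'.wri = L.wri) :
    L'.normalizedBracket = L.normalizedBracket := by
  rw [Link.normalizedBracket, Link.normalizedBracket, h.1, h.2]

lemma negCube_zpow (e : ℤˣ) :
    ((negCube ^ (e : ℤ) : (LaurentPolynomial ℤ)ˣ) : LaurentPolynomial ℤ) = -T (3 * (e : ℤ)) := by
  rcases Int.units_eq_one_or e with rfl | rfl
  · simp [negCube]
  · rw [Units.val_neg, Units.val_one, zpow_neg_one]
    rfl

/-- The bracket gains the factor `(-A³) ^ e`, and the normalization loses it because the writhe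
grows by `e`. -/
theorem MoveOne.normalizedBracket_eq {e : ℤˣ} (h : MoveOne e L L') :
    L'.normalizedBracket = L.normalizedBracket := by
  obtain ⟨h₁, h₂⟩ := h.bracket_wri
  rw [Link.normalizedBracket, Link.normalizedBracket, h₁, h₂, ← negCube_zpow, ← mul_assoc,
    ← Units.val_mul, ← zpow_add]
  congr 3
  ring

theorem Isotopic.normalizedBracket_eq (h : Isotopic L L') :
    L'.normalizedBracket = L.normalizedBracket := by
  induction h with
  | rel L L' h =>
    cases h with
    | reparam h => exact Link.normalizedBracket_congr h.bracket_wri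
    | ambient h => exact Link.normalizedBracket_congr h.bracket_wri
    | moveOne e h => exact h.normalizedBracket_eq
    | moveTwo h => exact Link.normalizedBracket_congr h.bracket_wri
    | moveThree h => exact Link.normalizedBracket_congr h.bracket_wri
    | moveFour h => exact Link.normalizedBracket_congr h.bracket_wri
    | moveFive e h => exact Link.normalizedBracket_congr h.bracket_wri
    | moveSix h => exact Link.normalizedBracket_congr h.bracket_wri
    | moveSeven h => exact Link.normalizedBracket_congr h.bracket_wri
  | refl => rfl
  | symm _ _ _ ih => exact ih.symm
  | trans _ _ _ _ _ ih₁ ih₂ => exact ih₂.trans ih₁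

end Transport

end LinksInTwoComplexes

theorem mainTheorem3 {X : Type*} [TopologicalSpace X] [ConnectedSpace X] (hX : IsTwoComplex X)
    {n : ℕ} (hn : 0 < n) :
    (∀ L L' : Link X n, Reparametrizes L L' → L'.bracket = L.bracket ∧ L'.wri = L.wri) ∧
    (∀ L L' : Link X n, MoveTwo L L' → L'.bracket = L.bracket) ∧
    (∀ L L' : Link X n, MoveThree L L' → L'.bracket = L.bracket) ∧
    (∀ L L' : Link X n, MoveFour L L' → L'.bracket = L.bracket) ∧
    (∀ (e : ℤˣ) (L L' : Link X n), MoveFive e L L' → L'.bracket = L.bracket) ∧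
    (∀ L L' : Link X n, MoveSix L L' → L'.bracket = L.bracket) ∧
    (∀ L L' : Link X n, MoveSeven L L' → L'.bracket = L.bracket) ∧
    (∀ L L' : Link X n, MoveOne 1 L L' →
      L'.bracket = -LaurentPolynomial.T 3 * L.bracket) ∧
    (∀ L L' : Link X n, MoveOne (-1) L L' →
      L'.bracket = -LaurentPolynomial.T (-3) * L.bracket) ∧
    (∀ L L' : Link X n, Isotopic L L' → L'.normalizedBracket = L.normalizedBracket) ∧
    (∀ (D : Diagram n) (f : ℝ × ℝ → X) (hf : Topology.IsOpenEmbedding f)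
      (hfX : Set.range f ⊆ interiorPts X),
      (D.localLink f hf hfX).bracket = D.kauffmanBracket ∧
      (D.localLink f hf hfX).wri = D.selfWrithe) := by
  refine ⟨fun _ _ h => h.bracket_wri, fun _ _ h => h.bracket_wri.1, fun _ _ h => h.bracket_wri.1,
    fun _ _ h => h.bracket_wri.1, fun _ _ _ h => h.bracket_wri.1, fun _ _ h => h.bracket_wri.1,
    fun _ _ h => h.bracket_wri.1, fun _ _ h => ?_, fun _ _ h => ?_,
    fun _ _ h => h.normalizedBracket_eq,
    fun D f hf hfX => ⟨D.localLink_bracket f hf hfX, D.localLink_wri f hf hfX⟩⟩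
  · simpa using h.bracket_wri.1
  · simpa using h.bracket_wri.1
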